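/- Let $n\ge 1$ be an integer and let $0\le\alpha<n$, $1<p<n/\alpha$ (that is, $1<p<\infty$ if $\alpha=0$), $\frac1q=\frac1p-\frac\alpha n$ and $p'=\frac p{p-1}$. For scalar (real or complex) functions $f$ on $\mathbb R^n$ put $$M_\alpha f(x)=\sup_{Q\ni x}\frac1{|Q|^{1-\alpha/n}}\int_Q|f(y)|\,dy,\qquad I_\alpha f(x)=\int_{\mathbb R^n}\frac{f(y)}{|x-y|^{n-\alpha}}\,dy\quad(\alpha>0),$$ where $Q$ runs over the cubes with sides parallel to the axes. Let $A_{p,q}$ be the class of locally integrable, almost everywhere positive functions $w$ on $\mathbb R^n$ with $$[w]_{A_{p,q}}=\sup_Q\Big(\frac1{|Q|}\int_Q w^q\,dx\Big)\Big(\frac1{|Q|}\int_Q w^{-p'}\,dx\Big)^{q/p'}<\infty .$$ (a) For every $w\in A_{p,q}$, $M_\alpha$ maps $L^p(w^p)$ into $L^q(w^q)$, and there is a constant $c$ that does not depend on $w$ with $$\|M_\alpha\|_{L^p(w^p)\to L^q(w^q)}\le c\,[w]_{A_{p,q}}^{\frac{p'}q(1-\frac\alpha n)}\qquad\text{for all }w\in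 A_{p,q}.$$ The exponent is sharp: if $\beta\in\mathbb R$ and there is a constant $c$ with $\|M_\alpha\|_{L^p(w^p)\to L^q(w^q)}\le c\,[w]_{A_{p,q}}^{\beta}$ for all $w\in A_{p,q}$, then $\beta\ge\frac{p'}q(1-\frac\alpha n)$. (b) Suppose in addition that $\alpha>0$. For every $w\in A_{p,q}$ and $f\in L^p(w^p)$ the integral $I_\alpha f(x)$ converges absolutely for almost every $x$ and $I_\alpha f\in L^q(w^q)$, and there is a constant $c$ that does not depend on $w$ with $$\|I_\alpha\|_{L^p(w^p)\to L^q(w^q)}\le c\,[w]_{A_{p,q}}^{(1-\frac\alpha n)\max\{1,\frac{p'}q\}}\qquad\text{for all }w\in A_{p,q}.$$ The exponent is sharp: if $\beta\in\mathbb R$ and there is a constant $c$ with $\|I_\alpha\|_{L^p(w^p)\to L^q(w^q)}\le c\,[w]_{A_{p,q}}^{\beta}$ for all $w\in A_{p,q}$, then $\beta\ge(1-\frac\alpha n)\max\{1,\frac{p'}q\}$. -/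

import Mathlib

open MeasureTheory
open scoped ENNReal

noncomputable section

namespace FracOp

/-- The closed cube with sides parallel to the axes, lower corner `a` and side length `l`. -/
def cube {n : ℕ} (a : EuclideanSpace ℝ (Fin n)) (l : ℝ) : Set (EuclideanSpace ℝ (Fin n)) :=
  {y | ∀ i, a i ≤ y i ∧ y i ≤ a i + l}

/-- The constant `[w]_{A_{p,q}}`: the supremum over all cubes `Q` of
`(⨍_Q w^q) (⨍_Q w^{-p'})^{q/p'}`, with values in `[0,∞]`, where `p' = p/(p-1)`. -/
def apqConst {n : ℕ} (p q : ℝ) (w : EuclideanSpace ℝ (Fin n) → ℝ) : ℝ≥0∞ :=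
  ⨆ (a : EuclideanSpace ℝ (Fin n)) (l : ℝ) (_ : 0 < l),
    (⨍⁻ x in cube a l, ENNReal.ofReal (w x) ^ q ∂volume) *
      (⨍⁻ x in cube a l, ENNReal.ofReal (w x) ^ (-p.conjExponent) ∂volume) ^ (q / p.conjExponent)

/-- `w` is a weight of class `A_{p,q}`: a locally integrable function, positive almost everywhere,
with `[w]_{A_{p,q}} < ∞`. -/
structure IsApqWeight {n : ℕ} (p q : ℝ) (w : EuclideanSpace ℝ (Fin n) → ℝ) : Prop where
  locallyIntegrable : LocallyIntegrable w
  ae_pos : ∀ᵐ x, 0 < w x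
  apqConst_lt_top : apqConst p q w < ∞

/-- The measure `w^r dx`. -/
def weightMeasure {n : ℕ} (w : EuclideanSpace ℝ (Fin n) → ℝ) (r : ℝ) :
    Measure (EuclideanSpace ℝ (Fin n)) :=
  volume.withDensity fun x => ENNReal.ofReal (w x) ^ r

/-- The fractional maximal operator: `M_α f(x)` is the supremum over all cubes `Q` containing `x`
of `|Q|^{-(1-α/n)} ∫_Q |f|`, with values in `[0,∞]`. -/
def fracMaximal {𝕜 : Type*} [RCLike 𝕜] {n : ℕ} (α : ℝ) (f : EuclideanSpace ℝ (Fin n) → 𝕜)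
    (x : EuclideanSpace ℝ (Fin n)) : ℝ≥0∞ :=
  ⨆ (a : EuclideanSpace ℝ (Fin n)) (l : ℝ) (_ : 0 < l) (_ : x ∈ cube a l),
    (∫⁻ y in cube a l, ‖f y‖ₑ) / volume (cube a l) ^ (1 - α / n)

/-- The integrand `y ↦ f(y) / |x-y|^{n-α}` of the Riesz potential at `x`. -/
def rieszIntegrand {𝕜 : Type*} [RCLike 𝕜] {n : ℕ} (α : ℝ) (f : EuclideanSpace ℝ (Fin n) → 𝕜)
    (x y : EuclideanSpace ℝ (Fin n)) : 𝕜 :=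
  f y / ((‖x - y‖ ^ ((n : ℝ) - α) : ℝ) : 𝕜)

/-- The fractional integral (Riesz potential) `I_α f(x) = ∫ f(y) / |x-y|^{n-α} dy`. -/
def fracIntegral {𝕜 : Type*} [RCLike 𝕜] {n : ℕ} (α : ℝ) (f : EuclideanSpace ℝ (Fin n) → 𝕜)
    (x : EuclideanSpace ℝ (Fin n)) : 𝕜 :=
  ∫ y, rieszIntegrand α f x y

/-- The operator norm `‖T‖_{L^p(w^p) → L^q(w^q)}`: the infimum of all `N ∈ [0,∞]` such that
`‖T f‖_{L^q(w^q)} ≤ N ‖f‖_{L^p(w^p)}` for all `f ∈ L^p(w^p)`; it is `∞` if `T` is unbounded. -/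
def weightedOpNorm {𝕜 F : Type*} [RCLike 𝕜] [ENorm F] {n : ℕ} (p q : ℝ)
    (w : EuclideanSpace ℝ (Fin n) → ℝ)
    (T : (EuclideanSpace ℝ (Fin n) → 𝕜) → EuclideanSpace ℝ (Fin n) → F) : ℝ≥0∞ :=
  sInf {N : ℝ≥0∞ | ∀ f : EuclideanSpace ℝ (Fin n) → 𝕜,
    MemLp f (ENNReal.ofReal p) (weightMeasure w p) →
      eLpNorm (T f) (ENNReal.ofReal q) (weightMeasure w q) ≤
        N * eLpNorm f (ENNReal.ofReal p) (weightMeasure w p)}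

/-- The weighted bound with exponent `β`: there is a constant `C`, independent of the weight, with
`‖T‖_{L^p(w^p) → L^q(w^q)} ≤ C [w]_{A_{p,q}}^β` for every `w ∈ A_{p,q}`. -/
def WeightedBound {𝕜 F : Type*} [RCLike 𝕜] [ENorm F] {n : ℕ} (p q β : ℝ)
    (T : (EuclideanSpace ℝ (Fin n) → 𝕜) → EuclideanSpace ℝ (Fin n) → F) : Prop :=
  ∃ C : ℝ, ∀ w : EuclideanSpace ℝ (Fin n) → ℝ, IsApqWeight p q w →
    weightedOpNorm p q w T ≤ ENNReal.ofReal C * apqConst p q w ^ β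

end FracOp

end

section

open Set
open scoped NNReal

noncomputable section

namespace FracOp

/-! Put `A = 1/q`, `B = 1/p'`, `U = w^q`, `S = w^(-p')` and `K = [w]^(1/q)`. Then `A + B = 1 - α/n`,
`U^A S^B = 1`, and the weight condition becomes `U(Q)^A S(Q)^B ≤ K |Q|^(A+B)`, which is symmetric
under exchanging `(A, U)` and `(B, S)`. In this notation the claimed bounds are `K^((A+B)/B)` for
the maximal operator and `K^((A+B)/B) + K^((A+B)/A)` for the fractional integral. A one-third trick
(`exists_cube_subset_grid`) dominates both operators by finitely many dyadic ones, and writing `|f|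
= h S` turns them into operators between `L^p(S dx)` and `L^q(U dx)`.

Maximal operator: the dyadic maximal function of any measure is bounded on its own `L^s`, `s > 1`,
with a constant independent of the measure. `WeightPair.rpow_neg_le` bounds a dyadic fractional
average by `K^((A+B)/B)` times a power of a `U`-average of a function built from a maximal function
for `S`. Two such measure-independent bounds then give `WeightPair.recipNorm_dyadicSup_le`, so that
`K` enters only once.

Fractional integral: a two weight testing theorem (`exists_bound_of_testing`), proved with stopping
sets, reduces the bound to testing on the sets of the grid, in both directions. In a testing sum
over `Q ⊆ F` the terms are controlled by geometric sequences in `|Q|`, so the sum is at most a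
constant times the geometric mean of two fractional maximal functions of the indicator of `F`, with
orders on either side of `A + B`. The sharp maximal bound therefore yields the testing constants
(`exists_testing_bound`), with `K^((A+B)/B)` in one direction and, by symmetry, `K^((A+B)/A)` in the
other.

Sharpness: the weight `|x|^((n-δ)/p')` tested on `|x|^(δ-n)` in the unit ball forces the exponent
`(p'/q)(1-α/n)` for both operators as `δ → 0`. The weight `|x|^(-(n-δ)/q)` tested on a power outside
the unit ball forces `1 - α/n` for the fractional integral. -/

lemma le_rpow_of_le_mul_rpow {I c : ℝ≥0∞} {s : ℝ} (hs : 1 < s) (hI : I ≠ ∞)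
    (h : I ≤ c * I ^ (1 - 1 / s)) : I ≤ c ^ s := by
  have hs0 : 0 < s := by linarith
  rcases eq_or_ne I 0 with rfl | h0
  · simp
  have h1 : I ^ (1 / s) ≤ c := by
    have h2 : I ^ (1 - 1 / s) ≠ 0 := by simp [ENNReal.rpow_eq_zero_iff, h0, hI]
    have h3 : I ^ (1 - 1 / s) ≠ ∞ := by simp [ENNReal.rpow_eq_top_iff, h0, hI]
    refine (ENNReal.mul_le_mul_iff_left h2 h3).1 ?_
    rw [← ENNReal.rpow_add _ _ h0 hI]
    simpa using h
  calc I = (I ^ (1 / s)) ^ s := by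
        rw [← ENNReal.rpow_mul, one_div_mul_cancel hs0.ne', ENNReal.rpow_one]
    _ ≤ c ^ s := ENNReal.rpow_le_rpow h1 hs0.le

/-! ### Suprema over families of sets -/

section Family

variable {X : Type*} {D : Set (Set X)} {a : Set X → ℝ≥0∞}

/-- The supremum of the numbers `a Q` over the sets `Q` of the family `D` that contain `x`. -/
def dyadicSup (D : Set (Set X)) (a : Set X → ℝ≥0∞) (x : X) : ℝ≥0∞ :=
  ⨆ Q ∈ D, Q.indicator (fun _ => a Q) x

lemma le_dyadicSup {Q : Set X} (hQ : Q ∈ D) {x : X} (hx : x ∈ Q) : a Q ≤ dyadicSup D a x := by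
  refine le_trans ?_ (le_iSup₂ (f := fun Q (_ : Q ∈ D) => Q.indicator (fun _ => a Q) x) Q hQ)
  simp [hx]

lemma dyadicSup_le {x : X} {c : ℝ≥0∞} (h : ∀ Q ∈ D, x ∈ Q → a Q ≤ c) : dyadicSup D a x ≤ c := by
  refine iSup₂_le fun Q hQ => ?_
  by_cases hx : x ∈ Q
  · simpa [hx] using h Q hQ hx
  · simp [hx]

lemma lt_dyadicSup_iff {x : X} {t : ℝ≥0∞} :
    t < dyadicSup D a x ↔ ∃ Q ∈ D, x ∈ Q ∧ t < a Q := by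
  constructor
  · intro h
    by_contra! hc
    exact absurd (dyadicSup_le hc) (not_le.2 h)
  · rintro ⟨Q, hQ, hx, ht⟩
    exact ht.trans_le (le_dyadicSup hQ hx)

lemma dyadicSup_rpow {s : ℝ} (hs : 0 < s) (x : X) :
    dyadicSup D a x ^ s = dyadicSup D (fun Q => a Q ^ s) x := by
  refine le_antisymm ?_ (dyadicSup_le fun Q hQ hx => ENNReal.rpow_le_rpow (le_dyadicSup hQ hx) hs.le)
  have h : dyadicSup D a x ≤ dyadicSup D (fun Q => a Q ^ s) x ^ s⁻¹ := by
    refine dyadicSup_le fun Q hQ hx => ?_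
    rw [ENNReal.le_rpow_inv_iff hs]
    exact le_dyadicSup (a := fun Q => a Q ^ s) hQ hx
  rwa [ENNReal.le_rpow_inv_iff hs] at h

lemma coe_map_subtype_subset (𝒬 : Finset D) :
    (↑(𝒬.map (Function.Embedding.subtype _)) : Set (Set X)) ⊆ D := fun Q hQ => by
  simp only [Finset.coe_map, mem_image] at hQ
  obtain ⟨P, -, rfl⟩ := hQ
  exact P.2

lemma iSup_finset_subset_eq (φ : Finset (Set X) → ℝ≥0∞) :
    (⨆ (𝒬 : Finset (Set X)) (_ : ↑𝒬 ⊆ D), φ 𝒬) =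
      ⨆ 𝒬 : Finset D, φ (𝒬.map (Function.Embedding.subtype _)) := by
  classical
  refine le_antisymm (iSup₂_le fun 𝒬 h𝒬 => ?_) (iSup_le fun 𝒬 =>
    le_iSup₂ (f := fun (𝒬 : Finset (Set X)) (_ : ↑𝒬 ⊆ D) => φ 𝒬) (𝒬.map _) fun Q hQ => ?_)
  · refine le_trans (le_of_eq ?_) (le_iSup _ (𝒬.subtype (· ∈ D)))
    congr 1
    ext Q
    simp only [Finset.mem_map, Finset.mem_subtype, Function.Embedding.subtype_apply]
    exact ⟨fun hQ => ⟨⟨Q, h𝒬 hQ⟩, hQ, rfl⟩, by rintro ⟨P, hP, rfl⟩; exact hP⟩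
  · exact coe_map_subtype_subset 𝒬 hQ

end Family

/-! ### Maximal functions of nested families, for an arbitrary measure -/

section Nested

variable {X : Type*} [MeasurableSpace X]

/-- A countable family of measurable sets, any two of which are nested or disjoint. -/
structure IsNested (D : Set (Set X)) : Prop where
  countable : D.Countable
  measurableSet : ∀ Q ∈ D, MeasurableSet Q
  nested : ∀ P ∈ D, ∀ Q ∈ D, P ⊆ Q ∨ Q ⊆ P ∨ Disjoint P Q

lemma IsNested.mono {D D' : Set (Set X)} (hD : IsNested D) (h : D' ⊆ D) : IsNested D' :=
  ⟨hD.countable.mono h, fun Q hQ => hD.measurableSet Q (h hQ),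
    fun P hP Q hQ => hD.nested P (h hP) Q (h hQ)⟩

variable {D : Set (Set X)} {a : Set X → ℝ≥0∞}

lemma IsNested.measurable_dyadicSup (hD : IsNested D) : Measurable (dyadicSup D a) :=
  Measurable.biSup D hD.countable fun Q hQ =>
    measurable_const.indicator (hD.measurableSet Q hQ)

/-- The maximal sets of a finite nested family are pairwise disjoint and have the same union, so the
inequality can be summed over them. -/
lemma measure_biUnion_le_of_nested {𝒬 : Finset (Set X)} (hD : IsNested (𝒬 : Set (Set X)))
    {μ ν : Measure X} (h : ∀ Q ∈ 𝒬, μ Q ≤ ν Q) : μ (⋃ Q ∈ 𝒬, Q) ≤ ν (⋃ Q ∈ 𝒬, Q) := by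
  classical
  set M := 𝒬.filter (Maximal (· ∈ 𝒬)) with hM
  have hU : (⋃ Q ∈ 𝒬, Q) = ⋃ Q ∈ M, Q := by
    refine Subset.antisymm ?_ (biUnion_subset_biUnion_left fun Q hQ => Finset.filter_subset _ _ hQ)
    refine iUnion₂_subset fun Q hQ => ?_
    obtain ⟨P, hQP, hP⟩ := 𝒬.exists_le_maximal hQ
    exact subset_trans hQP (subset_biUnion_of_mem (u := fun Q => Q)
      (Finset.mem_filter.2 ⟨hP.prop, hP⟩ : P ∈ M))
  have hd : PairwiseDisjoint (↑M : Set (Set X)) (fun Q => Q) := by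
    intro P hP Q hQ hne
    have hP' := Finset.mem_filter.1 hP
    have hQ' := Finset.mem_filter.1 hQ
    rcases hD.nested P hP'.1 Q hQ'.1 with h | h | h
    · exact absurd (hP'.2.eq_of_le hQ'.1 h) hne
    · exact absurd (hQ'.2.eq_of_le hP'.1 h).symm hne
    · exact h
  have hm : ∀ Q ∈ M, MeasurableSet Q := fun Q hQ =>
    hD.measurableSet Q (Finset.filter_subset _ _ hQ)
  rw [hU, measure_biUnion_finset hd hm, measure_biUnion_finset hd hm]
  exact Finset.sum_le_sum fun Q hQ => h Q (Finset.filter_subset _ _ hQ)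

variable {μ : Measure X}

lemma div_measure_ne_top {f : X → ℝ≥0∞} {Q : Set X} (hQ : ∫⁻ x in Q, f x ∂μ ≠ ∞) :
    (∫⁻ x in Q, f x ∂μ) / μ Q ≠ ∞ := by
  rcases eq_or_ne (μ Q) 0 with h | h
  · simp [Measure.restrict_eq_zero.2 h]
  · exact ENNReal.div_ne_top hQ h

lemma setLIntegral_ne_top_of_rpow {s : ℝ} (hs : 1 ≤ s) {f : X → ℝ≥0∞} {Q : Set X}
    (hQ : μ Q ≠ ∞) (hf : ∫⁻ x, f x ^ s ∂μ ≠ ∞) : ∫⁻ x in Q, f x ∂μ ≠ ∞ := by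
  have h1 : ∀ x, f x ≤ 1 + f x ^ s := fun x => by
    rcases le_total (f x) 1 with h | h
    · exact h.trans le_self_add
    · calc f x = f x ^ (1 : ℝ) := by simp
        _ ≤ f x ^ s := ENNReal.rpow_le_rpow_of_exponent_le h hs
        _ ≤ _ := le_add_self
  refine ne_top_of_le_ne_top ?_ (lintegral_mono h1)
  rw [lintegral_add_left measurable_const]
  refine ENNReal.add_ne_top.2 ⟨by simpa using hQ, ne_top_of_le_ne_top hf ?_⟩
  exact setLIntegral_le_lintegral _ _

/-- The strong type bound for the maximal function of a finite nested family. -/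
lemma lintegral_dyadicSup_average_rpow_le_of_finset {s : ℝ} (hs : 1 < s) {𝒬 : Finset (Set X)}
    (hD : IsNested (𝒬 : Set (Set X))) (hfin : ∀ Q ∈ 𝒬, μ Q ≠ ∞) {f : X → ℝ≥0∞}
    (hf : Measurable f) :
    ∫⁻ x, dyadicSup 𝒬 (fun Q => (∫⁻ y in Q, f y ∂μ) / μ Q) x ^ s ∂μ ≤
      ENNReal.ofReal (s / (s - 1)) ^ s * ∫⁻ x, f x ^ s ∂μ := by
  classical
  have hs0 : 0 < s := by linarith
  have hs1 : 0 < s - 1 := by linarith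
  by_cases htop : ∫⁻ x, f x ^ s ∂μ = ∞
  · rw [htop, ENNReal.mul_top]
    · exact le_top
    · simp only [ne_eq, ENNReal.rpow_eq_zero_iff, ENNReal.ofReal_eq_zero]
      have : 0 < s / (s - 1) := by positivity
      simp [this, hs0, not_lt.2 hs0.le]
  set a : Set X → ℝ≥0∞ := fun Q => (∫⁻ y in Q, f y ∂μ) / μ Q with ha
  have hafin : ∀ Q ∈ 𝒬, a Q ≠ ∞ := fun Q hQ =>
    div_measure_ne_top (setLIntegral_ne_top_of_rpow hs.le (hfin Q hQ) htop)
  set G : X → ℝ≥0∞ := dyadicSup 𝒬 a with hG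
  have hGm : Measurable G := hD.measurable_dyadicSup
  have hGle : ∀ x, G x ≤ (⋃ Q ∈ 𝒬, Q).indicator (fun _ => ∑ Q ∈ 𝒬, a Q) x := by
    intro x
    refine dyadicSup_le fun Q hQ hx => ?_
    have hx' : x ∈ ⋃ Q ∈ 𝒬, Q := mem_iUnion₂.2 ⟨Q, hQ, hx⟩
    rw [indicator_of_mem hx']
    exact Finset.single_le_sum (f := a) (fun _ _ => zero_le) hQ
  have hsum : ∑ Q ∈ 𝒬, a Q ≠ ∞ := ENNReal.sum_ne_top.2 hafin
  have hGfin : ∀ x, G x ≠ ∞ := fun x => by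
    refine ne_top_of_le_ne_top hsum ((hGle x).trans ?_)
    exact indicator_le_self' (fun _ _ => zero_le) x
  set I := ∫⁻ x, G x ^ s ∂μ with hI
  -- The argument ends by absorbing `I ^ (1 - 1/s)`, which needs `I < ∞`. For a finite family this
  -- holds because `G` is bounded and vanishes outside a set of finite measure.
  have hIfin : I ≠ ∞ := by
    have : ∀ x, G x ^ s ≤ (⋃ Q ∈ 𝒬, Q).indicator (fun _ => (∑ Q ∈ 𝒬, a Q) ^ s) x := by
      intro x
      refine (ENNReal.rpow_le_rpow (hGle x) hs0.le).trans ?_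
      by_cases hx : x ∈ ⋃ Q ∈ 𝒬, Q
      · rw [indicator_of_mem hx, indicator_of_mem hx]
      · rw [indicator_of_notMem hx, indicator_of_notMem hx, ENNReal.zero_rpow_of_pos hs0]
    refine ne_top_of_le_ne_top ?_ (lintegral_mono this)
    rw [lintegral_indicator (Finset.measurableSet_biUnion _ fun Q hQ => hD.measurableSet Q hQ),
      setLIntegral_const]
    refine ENNReal.mul_ne_top (ENNReal.rpow_ne_top_of_nonneg hs0.le hsum) ?_
    exact ((measure_biUnion_finset_le _ _).trans_lt
      (ENNReal.sum_lt_top.2 fun Q hQ => (hfin Q hQ).lt_top)).ne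
  set g : X → ℝ := fun x => (G x).toReal with hg
  have hgm : Measurable g := hGm.ennreal_toReal
  have hg0 : ∀ x, 0 ≤ g x := fun x => ENNReal.toReal_nonneg
  have hgG : ∀ (e : ℝ), 0 ≤ e → ∀ x, ENNReal.ofReal (g x ^ e) = G x ^ e := fun e he x => by
    rw [← ENNReal.ofReal_rpow_of_nonneg (hg0 x) he, ENNReal.ofReal_toReal (hGfin x)]
  set ν := μ.withDensity f with hν
  -- Weak type inequality: the level set is the union of the sets with average above `t`, and on
  -- each of these `t • μ` is at most `ν = f μ`.
  have hlevel : ∀ t : ℝ, 0 < t → ENNReal.ofReal t * μ {x | t < g x} ≤ ν {x | t < g x} := by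
    intro t ht
    have hset : {x | t < g x} = ⋃ Q ∈ 𝒬.filter (fun Q => ENNReal.ofReal t < a Q), Q := by
      ext x
      simp only [mem_ofPred_eq, hg, mem_iUnion, Finset.mem_filter, exists_prop]
      rw [← ENNReal.ofReal_lt_iff_lt_toReal ht.le (hGfin x), hG, lt_dyadicSup_iff]
      constructor
      · rintro ⟨Q, h1, h2, h3⟩
        exact ⟨Q, ⟨h1, h3⟩, h2⟩
      · rintro ⟨Q, ⟨h1, h3⟩, h2⟩
        exact ⟨Q, h1, h2, h3⟩
    rw [hset]
    have hD' : IsNested (↑(𝒬.filter (fun Q => ENNReal.ofReal t < a Q)) : Set (Set X)) :=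
      hD.mono (by exact_mod_cast Finset.filter_subset _ _)
    have := measure_biUnion_le_of_nested hD' (μ := ENNReal.ofReal t • μ) (ν := ν) ?_
    · simpa using this
    · intro Q hQ
      obtain ⟨hQ1, hQ2⟩ := Finset.mem_filter.1 hQ
      rw [hν, withDensity_apply _ (hD.measurableSet Q hQ1), Measure.smul_apply, smul_eq_mul]
      exact ENNReal.mul_le_of_le_div hQ2.le
  have h1 : I = ENNReal.ofReal s *
      ∫⁻ t in Ioi 0, μ {x | t < g x} * ENNReal.ofReal (t ^ (s - 1)) := by
    rw [← lintegral_rpow_eq_lintegral_meas_lt_mul μ (Filter.Eventually.of_forall hg0)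
      hgm.aemeasurable hs0]
    exact lintegral_congr fun x => (hgG s hs0.le x).symm
  have h2 : ∫⁻ x, G x ^ (s - 1) ∂ν = ENNReal.ofReal (s - 1) *
      ∫⁻ t in Ioi 0, ν {x | t < g x} * ENNReal.ofReal (t ^ (s - 1 - 1)) := by
    rw [← lintegral_rpow_eq_lintegral_meas_lt_mul ν (Filter.Eventually.of_forall hg0)
      hgm.aemeasurable hs1]
    exact lintegral_congr fun x => (hgG (s - 1) hs1.le x).symm
  -- The weak type inequality trades one factor `t` in the layer cake formula for the passage from
  -- `μ` to `ν`.
  have h3 : I ≤ ENNReal.ofReal (s / (s - 1)) * ∫⁻ x, G x ^ (s - 1) ∂ν := by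
    rw [h1, h2, ← mul_assoc, ← ENNReal.ofReal_mul (by positivity), div_mul_cancel₀ _ hs1.ne']
    refine mul_le_mul_right (setLIntegral_mono' measurableSet_Ioi fun t (ht : 0 < t) => ?_) _
    have : t ^ (s - 1) = t * t ^ (s - 1 - 1) := by
      rw [← Real.rpow_one_add' ht.le (by linarith)]
      ring_nf
    rw [this, ENNReal.ofReal_mul ht.le, ← mul_assoc, mul_comm (μ _)]
    exact mul_le_mul_left (hlevel t ht) _
  have h4 : ∫⁻ x, G x ^ (s - 1) ∂ν ≤ (∫⁻ x, f x ^ s ∂μ) ^ (1 / s) * I ^ (1 - 1 / s) := by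
    have hc : s.HolderConjugate (s / (s - 1)) := Real.HolderConjugate.conjExponent hs
    have := ENNReal.lintegral_mul_le_Lp_mul_Lq μ hc hf.aemeasurable
      (hGm.pow_const (s - 1)).aemeasurable
    rw [hν, lintegral_withDensity_eq_lintegral_mul _ hf (hGm.pow_const _)]
    refine this.trans_eq ?_
    congr 1
    have e1 : 1 / (s / (s - 1)) = 1 - 1 / s := by field_simp
    rw [e1, hI]
    congr 1
    refine lintegral_congr fun x => ?_
    rw [← ENNReal.rpow_mul]
    congr 1
    field_simp
  have h5 : I ≤ (ENNReal.ofReal (s / (s - 1)) * (∫⁻ x, f x ^ s ∂μ) ^ (1 / s)) * I ^ (1 - 1 / s) := by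
    rw [mul_assoc]
    exact h3.trans (mul_le_mul_right h4 _)
  refine (le_rpow_of_le_mul_rpow hs hIfin h5).trans_eq ?_
  rw [ENNReal.mul_rpow_of_nonneg _ _ hs0.le, ← ENNReal.rpow_mul, one_div_mul_cancel hs0.ne',
    ENNReal.rpow_one]

/-- Monotone convergence along the directed set of finite subfamilies, countable because `D` is. It
transfers bounds from finite families to whole grids. -/
lemma lintegral_le_of_finset (hD : D.Countable) {T : Finset (Set X) → X → ℝ≥0∞}
    (hT : ∀ 𝒬 : Finset (Set X), ↑𝒬 ⊆ D → Measurable (T 𝒬)) (hmono : Monotone T) {c : ℝ≥0∞}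
    (h : ∀ 𝒬 : Finset (Set X), ↑𝒬 ⊆ D → ∫⁻ x, T 𝒬 x ∂μ ≤ c) :
    ∫⁻ x, ⨆ (𝒬 : Finset (Set X)) (_ : ↑𝒬 ⊆ D), T 𝒬 x ∂μ ≤ c := by
  classical
  have : Countable D := hD
  simp_rw [iSup_finset_subset_eq fun 𝒬 => T 𝒬 _]
  rw [lintegral_iSup_directed_of_measurable (fun 𝒬 => hT _ (coe_map_subtype_subset 𝒬))]
  · exact iSup_le fun 𝒬 => h _ (coe_map_subtype_subset 𝒬)
  · intro 𝒬 𝒬'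
    exact ⟨𝒬 ∪ 𝒬', hmono (Finset.map_subset_map.2 Finset.subset_union_left),
      hmono (Finset.map_subset_map.2 Finset.subset_union_right)⟩

/-- The strong type bound for the maximal function of a nested family. -/
lemma lintegral_dyadicSup_average_rpow_le {s : ℝ} (hs : 1 < s) (hD : IsNested D)
    (hfin : ∀ Q ∈ D, μ Q ≠ ∞) {f : X → ℝ≥0∞} (hf : Measurable f) :
    ∫⁻ x, dyadicSup D (fun Q => (∫⁻ y in Q, f y ∂μ) / μ Q) x ^ s ∂μ ≤
      ENNReal.ofReal (s / (s - 1)) ^ s * ∫⁻ x, f x ^ s ∂μ := by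
  set a : Set X → ℝ≥0∞ := fun Q => (∫⁻ y in Q, f y ∂μ) / μ Q
  have h := lintegral_le_of_finset (μ := μ) hD.countable
    (T := fun 𝒬 x => dyadicSup 𝒬 a x ^ s) (c := ENNReal.ofReal (s / (s - 1)) ^ s * ∫⁻ x, f x ^ s ∂μ)
    (fun 𝒬 h => (hD.mono h).measurable_dyadicSup.pow_const s) ?_
    (fun 𝒬 h => lintegral_dyadicSup_average_rpow_le_of_finset hs (hD.mono h)
      (fun Q hQ => hfin Q (h hQ)) hf)
  · refine le_trans (lintegral_mono fun x => ?_) h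
    rw [dyadicSup_rpow (by linarith)]
    refine dyadicSup_le fun Q hQ hx => ?_
    refine le_trans ?_ (le_iSup₂ (f := fun (𝒬 : Finset (Set X)) (_ : ↑𝒬 ⊆ D) =>
      dyadicSup 𝒬 a x ^ s) {Q} (by simpa using hQ))
    exact ENNReal.rpow_le_rpow (le_dyadicSup (by simp) hx) (by linarith)
  · intro 𝒬 𝒬' h x
    exact ENNReal.rpow_le_rpow (dyadicSup_le fun Q hQ hx => le_dyadicSup (h hQ) hx) (by linarith)

end Nested

/-! ### Norms indexed by the reciprocal exponent, so that Hölder's inequality adds indices -/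

section RecipNorm

variable {X : Type*} [MeasurableSpace X] {μ : Measure X} {f g : X → ℝ≥0∞} {s t : ℝ}

/-- The `L^{1/s}` norm of a nonnegative function. -/
def recipNorm (μ : Measure X) (s : ℝ) (f : X → ℝ≥0∞) : ℝ≥0∞ := (∫⁻ x, f x ^ s⁻¹ ∂μ) ^ s

lemma recipNorm_mono_ae (hs : 0 ≤ s) (h : ∀ᵐ x ∂μ, f x ≤ g x) :
    recipNorm μ s f ≤ recipNorm μ s g :=
  ENNReal.rpow_le_rpow (lintegral_mono_ae (h.mono fun _ hx =>
    ENNReal.rpow_le_rpow hx (inv_nonneg.2 hs))) hs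

lemma recipNorm_mono (hs : 0 ≤ s) (h : ∀ x, f x ≤ g x) : recipNorm μ s f ≤ recipNorm μ s g :=
  recipNorm_mono_ae hs (Filter.Eventually.of_forall h)

lemma recipNorm_const_mul (hs : 0 < s) (c : ℝ≥0∞) (hf : Measurable f) :
    recipNorm μ s (fun x => c * f x) = c * recipNorm μ s f := by
  unfold recipNorm
  have h : ∀ x, (c * f x) ^ s⁻¹ = c ^ s⁻¹ * f x ^ s⁻¹ := fun x =>
    ENNReal.mul_rpow_of_nonneg _ _ (inv_nonneg.2 hs.le)
  simp_rw [h]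
  rw [lintegral_const_mul _ (hf.pow_const _), ENNReal.mul_rpow_of_nonneg _ _ hs.le,
    ← ENNReal.rpow_mul, inv_mul_cancel₀ hs.ne', ENNReal.rpow_one]

lemma recipNorm_rpow (ht : 0 < t) : recipNorm μ s (fun x => f x ^ t) = recipNorm μ (s / t) f ^ t := by
  unfold recipNorm
  rw [← ENNReal.rpow_mul, div_mul_cancel₀ _ ht.ne']
  congr 2 with x
  rw [← ENNReal.rpow_mul, inv_div, div_eq_mul_inv]

lemma recipNorm_mul_le (hs : 0 < s) (ht : 0 < t) (hf : AEMeasurable f μ) (hg : AEMeasurable g μ) :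
    recipNorm μ (s + t) (fun x => f x * g x) ≤ recipNorm μ s f * recipNorm μ t g := by
  unfold recipNorm
  have h := ENNReal.lintegral_Lp_mul_le_Lq_mul_Lr (p := (s + t)⁻¹) (q := s⁻¹) (r := t⁻¹)
    (by positivity) (inv_strictAnti₀ hs (by linarith)) (by simp) μ hf hg
  simpa using h

lemma recipNorm_add_le (hs : 0 < s) (hs1 : s ≤ 1) (hf : AEMeasurable f μ) (hg : AEMeasurable g μ) :
    recipNorm μ s (fun x => f x + g x) ≤ recipNorm μ s f + recipNorm μ s g := by
  have h := ENNReal.lintegral_Lp_add_le (p := s⁻¹) hf hg ((one_le_inv₀ hs).2 hs1)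
  simpa [recipNorm] using h

lemma recipNorm_sum_le {ι : Type*} (𝒮 : Finset ι) (hs : 0 < s) (hs1 : s ≤ 1) {f : ι → X → ℝ≥0∞}
    (hf : ∀ i ∈ 𝒮, Measurable (f i)) :
    recipNorm μ s (fun x => ∑ i ∈ 𝒮, f i x) ≤ ∑ i ∈ 𝒮, recipNorm μ s (f i) := by
  classical
  induction 𝒮 using Finset.induction_on with
  | empty => simp [recipNorm, hs, inv_pos.2 hs]
  | insert i 𝒮 hi ih =>
    simp only [Finset.sum_insert hi]
    have h1 : Measurable (fun x => ∑ i ∈ 𝒮, f i x) :=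
      Finset.measurable_fun_sum _ fun j hj => hf j (Finset.mem_insert_of_mem hj)
    refine (recipNorm_add_le hs hs1 (hf i (Finset.mem_insert_self _ _)).aemeasurable
      h1.aemeasurable).trans ?_
    exact add_le_add le_rfl (ih fun j hj => hf j (Finset.mem_insert_of_mem hj))

lemma setLIntegral_le_measure_rpow_mul_recipNorm (hs : 0 < s) (hs1 : s < 1) (hf : Measurable f)
    (Q : Set X) : ∫⁻ x in Q, f x ∂μ ≤ μ Q ^ (1 - s) * recipNorm μ s f := by
  have h := recipNorm_mul_le (μ := μ.restrict Q) (s := 1 - s) (t := s) (f := fun _ => 1) (g := f)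
    (by linarith) hs measurable_const.aemeasurable hf.aemeasurable
  simp only [sub_add_cancel, one_mul, recipNorm, inv_one, ENNReal.rpow_one, ENNReal.one_rpow,
    lintegral_const, MeasurableSet.univ, Measure.restrict_apply, univ_inter] at h
  refine h.trans (mul_le_mul_right (ENNReal.rpow_le_rpow ?_ hs.le) _)
  exact setLIntegral_le_lintegral _ _

lemma recipNorm_dyadicSup_average_le {D : Set (Set X)} (hs : 0 < s) (hs1 : s < 1)
    (hD : IsNested D) (hfin : ∀ Q ∈ D, μ Q ≠ ∞) (hf : Measurable f) :
    recipNorm μ s (dyadicSup D (fun Q => (∫⁻ y in Q, f y ∂μ) / μ Q)) ≤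
      ENNReal.ofReal (1 / (1 - s)) * recipNorm μ s f := by
  have h := lintegral_dyadicSup_average_rpow_le (s := s⁻¹) ((one_lt_inv₀ hs).2 hs1) hD hfin hf
  refine (ENNReal.rpow_le_rpow h hs.le).trans_eq ?_
  have : s⁻¹ / (s⁻¹ - 1) = 1 / (1 - s) := by field_simp
  rw [ENNReal.mul_rpow_of_nonneg _ _ hs.le, ← ENNReal.rpow_mul, inv_mul_cancel₀ hs.ne',
    ENNReal.rpow_one, this, recipNorm]

lemma recipNorm_withDensity {U : X → ℝ≥0∞} (hU : Measurable U) (hf : Measurable f) :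
    recipNorm (μ.withDensity U) s f = (∫⁻ x, U x * f x ^ s⁻¹ ∂μ) ^ s := by
  rw [recipNorm, lintegral_withDensity_eq_lintegral_mul _ hU (hf.pow_const _)]
  rfl

end RecipNorm

/-! ### The sharp weighted bound for the dyadic fractional maximal operator -/

section Maximal

variable {X : Type*} [MeasurableSpace X] {μ : Measure X} {D : Set (Set X)} {A B : ℝ}
  {U S : X → ℝ≥0∞} {K : ℝ≥0∞}

/-- Each fractional average splits as `(σ(Q)^(-B) J)^e₁ (J / σ(Q))^e₂` with `e₁ + e₂ = 1`. Hölder's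
inequality bounds the first base by the norm of `h`, and the second is an ordinary average, so the
maximal theorem for `σ` applies. The constant does not depend on `σ`. -/
lemma recipNorm_fracDyadicSup_le {σ : Measure X} (hA : 0 < A) (hB : 0 < B) (hAB : A + B ≤ 1)
    (hD : IsNested D) (h0 : ∀ Q ∈ D, σ Q ≠ 0) (hfin : ∀ Q ∈ D, σ Q ≠ ∞) {h : X → ℝ≥0∞}
    (hh : Measurable h) :
    recipNorm σ A (dyadicSup D (fun Q => σ Q ^ (-(A + B)) * ∫⁻ y in Q, h y ∂σ)) ≤
      ENNReal.ofReal (1 / B) ^ (A / (1 - B)) * recipNorm σ (1 - B) h := by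
  have hB1 : 0 < 1 - B := by linarith
  set N := recipNorm σ (1 - B) h with hN
  set Mh := dyadicSup D (fun Q => (∫⁻ y in Q, h y ∂σ) / σ Q) with hMh
  set e₁ := (1 - (A + B)) / (1 - B) with he₁
  set e₂ := A / (1 - B) with he₂
  have he₁0 : 0 ≤ e₁ := div_nonneg (by linarith) hB1.le
  have he₂0 : 0 < e₂ := div_pos hA hB1
  have he : e₁ + e₂ = 1 := by rw [he₁, he₂]; field_simp; ring
  have hpt : ∀ x, dyadicSup D (fun Q => σ Q ^ (-(A + B)) * ∫⁻ y in Q, h y ∂σ) x ≤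
      N ^ e₁ * Mh x ^ e₂ := by
    intro x
    refine dyadicSup_le fun Q hQ hx => ?_
    have h1 : (∫⁻ y in Q, h y ∂σ) ≤ σ Q ^ B * N := by
      have := setLIntegral_le_measure_rpow_mul_recipNorm (μ := σ) (s := 1 - B) hB1 (by linarith) hh Q
      simpa using this
    have h2 : (∫⁻ y in Q, h y ∂σ) / σ Q ≤ Mh x := le_dyadicSup
      (a := fun Q => (∫⁻ y in Q, h y ∂σ) / σ Q) hQ hx
    set J := ∫⁻ y in Q, h y ∂σ
    calc σ Q ^ (-(A + B)) * J = (σ Q ^ (-B) * J) ^ e₁ * (J / σ Q) ^ e₂ := by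
          rw [ENNReal.mul_rpow_of_nonneg _ _ he₁0, ENNReal.div_rpow_of_nonneg _ _ he₂0.le,
            ← ENNReal.rpow_mul, div_eq_mul_inv (J ^ e₂), ← ENNReal.rpow_neg]
          have e3 : σ Q ^ (-B * e₁) * J ^ e₁ * (J ^ e₂ * σ Q ^ (-e₂)) =
              (σ Q ^ (-B * e₁) * σ Q ^ (-e₂)) * (J ^ e₁ * J ^ e₂) := by ring
          rw [e3, ← ENNReal.rpow_add _ _ (h0 Q hQ) (hfin Q hQ),
            ← ENNReal.rpow_add_of_nonneg _ _ he₁0 he₂0.le, he, ENNReal.rpow_one]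
          congr 2
          rw [he₁, he₂]
          field_simp
          ring
      _ ≤ N ^ e₁ * Mh x ^ e₂ := by
          refine mul_le_mul' (ENNReal.rpow_le_rpow ?_ he₁0) (ENNReal.rpow_le_rpow h2 he₂0.le)
          refine (mul_le_mul_right h1 _).trans_eq ?_
          rw [← mul_assoc, ← ENNReal.rpow_add _ _ (h0 Q hQ) (hfin Q hQ)]
          simp
  have hMm : Measurable Mh := hD.measurable_dyadicSup
  refine (recipNorm_mono hA.le hpt).trans ?_
  rw [recipNorm_const_mul hA _ (hMm.pow_const _), recipNorm_rpow he₂0]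
  have e : A / e₂ = 1 - B := by rw [he₂]; field_simp
  have hmax := recipNorm_dyadicSup_average_le (μ := σ) (s := 1 - B) hB1 (by linarith) hD hfin hh
  rw [e]
  refine (mul_le_mul_right (ENNReal.rpow_le_rpow hmax he₂0.le) _).trans_eq ?_
  rw [← hN, ENNReal.mul_rpow_of_nonneg _ _ he₂0.le, mul_left_comm,
    ← ENNReal.rpow_add_of_nonneg _ _ he₁0 he₂0.le, he, ENNReal.rpow_one, sub_sub_cancel]

/-- Two weights `U`, `S` with `U^A S^B = 1` and `(∫_Q U)^A (∫_Q S)^B ≤ K |Q|^{A+B}` for the sets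
`Q` of a nested family. -/
structure WeightPair (μ : Measure X) (D : Set (Set X)) (A B : ℝ) (U S : X → ℝ≥0∞)
    (K : ℝ≥0∞) : Prop where
  A_pos : 0 < A
  B_pos : 0 < B
  add_le_one : A + B ≤ 1
  measurable_left : Measurable U
  measurable_right : Measurable S
  ae_eq_one : ∀ᵐ x ∂μ, U x ^ A * S x ^ B = 1
  nested : IsNested D
  measure_ne_zero : ∀ Q ∈ D, μ Q ≠ 0
  measure_ne_top : ∀ Q ∈ D, μ Q ≠ ∞
  ne_top : K ≠ ∞
  bound : ∀ Q ∈ D, μ.withDensity U Q ^ A * μ.withDensity S Q ^ B ≤ K * μ Q ^ (A + B)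

namespace WeightPair

lemma swap (h : WeightPair μ D A B U S K) : WeightPair μ D B A S U K where
  A_pos := h.B_pos
  B_pos := h.A_pos
  add_le_one := by have := h.add_le_one; linarith
  measurable_left := h.measurable_right
  measurable_right := h.measurable_left
  ae_eq_one := h.ae_eq_one.mono fun x hx => by rw [mul_comm]; exact hx
  nested := h.nested
  measure_ne_zero := h.measure_ne_zero
  measure_ne_top := h.measure_ne_top
  ne_top := h.ne_top
  bound := fun Q hQ => by rw [mul_comm, add_comm]; exact h.bound Q hQ

/-- Rescaling both exponents keeps the same two weights. It makes the maximal bound available for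
fractional orders near `A + B`, as needed in `exists_testing_bound`. -/
lemma scale (h : WeightPair μ D A B U S K) {t : ℝ} (ht : 0 < t) (ht1 : t * A + t * B ≤ 1) :
    WeightPair μ D (t * A) (t * B) U S (K ^ t) where
  A_pos := mul_pos ht h.A_pos
  B_pos := mul_pos ht h.B_pos
  add_le_one := ht1
  measurable_left := h.measurable_left
  measurable_right := h.measurable_right
  ae_eq_one := h.ae_eq_one.mono fun x hx => by
    rw [mul_comm t, mul_comm t, ENNReal.rpow_mul, ENNReal.rpow_mul,
      ← ENNReal.mul_rpow_of_nonneg _ _ ht.le, hx, ENNReal.one_rpow]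
  nested := h.nested
  measure_ne_zero := h.measure_ne_zero
  measure_ne_top := h.measure_ne_top
  ne_top := ENNReal.rpow_ne_top_of_nonneg ht.le h.ne_top
  bound := fun Q hQ => by
    rw [← mul_add, mul_comm t, mul_comm t, mul_comm t, ENNReal.rpow_mul, ENNReal.rpow_mul,
      ENNReal.rpow_mul _ (A + B), ← ENNReal.mul_rpow_of_nonneg _ _ ht.le,
      ← ENNReal.mul_rpow_of_nonneg _ _ ht.le]
    exact ENNReal.rpow_le_rpow (h.bound Q hQ) ht.le

lemma ae_ne_zero (h : WeightPair μ D A B U S K) : ∀ᵐ x ∂μ, U x ≠ 0 :=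
  h.ae_eq_one.mono fun x hx h0 => by simp [h0, h.A_pos] at hx

lemma ae_ne_top (h : WeightPair μ D A B U S K) : ∀ᵐ x ∂μ, U x ≠ ∞ := by
  filter_upwards [h.ae_eq_one, h.swap.ae_ne_zero] with x hx hx' h0
  rw [h0, ENNReal.top_rpow_of_pos h.A_pos, ENNReal.top_mul] at hx
  · exact ENNReal.top_ne_one hx
  · simp [ENNReal.rpow_eq_zero_iff, hx', not_lt.2 h.B_pos.le]

lemma left_ne_zero (h : WeightPair μ D A B U S K) {Q : Set X} (hQ : Q ∈ D) :
    μ.withDensity U Q ≠ 0 := by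
  intro h0
  rw [withDensity_apply_eq_zero h.measurable_left] at h0
  refine h.measure_ne_zero Q hQ ?_
  rw [← nonpos_iff_eq_zero, ← h0]
  refine measure_mono_ae ?_
  filter_upwards [h.ae_ne_zero] with x hx hxQ
  exact ⟨hx, hxQ⟩

lemma left_ne_top (h : WeightPair μ D A B U S K) {Q : Set X} (hQ : Q ∈ D) :
    μ.withDensity U Q ≠ ∞ := by
  intro h0
  have := h.bound Q hQ
  rw [h0, ENNReal.top_rpow_of_pos h.A_pos, ENNReal.top_mul, top_le_iff] at this
  · exact ENNReal.mul_ne_top h.ne_top (ENNReal.rpow_ne_top_of_nonneg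
      (add_pos h.A_pos h.B_pos).le (h.measure_ne_top Q hQ)) this
  · simp [ENNReal.rpow_eq_zero_iff, h.swap.left_ne_zero hQ, not_lt.2 h.B_pos.le]

/-- The weight condition raised to the power `(A+B)/B` and solved for `|Q|^(-(A+B))`. The exponent
of `σ(Q)` becomes exactly that of a fractional average with respect to `σ`, and the remaining factor
is a power of `|Q| / u(Q)`. The sharp power of `K` originates here. -/
lemma rpow_neg_le (h : WeightPair μ D A B U S K) {Q : Set X} (hQ : Q ∈ D) :
    μ Q ^ (-(A + B)) ≤ K ^ ((A + B) / B) *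
      ((μ Q / μ.withDensity U Q) ^ ((A + B) * A / B) * μ.withDensity S Q ^ (-(A + B))) := by
  have hA := h.A_pos
  have hB := h.B_pos
  have hb := h.bound Q hQ
  have m0 := h.measure_ne_zero Q hQ
  have m1 := h.measure_ne_top Q hQ
  have u0 := h.left_ne_zero hQ
  have u1 := h.left_ne_top hQ
  have s0 := h.swap.left_ne_zero hQ
  have s1 := h.swap.left_ne_top hQ
  set u := μ.withDensity U Q
  set σ := μ.withDensity S Q
  set V := μ Q
  set τ := (A + B) * A / B with hτ
  have hτ0 : 0 ≤ τ := by positivity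
  have hb' := ENNReal.rpow_le_rpow hb (z := (A + B) / B) (by positivity)
  rw [ENNReal.mul_rpow_of_nonneg _ _ (by positivity), ENNReal.mul_rpow_of_nonneg _ _ (by positivity),
    ← ENNReal.rpow_mul, ← ENNReal.rpow_mul, ← ENNReal.rpow_mul,
    show A * ((A + B) / B) = τ by rw [hτ]; ring, show B * ((A + B) / B) = A + B by field_simp,
    show (A + B) * ((A + B) / B) = τ + (A + B) by rw [hτ]; field_simp,
    ENNReal.rpow_add _ _ m0 m1] at hb'
  calc V ^ (-(A + B)) = V ^ (-(A + B)) * (u ^ τ * σ ^ (A + B)) * (u ^ (-τ) * σ ^ (-(A + B))) := by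
        rw [mul_assoc, mul_mul_mul_comm, ← ENNReal.rpow_add _ _ u0 u1, ← ENNReal.rpow_add _ _ s0 s1]
        simp
    _ ≤ V ^ (-(A + B)) * (K ^ ((A + B) / B) * (V ^ τ * V ^ (A + B))) * (u ^ (-τ) * σ ^ (-(A + B))) := by
        gcongr
    _ = (V ^ (-(A + B)) * V ^ (A + B)) * (K ^ ((A + B) / B) * ((V ^ τ * u ^ (-τ)) * σ ^ (-(A + B)))) := by
        ring
    _ = _ := by
        rw [← ENNReal.rpow_add _ _ m0 m1, neg_add_cancel, ENNReal.rpow_zero, one_mul,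
          ENNReal.div_rpow_of_nonneg _ _ hτ0, div_eq_mul_inv (V ^ τ), ENNReal.rpow_neg u]

/-- The sharp weighted bound for the dyadic fractional maximal operator. -/
theorem recipNorm_dyadicSup_le (hw : WeightPair μ D A B U S K) {h : X → ℝ≥0∞}
    (hh : Measurable h) :
    recipNorm (μ.withDensity U) A
        (dyadicSup D (fun Q => μ Q ^ (-(A + B)) * ∫⁻ y in Q, h y ∂μ.withDensity S)) ≤
      ENNReal.ofReal ((A + B) / A) ^ ((A + B) * A / B) * ENNReal.ofReal (1 / B) ^ (A / (1 - B)) *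
        K ^ ((A + B) / B) * recipNorm (μ.withDensity S) (1 - B) h := by
  have hA := hw.A_pos
  have hB := hw.B_pos
  set u := μ.withDensity U with hu
  set σ := μ.withDensity S with hσ
  set τ := (A + B) * A / B with hτ
  have hτ0 : 0 < τ := by positivity
  set m := dyadicSup D (fun Q => σ Q ^ (-(A + B)) * ∫⁻ y in Q, h y ∂σ) with hm
  have hmm : Measurable m := hw.nested.measurable_dyadicSup
  -- Dividing by `U` turns integrals of `m ^ τ⁻¹` over `Q` in `μ` into integrals of `G` in `u`, so
  -- that `|Q| / u(Q)` is absorbed into a `u`-average of `G`.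
  set G : X → ℝ≥0∞ := fun x => m x ^ τ⁻¹ * (U x)⁻¹ with hG
  have hGm : Measurable G := (hmm.pow_const _).mul hw.measurable_left.inv
  set MG := dyadicSup D (fun Q => (∫⁻ y in Q, G y ∂u) / u Q) with hMG
  have hMGm : Measurable MG := hw.nested.measurable_dyadicSup
  have hpt : ∀ x, dyadicSup D (fun Q => μ Q ^ (-(A + B)) * ∫⁻ y in Q, h y ∂σ) x ≤
      K ^ ((A + B) / B) * MG x ^ τ := by
    intro x
    refine dyadicSup_le fun Q hQ hx => ?_
    -- The fractional average over `Q` is a lower bound for `m` at every point of `Q`; integrate its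
    -- power `τ⁻¹`.
    have h1 : μ Q * (σ Q ^ (-(A + B)) * ∫⁻ y in Q, h y ∂σ) ^ τ⁻¹ ≤ ∫⁻ y in Q, G y ∂u := by
      rw [hu, setLIntegral_withDensity_eq_setLIntegral_mul _ hw.measurable_left hGm
        (hw.nested.measurableSet Q hQ), mul_comm, ← setLIntegral_const]
      refine lintegral_mono_ae ?_
      filter_upwards [ae_restrict_mem (hw.nested.measurableSet Q hQ),
        ae_restrict_of_ae hw.ae_ne_zero, ae_restrict_of_ae hw.ae_ne_top] with y hy h0 h1
      rw [Pi.mul_apply, hG]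
      simp only
      rw [mul_left_comm, ENNReal.mul_inv_cancel h0 h1, mul_one]
      refine ENNReal.rpow_le_rpow ?_ (inv_nonneg.2 hτ0.le)
      exact le_dyadicSup (a := fun Q => σ Q ^ (-(A + B)) * ∫⁻ y in Q, h y ∂σ) hQ hy
    have h2 : (∫⁻ y in Q, G y ∂u) / u Q ≤ MG x :=
      le_dyadicSup (a := fun Q => (∫⁻ y in Q, G y ∂u) / u Q) hQ hx
    set J := ∫⁻ y in Q, h y ∂σ
    calc μ Q ^ (-(A + B)) * J
        ≤ K ^ ((A + B) / B) * ((μ Q / u Q) ^ τ * σ Q ^ (-(A + B))) * J :=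
          mul_le_mul_left (hw.rpow_neg_le hQ) _
      _ = K ^ ((A + B) / B) * (μ Q * (σ Q ^ (-(A + B)) * J) ^ τ⁻¹ / u Q) ^ τ := by
          rw [ENNReal.div_rpow_of_nonneg _ _ hτ0.le, ENNReal.div_rpow_of_nonneg _ _ hτ0.le,
            ENNReal.mul_rpow_of_nonneg _ _ hτ0.le, ← ENNReal.rpow_mul,
            inv_mul_cancel₀ hτ0.ne', ENNReal.rpow_one, div_eq_mul_inv (μ Q ^ τ),
            div_eq_mul_inv (μ Q ^ τ * _)]
          ring
      _ ≤ K ^ ((A + B) / B) * MG x ^ τ := by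
          gcongr
          exact (ENNReal.div_le_div_right h1 _).trans h2
  refine (recipNorm_mono hA.le hpt).trans ?_
  rw [recipNorm_const_mul hA _ (hMGm.pow_const _), recipNorm_rpow hτ0]
  have e : A / τ = B / (A + B) := by rw [hτ]; field_simp
  have hmax := recipNorm_dyadicSup_average_le (μ := u) (s := B / (A + B)) (by positivity)
    ((div_lt_one (by positivity)).2 (by linarith)) hw.nested (fun Q hQ => hw.left_ne_top hQ) hGm
  -- The relation `U^A S^B = 1` gives `U * G^((A+B)/B) = S * m^(1/A)`, so the `u`-norm of `G` is a
  -- `σ`-norm of `m`, to which `recipNorm_fracDyadicSup_le` applies.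
  have hGn : recipNorm u (B / (A + B)) G = recipNorm σ A m ^ τ⁻¹ := by
    rw [hu, hσ, recipNorm_withDensity hw.measurable_left hGm,
      recipNorm_withDensity hw.measurable_right hmm, ← ENNReal.rpow_mul]
    have e' : A * τ⁻¹ = B / (A + B) := by rw [← e]; rfl
    rw [e']
    congr 1
    refine lintegral_congr_ae ?_
    filter_upwards [hw.ae_eq_one, hw.ae_ne_zero, hw.ae_ne_top, hw.swap.ae_ne_zero,
      hw.swap.ae_ne_top] with x h1 u0 u1 s0 s1
    have hS : S x = U x * (U x)⁻¹ ^ ((A + B) / B) := by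
      have : (U x ^ A * S x ^ B) ^ B⁻¹ = 1 := by rw [h1, ENNReal.one_rpow]
      rw [ENNReal.mul_rpow_of_nonneg _ _ (inv_nonneg.2 hB.le), ← ENNReal.rpow_mul,
        ← ENNReal.rpow_mul, mul_inv_cancel₀ hB.ne', ENNReal.rpow_one] at this
      have hz : U x ^ (-(A * B⁻¹)) * (U x ^ (A * B⁻¹) * S x) = U x ^ (-(A * B⁻¹)) := by
        rw [this, mul_one]
      rw [← mul_assoc, ← ENNReal.rpow_add _ _ u0 u1, neg_add_cancel, ENNReal.rpow_zero,
        one_mul] at hz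
      rw [hz, ENNReal.inv_rpow, ← ENNReal.rpow_neg]
      conv_rhs => rw [← ENNReal.rpow_one (U x), ← ENNReal.rpow_mul, ← ENNReal.rpow_add _ _ u0 u1]
      congr 1
      field_simp
      ring
    rw [hG]
    simp only
    rw [ENNReal.mul_rpow_of_nonneg _ _ (by positivity), hS,
      show (B / (A + B))⁻¹ = (A + B) / B from inv_div _ _, ← ENNReal.rpow_mul]
    have : τ⁻¹ * ((A + B) / B) = A⁻¹ := by rw [hτ]; field_simp
    rw [this]
    ring
  rw [e]
  have hfr := recipNorm_fracDyadicSup_le (σ := σ) hA hB hw.add_le_one hw.nested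
    (fun Q hQ => hw.swap.left_ne_zero hQ) (fun Q hQ => hw.swap.left_ne_top hQ) hh
  calc K ^ ((A + B) / B) * recipNorm u (B / (A + B)) MG ^ τ
      ≤ K ^ ((A + B) / B) * (ENNReal.ofReal (1 / (1 - B / (A + B))) *
          recipNorm u (B / (A + B)) G) ^ τ := by gcongr
    _ = K ^ ((A + B) / B) * (ENNReal.ofReal ((A + B) / A) ^ τ * recipNorm σ A m) := by
        rw [hGn, ENNReal.mul_rpow_of_nonneg _ _ hτ0.le, ← ENNReal.rpow_mul, inv_mul_cancel₀ hτ0.ne',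
          ENNReal.rpow_one]
        have e2 : 1 - B / (A + B) = A / (A + B) := by field_simp; ring
        rw [e2, one_div_div]
    _ ≤ K ^ ((A + B) / B) * (ENNReal.ofReal ((A + B) / A) ^ τ *
          (ENNReal.ofReal (1 / B) ^ (A / (1 - B)) * recipNorm σ (1 - B) h)) := by gcongr
    _ = _ := by ring

end WeightPair

end Maximal

/-! ### Sums controlled by two opposite geometric sequences -/

lemma summable_inv_pow_natAbs {R : ℝ} (hR : 1 < R) : Summable fun k : ℤ => (R⁻¹) ^ k.natAbs := by
  have h : Summable fun k : ℕ => (R⁻¹) ^ k :=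
    summable_geometric_of_lt_one (by positivity) (inv_lt_one_of_one_lt₀ hR)
  refine Summable.of_nat_of_neg ?_ ?_ <;> simpa using h

/-- Numbers bounded both by a geometrically increasing and by a geometrically decreasing sequence
have a sum controlled by the geometric mean of the two bounds. -/
lemma exists_sum_le_sqrt_mul {R : ℝ} (hR : 1 < R) : ∃ C : ℝ≥0, ∀ {ι : Type*} (𝒯 : Finset ι)
    (κ : ι → ℤ) (_ : Set.InjOn κ 𝒯) (a : ι → ℝ≥0∞) (x y : ℝ≥0∞)
    (_ : ∀ i ∈ 𝒯, a i ≤ x * ENNReal.ofReal (R ^ κ i))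
    (_ : ∀ i ∈ 𝒯, a i ≤ y * ENNReal.ofReal (R ^ (-κ i))),
    ∑ i ∈ 𝒯, a i ≤ C * (x * y) ^ (1 / 2 : ℝ) := by
  classical
  have hR0 : 0 < R := by linarith
  set b : ℤ → ℝ := fun k => (R⁻¹) ^ k.natAbs with hb
  have hb0 : ∀ k, 0 ≤ b k := fun k => by positivity
  have hbs : Summable b := summable_inv_pow_natAbs hR
  have hT : 0 < ∑' k, b k := hbs.tsum_pos hb0 0 (by simp [hb])
  refine ⟨(R * ∑' k, b k).toNNReal, ?_⟩
  intro ι 𝒯 κ hκ a x y hx hy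
  have hC : ((R * ∑' k, b k).toNNReal : ℝ≥0∞) ≠ 0 := by
    simpa using mul_pos hR0 hT
  rcases eq_or_ne x 0 with rfl | hx0
  · have : ∀ i ∈ 𝒯, a i = 0 := fun i hi => by simpa using hx i hi
    rw [Finset.sum_eq_zero this]; exact zero_le
  rcases eq_or_ne y 0 with rfl | hy0
  · have : ∀ i ∈ 𝒯, a i = 0 := fun i hi => by simpa using hy i hi
    rw [Finset.sum_eq_zero this]; exact zero_le
  by_cases htop : x = ∞ ∨ y = ∞
  · have : x * y = ∞ := by
      rcases htop with rfl | rfl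
      · exact ENNReal.top_mul hy0
      · exact ENNReal.mul_top hx0
    rw [this, ENNReal.top_rpow_of_pos (by norm_num), ENNReal.mul_top hC]
    exact le_top
  push Not at htop
  lift x to ℝ≥0 using htop.1
  lift y to ℝ≥0 using htop.2
  have hx0' : (0 : ℝ) < x := by exact_mod_cast pos_iff_ne_zero.2 (by simpa using hx0)
  have hy0' : (0 : ℝ) < y := by exact_mod_cast pos_iff_ne_zero.2 (by simpa using hy0)
  -- The bounds `x R^k` and `y R^(-k)` cross where `R^k = s`, with common value `z`. Below, `k₀` is
  -- the integer part of the crossing index.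
  set s : ℝ := √(y / x) with hs
  set z : ℝ := √(x * y) with hz
  have hs0 : 0 < s := Real.sqrt_pos.2 (by positivity)
  have hz0 : 0 < z := Real.sqrt_pos.2 (by positivity)
  have hxz : (x : ℝ) = z / s := by
    rw [hz, hs, ← Real.sqrt_div (by positivity)]
    rw [show (x : ℝ) * y / (y / x) = x ^ 2 by field_simp, Real.sqrt_sq hx0'.le]
  have hyz : (y : ℝ) = z * s := by
    rw [hz, hs, ← Real.sqrt_mul (by positivity)]
    rw [show (x : ℝ) * y * (y / x) = y ^ 2 by field_simp, Real.sqrt_sq hy0'.le]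
  obtain ⟨k₀, hk1, hk2⟩ := exists_mem_Ico_zpow hs0 hR
  have hxy : ((x : ℝ≥0∞) * y) ^ (1 / 2 : ℝ) = ENNReal.ofReal z := by
    rw [hz, Real.sqrt_eq_rpow, ← ENNReal.ofReal_rpow_of_pos (by positivity),
      ENNReal.ofReal_mul hx0'.le, ENNReal.ofReal_coe_nnreal, ENNReal.ofReal_coe_nnreal]
  -- Use the increasing bound to the left of `k₀` and the decreasing one to the right. The factor
  -- `R` pays for rounding the crossing index to an integer.
  have key : ∀ i ∈ 𝒯, a i ≤ ENNReal.ofReal (z * R * b (κ i - k₀)) := by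
    intro i hi
    rcases le_total (κ i) k₀ with h | h
    · refine (hx i hi).trans ?_
      rw [← ENNReal.ofReal_coe_nnreal, ← ENNReal.ofReal_mul hx0'.le]
      refine ENNReal.ofReal_le_ofReal ?_
      have hbk : b (κ i - k₀) = R ^ (κ i - k₀) := by
        have : ((κ i - k₀).natAbs : ℤ) = k₀ - κ i := by omega
        simp only [hb]
        rw [← zpow_natCast, this, inv_zpow', neg_sub]
      rw [hbk, hxz, zpow_sub₀ hR0.ne']
      calc z / s * R ^ κ i ≤ z / R ^ k₀ * R ^ κ i := by gcongr
        _ = z * 1 * (R ^ κ i / R ^ k₀) := by ring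
        _ ≤ _ := by gcongr
    · refine (hy i hi).trans ?_
      rw [← ENNReal.ofReal_coe_nnreal, ← ENNReal.ofReal_mul hy0'.le]
      refine ENNReal.ofReal_le_ofReal ?_
      have hbk : b (κ i - k₀) = R ^ (k₀ - κ i) := by
        have : ((κ i - k₀).natAbs : ℤ) = κ i - k₀ := by omega
        simp only [hb]
        rw [← zpow_natCast, this, inv_zpow', neg_sub]
      rw [hbk, hyz, zpow_sub₀ hR0.ne', zpow_neg]
      calc z * s * (R ^ κ i)⁻¹ ≤ z * R ^ (k₀ + 1) * (R ^ κ i)⁻¹ := by gcongr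
        _ = z * R * (R ^ k₀ / R ^ κ i) := by rw [zpow_add_one₀ hR0.ne']; ring
  have hsum : ∑ i ∈ 𝒯, b (κ i - k₀) ≤ ∑' k, b k := by
    have : ∑ i ∈ 𝒯, b (κ i - k₀) = ∑ k ∈ 𝒯.image (fun i => κ i - k₀), b k := by
      rw [Finset.sum_image]
      intro i hi j hj hij
      exact hκ hi hj (by simpa using hij)
    rw [this]
    exact hbs.sum_le_tsum _ fun k _ => hb0 k
  calc ∑ i ∈ 𝒯, a i ≤ ∑ i ∈ 𝒯, ENNReal.ofReal (z * R * b (κ i - k₀)) := Finset.sum_le_sum key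
    _ = ENNReal.ofReal (z * R * ∑ i ∈ 𝒯, b (κ i - k₀)) := by
        rw [← ENNReal.ofReal_sum_of_nonneg fun i _ => by have := hb0 (κ i - k₀); positivity,
          Finset.mul_sum]
    _ ≤ ENNReal.ofReal (R * (∑' k, b k) * z) := by
        refine ENNReal.ofReal_le_ofReal ?_
        calc z * R * ∑ i ∈ 𝒯, b (κ i - k₀) ≤ z * R * ∑' k, b k := by gcongr
          _ = _ := by ring
    _ = _ := by
        rw [ENNReal.ofReal_mul (by positivity), hxy]
        rfl

/-! ### Testing constants from the sharp maximal bound -/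

section Testing

variable {X : Type*} [MeasurableSpace X]

/-- The sets of `D` have measures in `ρ^ℤ`, and at most one set of a given measure contains a
given point. -/
structure IsGraded (μ : Measure X) (D : Set (Set X)) (ρ : ℝ) (κ : Set X → ℤ) : Prop where
  measure_eq : ∀ Q ∈ D, μ Q = ENNReal.ofReal (ρ ^ κ Q)
  eq_of_mem : ∀ P ∈ D, ∀ Q ∈ D, ∀ x, x ∈ P → x ∈ Q → κ P = κ Q → P = Q

lemma ofReal_zpow_rpow {ρ : ℝ} (hρ : 0 < ρ) (k : ℤ) (e : ℝ) :
    ENNReal.ofReal (ρ ^ k) ^ e = ENNReal.ofReal ((ρ ^ e) ^ k) := by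
  rw [ENNReal.ofReal_rpow_of_pos (zpow_pos hρ k), ← Real.rpow_intCast, ← Real.rpow_intCast,
    ← Real.rpow_mul hρ.le, ← Real.rpow_mul hρ.le, mul_comm]

/-- At a point, the sets `Q` containing it have distinct measures among the powers of `ρ`. Comparing
`|Q|^(-r) σ(Q)` with fractional maximal functions of orders `(1 ± η) r` therefore bounds the sum by
the geometric mean of the two. Each of these obeys the sharp maximal bound after `WeightPair.scale`,
and in the mean the powers of `K` and of `σ(F)` combine to the required ones. -/
lemma exists_testing_bound (X : Type*) [MeasurableSpace X] {A B ρ : ℝ} (hA : 0 < A) (hB : 0 < B)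
    (hAB : A + B < 1) (hρ : 1 < ρ) : ∃ C : ℝ≥0, ∀ (μ : Measure X) (D : Set (Set X))
      (U S : X → ℝ≥0∞) (K : ℝ≥0∞) (κ : Set X → ℤ), WeightPair μ D A B U S K → IsGraded μ D ρ κ →
      ∀ (𝒬 : Finset (Set X)), ↑𝒬 ⊆ D → ∀ F : Set X, MeasurableSet F → (∀ Q ∈ 𝒬, Q ⊆ F) →
      recipNorm (μ.withDensity U) A (fun x => ∑ Q ∈ 𝒬,
        Q.indicator (fun _ => μ Q ^ (-(A + B)) * μ.withDensity S Q) x) ≤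
      C * K ^ ((A + B) / B) * μ.withDensity S F ^ (1 - B) := by
  classical
  set r := A + B with hr
  have hr0 : 0 < r := by positivity
  -- Small enough for `(1 + η) r ≤ 1`, so that both rescaled pairs are admissible; positive because
  -- `A + B < 1`.
  set η := (1 - r) / 2 with hη
  have hη0 : 0 < η := by rw [hη]; linarith
  have hη1 : η < 1 := by rw [hη]; linarith
  have hρ0 : 0 < ρ := by linarith
  obtain ⟨C₀, hC₀⟩ := exists_sum_le_sqrt_mul (Real.one_lt_rpow hρ (mul_pos hη0 hr0))
  have hM : ∀ t : ℝ, 0 < t → t * r ≤ 1 → ∃ C : ℝ≥0, ∀ (μ : Measure X) (D : Set (Set X))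
      (U S : X → ℝ≥0∞) (K : ℝ≥0∞), WeightPair μ D A B U S K →
      ∀ F : Set X, MeasurableSet F → recipNorm (μ.withDensity U) (t * A)
        (dyadicSup D (fun Q => μ Q ^ (-(t * r)) *
          ∫⁻ y in Q, F.indicator 1 y ∂μ.withDensity S)) ≤
        C * K ^ (t * (r / B)) * μ.withDensity S F ^ (1 - t * B) := by
    intro t ht htr
    have htr' : t * A + t * B ≤ 1 := by rw [← mul_add]; exact htr
    have hB1 : 0 < 1 - t * B := by have := mul_pos ht hA; linarith
    have hc1 : ENNReal.ofReal ((t * A + t * B) / (t * A)) ^ ((t * A + t * B) * (t * A) / (t * B)) ≠ ∞ :=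
      ENNReal.rpow_ne_top_of_nonneg (by positivity) ENNReal.ofReal_ne_top
    have hc2 : ENNReal.ofReal (1 / (t * B)) ^ (t * A / (1 - t * B)) ≠ ∞ :=
      ENNReal.rpow_ne_top_of_nonneg (by positivity) ENNReal.ofReal_ne_top
    refine ⟨(ENNReal.ofReal ((t * A + t * B) / (t * A)) ^ ((t * A + t * B) * (t * A) / (t * B)) *
      ENNReal.ofReal (1 / (t * B)) ^ (t * A / (1 - t * B))).toNNReal, ?_⟩
    intro μ D U S K hw F hF
    have h := (hw.scale ht htr').recipNorm_dyadicSup_le (h := F.indicator 1)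
      (measurable_one.indicator hF)
    rw [ENNReal.coe_toNNReal (ENNReal.mul_ne_top hc1 hc2)]
    have e1 : t * A + t * B = t * r := by rw [hr]; ring
    have e2 : recipNorm (μ.withDensity S) (1 - t * B) (F.indicator 1) =
        μ.withDensity S F ^ (1 - t * B) := by
      have : ∀ x, (F.indicator (1 : X → ℝ≥0∞) x) ^ (1 - t * B)⁻¹ = F.indicator 1 x := by
        intro x
        by_cases hx : x ∈ F <;> simp [hx, hB1]
      rw [recipNorm]
      simp_rw [this]
      rw [lintegral_indicator_one hF]
    rw [e2, ← ENNReal.rpow_mul, e1, show t * (t * r / (t * B)) = t * (r / B) by field_simp] at h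
    rw [e1]
    exact h
  obtain ⟨C₁, hC₁⟩ := hM (1 + η) (by linarith) (by rw [hη]; nlinarith)
  obtain ⟨C₂, hC₂⟩ := hM (1 - η) (by linarith) (by nlinarith)
  refine ⟨C₀ * (C₁ * C₂) ^ (1 / 2 : ℝ), ?_⟩
  intro μ D U S K κ hw hκ 𝒬 h𝒬 F hF hQF
  set u := μ.withDensity U
  set σ := μ.withDensity S
  set M₁ := dyadicSup D (fun Q => μ Q ^ (-((1 + η) * r)) * ∫⁻ y in Q, F.indicator 1 y ∂σ) with hM₁
  set M₂ := dyadicSup D (fun Q => μ Q ^ (-((1 - η) * r)) * ∫⁻ y in Q, F.indicator 1 y ∂σ) with hM₂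
  have hM₁m : Measurable M₁ := hw.nested.measurable_dyadicSup
  have hM₂m : Measurable M₂ := hw.nested.measurable_dyadicSup
  have hint : ∀ Q ∈ 𝒬, ∫⁻ y in Q, F.indicator 1 y ∂σ = σ Q := by
    intro Q hQ
    rw [setLIntegral_congr_fun (g := fun _ => 1) (hw.nested.measurableSet Q (h𝒬 hQ))]
    · simp
    · intro y hy
      simp [hQF Q hQ hy]
  have hpt : ∀ x, ∑ Q ∈ 𝒬, Q.indicator (fun _ => μ Q ^ (-r) * σ Q) x ≤
      C₀ * (M₁ x * M₂ x) ^ (1 / 2 : ℝ) := by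
    intro x
    have : ∑ Q ∈ 𝒬, Q.indicator (fun _ => μ Q ^ (-r) * σ Q) x =
        ∑ Q ∈ 𝒬.filter (x ∈ ·), μ Q ^ (-r) * σ Q := by
      rw [Finset.sum_filter]
      rfl
    rw [this]
    refine hC₀ _ κ ?_ _ _ _ ?_ ?_
    · intro P hP Q hQ hPQ
      simp only [Finset.coe_filter, mem_ofPred_eq] at hP hQ
      exact hκ.eq_of_mem P (h𝒬 hP.1) Q (h𝒬 hQ.1) x hP.2 hQ.2 hPQ
    · intro Q hQ
      obtain ⟨hQ1, hQ2⟩ := Finset.mem_filter.1 hQ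
      have h1 : μ Q ^ (-((1 + η) * r)) * ∫⁻ y in Q, F.indicator 1 y ∂σ ≤ M₁ x := le_dyadicSup
        (a := fun Q => μ Q ^ (-((1 + η) * r)) * ∫⁻ y in Q, F.indicator 1 y ∂σ) (h𝒬 hQ1) hQ2
      rw [hint Q hQ1] at h1
      rw [← ofReal_zpow_rpow hρ0, ← hκ.measure_eq Q (h𝒬 hQ1)]
      refine le_trans (le_of_eq ?_) (mul_le_mul_left h1 _)
      rw [mul_right_comm, ← ENNReal.rpow_add _ _ (hw.measure_ne_zero Q (h𝒬 hQ1))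
        (hw.measure_ne_top Q (h𝒬 hQ1))]
      congr 2
      ring
    · intro Q hQ
      obtain ⟨hQ1, hQ2⟩ := Finset.mem_filter.1 hQ
      have h1 : μ Q ^ (-((1 - η) * r)) * ∫⁻ y in Q, F.indicator 1 y ∂σ ≤ M₂ x := le_dyadicSup
        (a := fun Q => μ Q ^ (-((1 - η) * r)) * ∫⁻ y in Q, F.indicator 1 y ∂σ) (h𝒬 hQ1) hQ2
      rw [hint Q hQ1] at h1
      have e : ENNReal.ofReal ((ρ ^ (η * r)) ^ (-κ Q)) = μ Q ^ (-(η * r)) := by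
        rw [← ofReal_zpow_rpow hρ0, hκ.measure_eq Q (h𝒬 hQ1), ENNReal.rpow_neg,
          ← ENNReal.inv_rpow, ← ENNReal.ofReal_inv_of_pos (zpow_pos hρ0 _), zpow_neg]
      rw [e]
      refine le_trans (le_of_eq ?_) (mul_le_mul_left h1 _)
      rw [mul_right_comm, ← ENNReal.rpow_add _ _ (hw.measure_ne_zero Q (h𝒬 hQ1))
        (hw.measure_ne_top Q (h𝒬 hQ1))]
      congr 2
      ring
  have hAη1 : 0 < (1 + η) * A := mul_pos (by linarith) hA
  have hAη2 : 0 < (1 - η) * A := mul_pos (by linarith) hA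
  refine (recipNorm_mono hA.le hpt).trans ?_
  have hm : Measurable fun x => (M₁ x * M₂ x) ^ (1 / 2 : ℝ) := (hM₁m.mul hM₂m).pow_const _
  rw [recipNorm_const_mul hA _ hm, recipNorm_rpow (by norm_num)]
  -- The square root doubles the index `A`, and `2A` is the sum of the two rescaled indices, as
  -- Hölder's inequality requires.
  have e : A / (1 / 2) = (1 + η) * A + (1 - η) * A := by ring
  rw [e]
  have hb : recipNorm u ((1 + η) * A + (1 - η) * A) (fun x => M₁ x * M₂ x) ≤
      (C₁ * C₂ : ℝ≥0) * (K ^ (r / B) * σ F ^ (1 - B)) ^ (2 : ℝ) := by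
    refine (recipNorm_mul_le hAη1 hAη2 hM₁m.aemeasurable hM₂m.aemeasurable).trans ?_
    refine (mul_le_mul' (hC₁ μ D U S K hw F hF) (hC₂ μ D U S K hw F hF)).trans_eq ?_
    have hB2 : 0 ≤ 1 - (1 + η) * B := by
      have : (1 + η) * r ≤ 1 := by rw [hη]; nlinarith
      nlinarith
    have hB3 : 0 ≤ 1 - (1 - η) * B := by nlinarith
    have f1 : K ^ ((1 + η) * (r / B)) * K ^ ((1 - η) * (r / B)) = (K ^ (r / B)) ^ (2 : ℝ) := by
      have : 0 ≤ r / B := by positivity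
      rw [← ENNReal.rpow_add_of_nonneg _ _ (mul_nonneg (by linarith) this)
        (mul_nonneg (by linarith) this), ← ENNReal.rpow_mul]
      congr 1
      ring
    have f2 : σ F ^ (1 - (1 + η) * B) * σ F ^ (1 - (1 - η) * B) = (σ F ^ (1 - B)) ^ (2 : ℝ) := by
      rw [← ENNReal.rpow_add_of_nonneg _ _ hB2 hB3, ← ENNReal.rpow_mul]
      congr 1
      ring
    rw [ENNReal.mul_rpow_of_nonneg _ _ (by norm_num : (0 : ℝ) ≤ 2), ← f1, ← f2, ENNReal.coe_mul]
    ring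
  refine (mul_le_mul_right (ENNReal.rpow_le_rpow hb (by norm_num)) _).trans_eq ?_
  rw [ENNReal.mul_rpow_of_nonneg _ _ (by norm_num : (0 : ℝ) ≤ 1 / 2), ← ENNReal.rpow_mul,
    ENNReal.coe_mul C₀, ← ENNReal.coe_rpow_of_nonneg _ (by norm_num : (0 : ℝ) ≤ 1 / 2)]
  norm_num
  ring

end Testing

/-- A sum of distinct powers of `R` is comparable to its largest term: if `R^k ≤ y`, then also `R^k
≤ y² R^(-k)`, and `exists_sum_le_sqrt_mul` applies with the bounds `1` and `y²`. -/
lemma exists_sum_zpow_le {R : ℝ} (hR : 1 < R) : ∃ C : ℝ≥0, ∀ {ι : Type*} (𝒯 : Finset ι)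
    (κ : ι → ℤ) (_ : Set.InjOn κ 𝒯) (y : ℝ≥0∞) (_ : ∀ i ∈ 𝒯, ENNReal.ofReal (R ^ κ i) ≤ y),
    ∑ i ∈ 𝒯, ENNReal.ofReal (R ^ κ i) ≤ C * y := by
  have hR0 : 0 < R := by linarith
  obtain ⟨C, hC⟩ := exists_sum_le_sqrt_mul hR
  refine ⟨C, fun 𝒯 κ hκ y hy => ?_⟩
  refine (hC 𝒯 κ hκ (fun i => ENNReal.ofReal (R ^ κ i)) 1 (y ^ (2 : ℝ)) ?_ ?_).trans_eq ?_
  · intro i _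
    simp
  · intro i hi
    have h0 : ENNReal.ofReal (R ^ κ i) ≠ 0 := by simpa using zpow_pos hR0 _
    rw [zpow_neg, ENNReal.ofReal_inv_of_pos (zpow_pos hR0 _), ← div_eq_mul_inv,
      ENNReal.le_div_iff_mul_le (Or.inl h0) (Or.inl ENNReal.ofReal_ne_top), ENNReal.rpow_two, sq]
    exact mul_le_mul' (hy i hi) (hy i hi)
  · rw [one_mul, ← ENNReal.rpow_mul]
    norm_num

/-- Young's inequality with exponents `1/s` and `1/(1-s)`, together with the embedding of `ℓ^(1/t)`
into `ℓ^(1/(1-s))`, valid because `1 - s ≤ t`. In the application this is where `p ≤ q` enters. -/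
lemma sum_mul_le_of_sum_rpow_le {ι : Type*} {𝒯 : Finset ι} {a b : ι → ℝ≥0∞} {s t : ℝ} (hs : 0 < s)
    (hs1 : s < 1) (ht : 0 < t) (hst : 1 ≤ s + t) {x y : ℝ≥0∞} (ha : ∑ i ∈ 𝒯, a i ^ s⁻¹ ≤ x)
    (hb : ∑ i ∈ 𝒯, b i ^ t⁻¹ ≤ y) :
    ∑ i ∈ 𝒯, a i * b i ≤ x + y ^ (t / (1 - s)) := by
  have hs1' : 0 < 1 - s := by linarith
  have hconj : (s⁻¹).HolderConjugate (1 - s)⁻¹ := by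
    rw [Real.holderConjugate_iff]
    exact ⟨(one_lt_inv₀ hs).2 hs1, by simp⟩
  have he : 0 ≤ (1 - s)⁻¹ - t⁻¹ := by
    have := inv_anti₀ hs1' (show 1 - s ≤ t by linarith)
    linarith
  have h1 : ∀ i ∈ 𝒯, a i * b i ≤ a i ^ s⁻¹ + b i ^ t⁻¹ * y ^ (t * ((1 - s)⁻¹ - t⁻¹)) := by
    intro i hi
    have hbi : b i ≤ y ^ t := by
      have := (Finset.single_le_sum (f := fun i => b i ^ t⁻¹) (fun _ _ => zero_le) hi).trans hb
      have := ENNReal.rpow_le_rpow this ht.le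
      rwa [← ENNReal.rpow_mul, inv_mul_cancel₀ ht.ne', ENNReal.rpow_one] at this
    refine (ENNReal.young_inequality _ _ hconj).trans (add_le_add ?_ ?_)
    · refine ENNReal.div_le_of_le_mul (le_mul_of_one_le_right' ?_)
      simpa using ((one_lt_inv₀ hs).2 hs1).le
    · refine (ENNReal.div_le_of_le_mul (le_mul_of_one_le_right' ?_) : _ ≤ b i ^ (1 - s)⁻¹).trans ?_
      · simpa using (one_le_inv₀ hs1').2 (by linarith)
      · calc b i ^ (1 - s)⁻¹ = b i ^ t⁻¹ * b i ^ ((1 - s)⁻¹ - t⁻¹) := by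
              rw [← ENNReal.rpow_add_of_nonneg _ _ (inv_nonneg.2 ht.le) he]
              congr 1
              ring
          _ ≤ b i ^ t⁻¹ * (y ^ t) ^ ((1 - s)⁻¹ - t⁻¹) := by gcongr
          _ = _ := by rw [ENNReal.rpow_mul]
  refine (Finset.sum_le_sum h1).trans ?_
  rw [Finset.sum_add_distrib, ← Finset.sum_mul]
  refine add_le_add ha ((mul_le_mul_left hb _).trans_eq ?_)
  conv_lhs => rw [← ENNReal.rpow_one y, ← ENNReal.rpow_mul, ← ENNReal.rpow_add_of_nonneg _ _
    zero_le_one (by positivity)]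
  congr 1
  field_simp
  ring

/-! ### Stopping sets and their children -/

section Principal

open scoped Classical in
/-- The sets of a finite family at which the function `k` exceeds its values at all larger sets. -/
def principal {X : Type*} (𝒬 : Finset (Set X)) (k : Set X → ℤ) : Finset (Set X) :=
  𝒬.filter fun Q => ∀ P ∈ 𝒬, Q ⊂ P → k P < k Q

open scoped Classical in
/-- The maximal proper subsets of `F` in a finite family. -/
def children {X : Type*} (𝒢 : Finset (Set X)) (F : Set X) : Finset (Set X) :=
  𝒢.filter fun P => P ⊂ F ∧ ∀ P' ∈ 𝒢, P' ⊂ F → P ⊆ P' → P' ⊆ P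

variable {X : Type*} {𝒬 𝒢 : Finset (Set X)} {k : Set X → ℤ}

lemma principal_subset : principal 𝒬 k ⊆ 𝒬 := by
  classical exact Finset.filter_subset _ _

lemma lt_of_mem_principal {Q P : Set X} (hQ : Q ∈ principal 𝒬 k) (hP : P ∈ 𝒬) (h : Q ⊂ P) :
    k P < k Q := by
  classical exact (Finset.mem_filter.1 hQ).2 P hP h

/-- Among the sets containing `Q` at which `k` is largest, take a maximal one: every strictly larger
set has a smaller value of `k`. -/
lemma exists_principal {Q : Set X} (hQ : Q ∈ 𝒬) :
    ∃ F ∈ principal 𝒬 k, Q ⊆ F ∧ ∀ P ∈ 𝒬, Q ⊆ P → k P ≤ k F := by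
  classical
  obtain ⟨P₀, hP₀, hmax⟩ := Finset.exists_max_image (𝒬.filter (Q ⊆ ·)) k
    ⟨Q, Finset.mem_filter.2 ⟨hQ, subset_rfl⟩⟩
  obtain ⟨F, hPF, hF⟩ := Finset.exists_le_maximal (𝒬.filter fun P => Q ⊆ P ∧ k P = k P₀)
    (a := P₀) (Finset.mem_filter.2 ⟨(Finset.mem_filter.1 hP₀).1, (Finset.mem_filter.1 hP₀).2, rfl⟩)
  have hF' := hF.prop
  simp only [Finset.mem_filter] at hF' hmax
  refine ⟨F, Finset.mem_filter.2 ⟨hF'.1, fun P hP hFP => ?_⟩, hF'.2.1, fun P hP hQP => ?_⟩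
  · rw [hF'.2.2]
    have hQP := hF'.2.1.trans hFP.subset
    refine lt_of_le_of_ne (hmax P ⟨hP, hQP⟩) fun h => hFP.2 ?_
    exact hF.le_of_ge (Finset.mem_filter.2 ⟨hP, hQP, h⟩) hFP.subset
  · rw [hF'.2.2]
    exact hmax P ⟨hP, hQP⟩

lemma mem_children {P F : Set X} : P ∈ children 𝒢 F ↔
    P ∈ 𝒢 ∧ P ⊂ F ∧ ∀ P' ∈ 𝒢, P' ⊂ F → P ⊆ P' → P' ⊆ P := by
  classical
  simp [children]

lemma exists_mem_children {P F : Set X} (hP : P ∈ 𝒢) (hPF : P ⊂ F) :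
    ∃ P' ∈ children 𝒢 F, P ⊆ P' := by
  classical
  obtain ⟨P', hPP', hP'⟩ := Finset.exists_le_maximal (𝒢.filter (· ⊂ F)) (a := P)
    (Finset.mem_filter.2 ⟨hP, hPF⟩)
  have h := Finset.mem_filter.1 hP'.prop
  exact ⟨P', mem_children.2 ⟨h.1, h.2, fun R hR hRF hle =>
    hP'.le_of_ge (Finset.mem_filter.2 ⟨hR, hRF⟩) hle⟩, hPP'⟩

variable [MeasurableSpace X]

lemma disjoint_of_mem_children (hD : IsNested (𝒢 : Set (Set X))) (F : Set X) :
    PairwiseDisjoint (children 𝒢 F : Set (Set X)) (fun P => P) := by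
  intro P hP P' hP' hne
  rw [Finset.mem_coe, mem_children] at hP hP'
  rcases hD.nested P hP.1 P' hP'.1 with h | h | h
  · exact absurd (subset_antisymm h (hP.2.2 P' hP'.1 hP'.2.1 h)) hne
  · exact absurd (subset_antisymm (hP'.2.2 P hP.1 hP.2.1 h) h) hne
  · exact h

/-- A set has at most one parent: of two nested candidates the smaller one would lie between the set
and the larger candidate. -/
lemma disjoint_children (hD : IsNested (𝒢 : Set (Set X))) (hne : ∀ P ∈ 𝒢, P.Nonempty) :
    PairwiseDisjoint (𝒢 : Set (Set X)) (children 𝒢) := by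
  intro F hF F' hF' hFF'
  refine Finset.disjoint_left.2 fun P hP hP' => ?_
  rw [mem_children] at hP hP'
  obtain ⟨x, hx⟩ := hne P hP.1
  rcases hD.nested F hF F' hF' with h | h | h
  · have h' : F ⊂ F' := h.ssubset_of_ne hFF'
    exact hP.2.1.2 (hP'.2.2 F hF h' hP.2.1.1)
  · have h' : F' ⊂ F := h.ssubset_of_ne hFF'.symm
    exact hP'.2.1.2 (hP.2.2 F' hF' h' hP'.2.1.1)
  · exact (Set.disjoint_left.1 h (hP.2.1.1 hx)) (hP'.2.1.1 hx)

lemma disjoint_diff_children (hD : IsNested (𝒢 : Set (Set X))) :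
    PairwiseDisjoint (𝒢 : Set (Set X)) (fun F => F \ ⋃ P ∈ children 𝒢 F, P) := by
  have key : ∀ F ∈ 𝒢, ∀ F' ∈ 𝒢, F ⊂ F' → ∀ x ∈ F, x ∈ ⋃ P ∈ children 𝒢 F', P := by
    intro F hF F' _ h x hx
    obtain ⟨P, hP, hFP⟩ := exists_mem_children hF h
    exact mem_iUnion₂.2 ⟨P, hP, hFP hx⟩
  intro F hF F' hF' hne
  refine Set.disjoint_left.2 fun x hx hx' => ?_
  rcases hD.nested F hF F' hF' with h | h | h
  · exact hx'.2 (key F hF F' hF' (h.ssubset_of_ne hne) x hx.1)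
  · exact hx.2 (key F' hF' F hF (h.ssubset_of_ne hne.symm) x hx'.1)
  · exact Set.disjoint_left.1 h hx.1 hx'.1

/-- The principal sets through a point form a chain along which `k` strictly increases as the sets
shrink. -/
lemma injOn_principal (hD : IsNested (𝒬 : Set (Set X))) (x : X) :
    Set.InjOn k {F | F ∈ principal 𝒬 k ∧ x ∈ F} := by
  intro F hF F' hF' hk
  by_contra hne
  rcases hD.nested F (principal_subset hF.1) F' (principal_subset hF'.1) with h | h | h
  · exact (lt_of_mem_principal hF.1 (principal_subset hF'.1) (h.ssubset_of_ne hne)).ne' hk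
  · exact (lt_of_mem_principal hF'.1 (principal_subset hF.1) (h.ssubset_of_ne (Ne.symm hne))).ne hk
  · exact Set.disjoint_left.1 h hF.2 hF'.2

end Principal

/-! ### Embedding over principal sets, and functions averaged on children -/

section Treil

variable {X : Type*} [MeasurableSpace X]

lemma exists_mem_Ico_two_zpow {y : ℝ≥0∞} (h0 : y ≠ 0) (htop : y ≠ ∞) :
    ∃ k : ℤ, ENNReal.ofReal (2 ^ k) ≤ y ∧ y ≤ 2 * ENNReal.ofReal (2 ^ k) := by
  obtain ⟨k, hk1, hk2⟩ := exists_mem_Ico_zpow (ENNReal.toReal_pos h0 htop) (one_lt_two (α := ℝ))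
  refine ⟨k, ENNReal.ofReal_le_of_le_toReal hk1, ?_⟩
  rw [← ENNReal.ofReal_ofNat, ← ENNReal.ofReal_mul (by norm_num)]
  refine ENNReal.le_ofReal_iff_toReal_le htop (by positivity) |>.2 ?_
  rw [zpow_add_one₀ (by norm_num)] at hk2
  linarith

/-- The values `2^k` over principal sets are controlled by the maximal function. -/
lemma exists_sum_principal_le {s : ℝ} (hs : 0 < s) (hs1 : s < 1) : ∃ C : ℝ≥0,
    ∀ {X : Type*} [MeasurableSpace X] (σ : Measure X) (𝒬 : Finset (Set X)),
      IsNested (𝒬 : Set (Set X)) → (∀ Q ∈ 𝒬, σ Q ≠ ∞) → ∀ (h : X → ℝ≥0∞), Measurable h →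
      ∀ k : Set X → ℤ, (∀ Q ∈ 𝒬, ENNReal.ofReal (2 ^ k Q) ≤ (∫⁻ y in Q, h y ∂σ) / σ Q) →
      ∑ F ∈ principal 𝒬 k, ENNReal.ofReal (2 ^ k F) ^ s⁻¹ * σ F ≤ C * ∫⁻ x, h x ^ s⁻¹ ∂σ := by
  classical
  have hs' : 1 < s⁻¹ := (one_lt_inv₀ hs).2 hs1
  have hR : (1 : ℝ) < 2 ^ s⁻¹ := Real.one_lt_rpow one_lt_two (by positivity)
  obtain ⟨C, hC⟩ := exists_sum_zpow_le hR
  have hfin : ENNReal.ofReal (s⁻¹ / (s⁻¹ - 1)) ^ s⁻¹ ≠ ∞ :=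
    ENNReal.rpow_ne_top_of_nonneg (by positivity) ENNReal.ofReal_ne_top
  refine ⟨C * (ENNReal.ofReal (s⁻¹ / (s⁻¹ - 1)) ^ s⁻¹).toNNReal, ?_⟩
  intro X _ σ 𝒬 hD hσ h hh k hk
  set M := dyadicSup 𝒬 (fun Q => (∫⁻ y in Q, h y ∂σ) / σ Q) with hM
  have hMm : Measurable M := hD.measurable_dyadicSup
  have hmeas : ∀ F ∈ principal 𝒬 k, MeasurableSet F := fun F hF =>
    hD.measurableSet F (principal_subset hF)
  have h1 : ∀ F ∈ principal 𝒬 k, ENNReal.ofReal (2 ^ k F) ^ s⁻¹ * σ F =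
      ∫⁻ x, F.indicator (fun _ => ENNReal.ofReal (2 ^ k F) ^ s⁻¹) x ∂σ := fun F hF => by
    rw [lintegral_indicator (hmeas F hF), setLIntegral_const]
  rw [Finset.sum_congr rfl h1, ← lintegral_finsetSum _ fun F hF =>
    measurable_const.indicator (hmeas F hF)]
  -- At `x` the summands are distinct powers of `2 ^ s⁻¹`, all at most `M x ^ s⁻¹`, so their sum is
  -- comparable to the largest.
  have hpt : ∀ x, ∑ F ∈ principal 𝒬 k, F.indicator (fun _ => ENNReal.ofReal (2 ^ k F) ^ s⁻¹) x ≤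
      C * M x ^ s⁻¹ := by
    intro x
    have : ∑ F ∈ principal 𝒬 k, F.indicator (fun _ => ENNReal.ofReal (2 ^ k F) ^ s⁻¹) x =
        ∑ F ∈ (principal 𝒬 k).filter (x ∈ ·), ENNReal.ofReal ((2 ^ s⁻¹ : ℝ) ^ k F) := by
      rw [Finset.sum_filter]
      refine Finset.sum_congr rfl fun F _ => ?_
      rw [← ofReal_zpow_rpow two_pos]
      rfl
    rw [this]
    refine hC _ k ?_ _ ?_
    · intro P hP Q hQ hPQ
      simp only [Finset.coe_filter, mem_ofPred_eq] at hP hQ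
      exact injOn_principal hD x hP hQ hPQ
    · intro F hF
      obtain ⟨hF1, hF2⟩ := Finset.mem_filter.1 hF
      rw [← ofReal_zpow_rpow two_pos]
      refine ENNReal.rpow_le_rpow ((hk F (principal_subset hF1)).trans ?_) (by positivity)
      exact le_dyadicSup (a := fun Q => (∫⁻ y in Q, h y ∂σ) / σ Q) (principal_subset hF1) hF2
  refine (lintegral_mono hpt).trans ?_
  rw [lintegral_const_mul _ (hMm.pow_const _), ENNReal.coe_mul, ENNReal.coe_toNNReal hfin, mul_assoc]
  gcongr
  exact lintegral_dyadicSup_average_rpow_le hs' hD hσ hh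

/-- The conditional expectation of `g` on the sets of `𝒞`, cut off to `F`. -/
def stoppedFun (u : Measure X) (𝒞 : Finset (Set X)) (F : Set X) (g : X → ℝ≥0∞) (x : X) : ℝ≥0∞ :=
  (F \ ⋃ P ∈ 𝒞, P).indicator g x + ∑ P ∈ 𝒞, P.indicator (fun _ => (∫⁻ y in P, g y ∂u) / u P) x

variable {u : Measure X} {𝒞 : Finset (Set X)} {F Q : Set X} {g : X → ℝ≥0∞}

lemma measurable_stoppedFun (hF : MeasurableSet F) (h𝒞 : ∀ P ∈ 𝒞, MeasurableSet P)
    (hg : Measurable g) : Measurable (stoppedFun u 𝒞 F g) := by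
  refine (hg.indicator (hF.diff (Finset.measurableSet_biUnion _ h𝒞))).add ?_
  exact Finset.measurable_fun_sum _ fun P hP => measurable_const.indicator (h𝒞 P hP)

/-- A set `Q` that meets the members of `𝒞` only by containing them does not see the averaging: the
integral over each such member is preserved. Only the inequality is needed. -/
lemma setLIntegral_le_stoppedFun (hF : MeasurableSet F) (h𝒞 : ∀ P ∈ 𝒞, MeasurableSet P)
    (hu0 : ∀ P ∈ 𝒞, u P ≠ 0) (hu1 : ∀ P ∈ 𝒞, u P ≠ ∞) (hg : Measurable g) (hQF : Q ⊆ F)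
    (hnest : ∀ P ∈ 𝒞, P ⊆ Q ∨ Disjoint P Q) :
    ∫⁻ x in Q, g x ∂u ≤ ∫⁻ x in Q, stoppedFun u 𝒞 F g x ∂u := by
  classical
  set 𝒰 := ⋃ P ∈ 𝒞, P with h𝒰
  have h𝒰m : MeasurableSet 𝒰 := Finset.measurableSet_biUnion _ h𝒞
  have hcov : Q ⊆ (Q \ 𝒰) ∪ ⋃ P ∈ 𝒞.filter (· ⊆ Q), P := by
    intro x hx
    by_cases h : x ∈ 𝒰
    · obtain ⟨P, hP, hxP⟩ := mem_iUnion₂.1 h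
      refine Or.inr (mem_iUnion₂.2 ⟨P, Finset.mem_filter.2 ⟨hP, ?_⟩, hxP⟩)
      exact (hnest P hP).resolve_right fun hd => Set.disjoint_left.1 hd hxP hx
    · exact Or.inl ⟨hx, h⟩
  have h2 : ∫⁻ x in ⋃ P ∈ 𝒞.filter (· ⊆ Q), P, g x ∂u ≤
      ∑ P ∈ 𝒞.filter (· ⊆ Q), ∫⁻ x in P, g x ∂u := by
    induction 𝒞.filter (· ⊆ Q) using Finset.induction_on with
    | empty => simp
    | insert P 𝒮 hP ih =>
      rw [Finset.set_biUnion_insert, Finset.sum_insert hP]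
      exact (lintegral_union_le _ _ _).trans (add_le_add le_rfl ih)
  have h3 : ∫⁻ x in Q, stoppedFun u 𝒞 F g x ∂u = ∫⁻ x in Q \ 𝒰, g x ∂u +
      ∑ P ∈ 𝒞, (∫⁻ y in P, g y ∂u) / u P * u (P ∩ Q) := by
    unfold stoppedFun
    rw [lintegral_add_left (hg.indicator (hF.diff h𝒰m)), lintegral_finsetSum _ fun P hP =>
      measurable_const.indicator (h𝒞 P hP), lintegral_indicator (hF.diff h𝒰m),
      Measure.restrict_restrict (hF.diff h𝒰m)]
    have hset : F \ 𝒰 ∩ Q = Q \ 𝒰 := by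
      ext x
      simp only [mem_inter_iff, mem_sdiff]
      exact ⟨fun h => ⟨h.2, h.1.2⟩, fun h => ⟨⟨hQF h.1, h.2⟩, h.1⟩⟩
    rw [hset]
    congr 1
    refine Finset.sum_congr rfl fun P hP => ?_
    rw [lintegral_indicator (h𝒞 P hP), lintegral_const, Measure.restrict_apply MeasurableSet.univ,
      univ_inter, Measure.restrict_apply (h𝒞 P hP)]
  rw [h3]
  refine (lintegral_mono_set hcov).trans ((lintegral_union_le _ _ _).trans ?_)
  refine add_le_add le_rfl (h2.trans ?_)
  refine le_trans (Finset.sum_le_sum fun P hP => ?_)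
    (Finset.sum_le_sum_of_subset (Finset.filter_subset (· ⊆ Q) 𝒞))
  obtain ⟨hP1, hP2⟩ := Finset.mem_filter.1 hP
  rw [inter_eq_left.2 hP2, ENNReal.div_mul_cancel (hu0 P hP1) (hu1 P hP1)]

/-- The pieces of `stoppedFun` have disjoint supports, so the power can be taken piece by piece. -/
lemma lintegral_stoppedFun_rpow_le {e : ℝ} (he : 0 < e) (hF : MeasurableSet F)
    (h𝒞 : ∀ P ∈ 𝒞, MeasurableSet P) (hd : PairwiseDisjoint (𝒞 : Set (Set X)) (fun P => P))
    (hg : Measurable g) :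
    ∫⁻ x, stoppedFun u 𝒞 F g x ^ e ∂u ≤ ∫⁻ x in F \ ⋃ P ∈ 𝒞, P, g x ^ e ∂u +
      ∑ P ∈ 𝒞, u P * ((∫⁻ y in P, g y ∂u) / u P) ^ e := by
  classical
  set 𝒰 := ⋃ P ∈ 𝒞, P with h𝒰
  have h𝒰m : MeasurableSet 𝒰 := Finset.measurableSet_biUnion _ h𝒞
  set c : Set X → ℝ≥0∞ := fun P => (∫⁻ y in P, g y ∂u) / u P with hc
  have hpt : ∀ x, stoppedFun u 𝒞 F g x ^ e ≤ (F \ 𝒰).indicator (fun x => g x ^ e) x +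
      ∑ P ∈ 𝒞, P.indicator (fun _ => c P ^ e) x := by
    intro x
    unfold stoppedFun
    by_cases hx : x ∈ 𝒰
    · obtain ⟨P, hP, hxP⟩ := mem_iUnion₂.1 hx
      have hsum : ∀ v : Set X → ℝ≥0∞, ∑ P ∈ 𝒞, P.indicator (fun _ => v P) x = v P := fun v => by
        rw [Finset.sum_eq_single P]
        · simp [hxP]
        · intro P' hP' hne
          exact indicator_of_notMem (fun hx' =>
            Set.disjoint_left.1 (hd hP' hP hne) hx' hxP) _
        · exact fun h => absurd hP h
      rw [hsum c, hsum (fun P => c P ^ e), indicator_of_notMem (fun h => h.2 hx), zero_add]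
      exact le_add_self
    · have hsum : ∀ v : Set X → ℝ≥0∞, ∑ P ∈ 𝒞, P.indicator (fun _ => v P) x = 0 := fun v =>
        Finset.sum_eq_zero fun P hP => indicator_of_notMem
          (fun hxP => hx (mem_iUnion₂.2 ⟨P, hP, hxP⟩)) _
      rw [hsum c, add_zero]
      refine le_trans ?_ le_self_add
      by_cases hxF : x ∈ F \ 𝒰
      · rw [indicator_of_mem hxF, indicator_of_mem hxF]
      · rw [indicator_of_notMem hxF, indicator_of_notMem hxF, ENNReal.zero_rpow_of_pos he]
  refine (lintegral_mono hpt).trans_eq ?_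
  rw [lintegral_add_left ((hg.pow_const e).indicator (hF.diff h𝒰m)),
    lintegral_finsetSum _ fun P hP => measurable_const.indicator (h𝒞 P hP),
    lintegral_indicator (hF.diff h𝒰m)]
  congr 1
  refine Finset.sum_congr rfl fun P hP => ?_
  rw [lintegral_indicator (h𝒞 P hP), setLIntegral_const, mul_comm]

end Treil

/-! ### The two weight testing theorem and duality -/

section Treil

lemma sum_mul_setLIntegral_eq {X : Type*} [MeasurableSpace X] {u : Measure X}
    {𝒬 : Finset (Set X)} (hm : ∀ Q ∈ 𝒬, MeasurableSet Q) (v : Set X → ℝ≥0∞) {g : X → ℝ≥0∞}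
    (hg : Measurable g) :
    ∑ Q ∈ 𝒬, v Q * ∫⁻ y in Q, g y ∂u = ∫⁻ x, (∑ Q ∈ 𝒬, Q.indicator (fun _ => v Q) x) * g x ∂u := by
  simp_rw [Finset.sum_mul]
  rw [lintegral_finsetSum 𝒬 (f := fun Q x => Q.indicator (fun _ => v Q) x * g x) fun Q hQ =>
    (measurable_const.indicator (hm Q hQ)).mul hg]
  refine Finset.sum_congr rfl fun Q hQ => ?_
  rw [← lintegral_const_mul _ hg, ← lintegral_indicator (hm Q hQ)]
  refine lintegral_congr fun x => ?_
  by_cases hx : x ∈ Q <;> simp [hx]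

/-- The part of the two weight testing theorem in which the first function dominates. -/
lemma exists_bound_of_testing_of_le {s t : ℝ} (hs : 0 < s) (hs1 : s < 1) (ht : 0 < t) (ht1 : t < 1)
    (hst : 1 ≤ s + t) : ∃ C : ℝ≥0, ∀ {X : Type*} [MeasurableSpace X] (u σ : Measure X)
      (𝒬 : Finset (Set X)), IsNested (𝒬 : Set (Set X)) →
      (∀ Q ∈ 𝒬, u Q ≠ 0) → (∀ Q ∈ 𝒬, u Q ≠ ∞) → (∀ Q ∈ 𝒬, σ Q ≠ 0) → (∀ Q ∈ 𝒬, σ Q ≠ ∞) →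
      ∀ (c : Set X → ℝ≥0∞) (L : ℝ≥0∞),
      (∀ F ∈ 𝒬, ∀ 𝒬' ⊆ 𝒬, (∀ Q ∈ 𝒬', Q ⊆ F) → recipNorm u (1 - t)
        (fun x => ∑ Q ∈ 𝒬', Q.indicator (fun _ => c Q * σ Q) x) ≤ L * σ F ^ s) →
      ∀ h g : X → ℝ≥0∞, Measurable h → Measurable g → ∫⁻ x, h x ^ s⁻¹ ∂σ ≤ 1 →
      ∫⁻ x, g x ^ t⁻¹ ∂u ≤ 1 →
      (∀ Q ∈ 𝒬, u Q * ((∫⁻ y in Q, g y ∂u) / u Q) ^ t⁻¹ ≤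
        σ Q * ((∫⁻ y in Q, h y ∂σ) / σ Q) ^ s⁻¹) →
      ∑ Q ∈ 𝒬, c Q * (∫⁻ y in Q, h y ∂σ) * ∫⁻ y in Q, g y ∂u ≤ C * L := by
  classical
  obtain ⟨C₁, hC₁⟩ := exists_sum_principal_le hs hs1
  set C₂ : ℝ≥0 := 1 + 2 ^ s⁻¹ * C₁ with hC₂
  refine ⟨2 * (C₁ + C₂ ^ (t / (1 - s))), ?_⟩
  intro X _ u σ 𝒬₀ hD₀ hu0 hu1 hσ0 hσ1 c L hL h g hh hg hhn hgn hle
  have hs' : 1 ≤ s⁻¹ := (one_le_inv₀ hs).2 hs1.le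
  have ht' : 1 ≤ t⁻¹ := (one_le_inv₀ ht).2 ht1.le
  -- Sets on which `h` has zero integral contribute nothing, and no power of two is comparable to
  -- their average.
  set 𝒬 := 𝒬₀.filter (fun Q => ∫⁻ y in Q, h y ∂σ ≠ 0) with h𝒬
  have hsub : 𝒬 ⊆ 𝒬₀ := Finset.filter_subset _ _
  have hD : IsNested (𝒬 : Set (Set X)) := hD₀.mono (by exact_mod_cast hsub)
  have hsum0 : ∑ Q ∈ 𝒬₀, c Q * (∫⁻ y in Q, h y ∂σ) * ∫⁻ y in Q, g y ∂u =
      ∑ Q ∈ 𝒬, c Q * (∫⁻ y in Q, h y ∂σ) * ∫⁻ y in Q, g y ∂u := by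
    refine (Finset.sum_subset hsub fun Q hQ hQ' => ?_).symm
    have : ∫⁻ y in Q, h y ∂σ = 0 := by
      by_contra hne
      exact hQ' (Finset.mem_filter.2 ⟨hQ, hne⟩)
    simp [this]
  rw [hsum0]
  have hk : ∀ Q ∈ 𝒬, ∃ k : ℤ, ENNReal.ofReal (2 ^ k) ≤ (∫⁻ y in Q, h y ∂σ) / σ Q ∧
      (∫⁻ y in Q, h y ∂σ) / σ Q ≤ 2 * ENNReal.ofReal (2 ^ k) := by
    intro Q hQ
    refine exists_mem_Ico_two_zpow ?_ ?_
    · exact (ENNReal.div_pos (Finset.mem_filter.1 hQ).2 (hσ1 Q (hsub hQ))).ne'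
    · exact div_measure_ne_top (setLIntegral_ne_top_of_rpow hs' (hσ1 Q (hsub hQ))
        (ne_top_of_le_ne_top ENNReal.one_ne_top hhn))
  choose! k hk1 hk2 using hk
  set 𝒢 := principal 𝒬 k with h𝒢
  have h𝒢𝒬 : 𝒢 ⊆ 𝒬 := principal_subset
  have hD𝒢 : IsNested (𝒢 : Set (Set X)) := hD.mono (by exact_mod_cast h𝒢𝒬)
  have hmeas : ∀ Q ∈ 𝒬, MeasurableSet Q := fun Q hQ => hD.measurableSet Q hQ
  have hne : ∀ P ∈ 𝒢, P.Nonempty := fun P hP => nonempty_of_measure_ne_zero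
    (hu0 P (hsub (h𝒢𝒬 hP)))
  have hch : ∀ F, children 𝒢 F ⊆ 𝒢 := fun F P hP => (mem_children.1 hP).1
  have hπ : ∀ Q ∈ 𝒬, ∃ F ∈ 𝒢, Q ⊆ F ∧ ∀ P ∈ 𝒬, Q ⊆ P → k P ≤ k F := fun Q hQ =>
    exists_principal hQ
  choose! π hπ1 hπ2 hπ3 using hπ
  set a : Set X → ℝ≥0∞ := fun F => ENNReal.ofReal (2 ^ k F) * σ F ^ s with ha
  set G : Set X → X → ℝ≥0∞ := fun F => stoppedFun u (children 𝒢 F) F g with hG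
  have hGm : ∀ F ∈ 𝒢, Measurable (G F) := fun F hF => measurable_stoppedFun
    (hmeas F (h𝒢𝒬 hF)) (fun P hP => hmeas P (h𝒢𝒬 (hch F hP))) hg
  set b : Set X → ℝ≥0∞ := fun F => recipNorm u t (G F) with hb
  have hF : ∀ F ∈ 𝒢, ∑ Q ∈ 𝒬.filter (fun Q => π Q = F),
      c Q * (∫⁻ y in Q, h y ∂σ) * ∫⁻ y in Q, g y ∂u ≤ 2 * L * (a F * b F) := by
    intro F hF
    set 𝒬' := 𝒬.filter (fun Q => π Q = F) with h𝒬'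
    have hQF : ∀ Q ∈ 𝒬', Q ⊆ F := fun Q hQ => by
      obtain ⟨h1, h2⟩ := Finset.mem_filter.1 hQ
      rw [← h2]
      exact hπ2 Q h1
    -- Within the group of `F`, the average of `h` over `Q` is at most `2 * 2^(k F)`, and `g` may be
    -- replaced by its version averaged on the children of `F`. What remains is a testing sum on `F`
    -- integrated against `G F`.
    have hterm : ∀ Q ∈ 𝒬', c Q * (∫⁻ y in Q, h y ∂σ) * ∫⁻ y in Q, g y ∂u ≤
        2 * ENNReal.ofReal (2 ^ k F) * (c Q * σ Q * ∫⁻ y in Q, G F y ∂u) := by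
      intro Q hQ
      obtain ⟨hQ1, hQ2⟩ := Finset.mem_filter.1 hQ
      have h1 : ∫⁻ y in Q, h y ∂σ ≤ 2 * ENNReal.ofReal (2 ^ k F) * σ Q := by
        rw [← ENNReal.div_le_iff (hσ0 Q (hsub hQ1)) (hσ1 Q (hsub hQ1))]
        refine (hk2 Q hQ1).trans (mul_le_mul_right (ENNReal.ofReal_le_ofReal ?_) _)
        have := hπ3 Q hQ1 Q hQ1 subset_rfl
        rw [hQ2] at this
        exact zpow_le_zpow_right₀ one_le_two this
      have h2 : ∫⁻ y in Q, g y ∂u ≤ ∫⁻ y in Q, G F y ∂u := by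
        refine setLIntegral_le_stoppedFun (hmeas F (h𝒢𝒬 hF))
          (fun P hP => hmeas P (h𝒢𝒬 (hch F hP))) (fun P hP => hu0 P (hsub (h𝒢𝒬 (hch F hP))))
          (fun P hP => hu1 P (hsub (h𝒢𝒬 (hch F hP)))) hg (hQF Q hQ) fun P hP => ?_
        have hP' := mem_children.1 hP
        rcases hD.nested P (h𝒢𝒬 hP'.1) Q hQ1 with h | h | h
        · exact Or.inl h
        -- A child `P` of `F` cannot contain `Q`: it would have `k P > k F`, whereas `F = π Q`
        -- maximises `k` over the sets containing `Q`.
        · have h3 := hπ3 Q hQ1 P (h𝒢𝒬 hP'.1) h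
          rw [hQ2] at h3
          exact absurd h3 (not_le.2 (lt_of_mem_principal hP'.1 (h𝒢𝒬 hF) hP'.2.1))
        · exact Or.inr h
      calc c Q * (∫⁻ y in Q, h y ∂σ) * ∫⁻ y in Q, g y ∂u
          ≤ c Q * (2 * ENNReal.ofReal (2 ^ k F) * σ Q) * ∫⁻ y in Q, G F y ∂u := by gcongr
        _ = _ := by ring
    have hint : ∑ Q ∈ 𝒬', c Q * σ Q * ∫⁻ y in Q, G F y ∂u =
        ∫⁻ x, (∑ Q ∈ 𝒬', Q.indicator (fun _ => c Q * σ Q) x) * G F x ∂u :=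
      sum_mul_setLIntegral_eq (fun Q hQ => hmeas Q (Finset.filter_subset _ _ hQ)) _ (hGm F hF)
    have hhol : ∫⁻ x, (∑ Q ∈ 𝒬', Q.indicator (fun _ => c Q * σ Q) x) * G F x ∂u ≤
        L * σ F ^ s * b F := by
      have hm : Measurable fun x => ∑ Q ∈ 𝒬', Q.indicator (fun _ => c Q * σ Q) x :=
        Finset.measurable_fun_sum _ fun Q hQ => measurable_const.indicator
          (hmeas Q (Finset.filter_subset _ _ hQ))
      have := recipNorm_mul_le (μ := u) (s := 1 - t) (t := t) (by linarith) ht hm.aemeasurable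
        (hGm F hF).aemeasurable
      rw [sub_add_cancel] at this
      simp only [recipNorm, inv_one, ENNReal.rpow_one] at this
      refine this.trans (mul_le_mul' ?_ le_rfl)
      exact hL F (hsub (h𝒢𝒬 hF)) 𝒬' ((Finset.filter_subset _ _).trans hsub) hQF
    refine (Finset.sum_le_sum hterm).trans ?_
    rw [← Finset.mul_sum, hint]
    refine (mul_le_mul_right hhol _).trans_eq ?_
    rw [ha]
    ring
  have hsumF : ∑ Q ∈ 𝒬, c Q * (∫⁻ y in Q, h y ∂σ) * ∫⁻ y in Q, g y ∂u ≤
      2 * L * ∑ F ∈ 𝒢, a F * b F := by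
    rw [← Finset.sum_fiberwise_of_maps_to hπ1, Finset.mul_sum]
    exact Finset.sum_le_sum hF
  have hprin := hC₁ σ 𝒬 hD (fun Q hQ => hσ1 Q (hsub hQ)) h hh k hk1
  have hprin' : ∑ F ∈ 𝒢, ENNReal.ofReal (2 ^ k F) ^ s⁻¹ * σ F ≤ C₁ :=
    hprin.trans ((mul_le_mul_right hhn _).trans_eq (mul_one _))
  have hasum : ∑ F ∈ 𝒢, a F ^ s⁻¹ ≤ C₁ := by
    refine le_trans (Finset.sum_le_sum fun F _ => le_of_eq ?_) hprin'
    rw [ha]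
    simp only
    rw [ENNReal.mul_rpow_of_nonneg _ _ (by positivity), ← ENNReal.rpow_mul, mul_inv_cancel₀ hs.ne',
      ENNReal.rpow_one]
  -- Off the children the sets are disjoint and `g` contributes at most `1`. On the children the
  -- domination hypothesis replaces averages of `g` by averages of `h`, and since each principal set
  -- is the child of at most one other, the embedding over principal sets applies again.
  have hbsum : ∑ F ∈ 𝒢, b F ^ t⁻¹ ≤ C₂ := by
    have h1 : ∀ F ∈ 𝒢, b F ^ t⁻¹ ≤ ∫⁻ x in F \ ⋃ P ∈ children 𝒢 F, P, g x ^ t⁻¹ ∂u +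
        ∑ P ∈ children 𝒢 F, 2 ^ s⁻¹ * (ENNReal.ofReal (2 ^ k P) ^ s⁻¹ * σ P) := by
      intro F hF
      rw [hb]
      simp only [recipNorm]
      rw [← ENNReal.rpow_mul, mul_inv_cancel₀ ht.ne', ENNReal.rpow_one]
      refine (lintegral_stoppedFun_rpow_le (by positivity) (hmeas F (h𝒢𝒬 hF))
        (fun P hP => hmeas P (h𝒢𝒬 (hch F hP))) (disjoint_of_mem_children hD𝒢 F) hg).trans ?_
      refine add_le_add le_rfl (Finset.sum_le_sum fun P hP => ?_)
      have hP𝒬 := h𝒢𝒬 (hch F hP)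
      refine (hle P (hsub hP𝒬)).trans ?_
      calc σ P * ((∫⁻ y in P, h y ∂σ) / σ P) ^ s⁻¹
          ≤ σ P * (2 * ENNReal.ofReal (2 ^ k P)) ^ s⁻¹ := by
            gcongr
            exact hk2 P hP𝒬
        _ = _ := by
            rw [ENNReal.mul_rpow_of_nonneg _ _ (by positivity)]
            ring
    refine (Finset.sum_le_sum h1).trans ?_
    rw [Finset.sum_add_distrib]
    have h2 : ∑ F ∈ 𝒢, ∫⁻ x in F \ ⋃ P ∈ children 𝒢 F, P, g x ^ t⁻¹ ∂u ≤ 1 := by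
      rw [← lintegral_biUnion_finset (disjoint_diff_children hD𝒢) fun F hF =>
        (hmeas F (h𝒢𝒬 hF)).diff (Finset.measurableSet_biUnion _ fun P hP =>
          hmeas P (h𝒢𝒬 (hch F hP)))]
      exact (setLIntegral_le_lintegral _ _).trans hgn
    have h3 : ∑ F ∈ 𝒢, ∑ P ∈ children 𝒢 F, 2 ^ s⁻¹ * (ENNReal.ofReal (2 ^ k P) ^ s⁻¹ * σ P) ≤
        2 ^ s⁻¹ * (C₁ : ℝ≥0∞) := by
      rw [← Finset.sum_biUnion (disjoint_children hD𝒢 hne), ← Finset.mul_sum]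
      refine mul_le_mul_right (le_trans (Finset.sum_le_sum_of_subset ?_) hprin') _
      exact Finset.biUnion_subset.2 fun F _ => hch F
    refine (add_le_add h2 h3).trans_eq ?_
    rw [hC₂]
    push_cast
    rw [ENNReal.coe_rpow_of_nonneg _ (by positivity)]
    rfl
  refine hsumF.trans ((mul_le_mul_right
    (sum_mul_le_of_sum_rpow_le hs hs1 ht hst hasum hbsum) _).trans_eq ?_)
  have : 0 ≤ t / (1 - s) := div_nonneg ht.le (by linarith)
  push_cast
  rw [ENNReal.coe_rpow_of_nonneg _ this]
  ring

/-- The two weight testing theorem for positive operators on a finite nested family. -/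
lemma exists_bound_of_testing {s t : ℝ} (hs : 0 < s) (hs1 : s < 1) (ht : 0 < t) (ht1 : t < 1)
    (hst : 1 ≤ s + t) : ∃ C : ℝ≥0, ∀ {X : Type*} [MeasurableSpace X] (u σ : Measure X)
      (𝒬 : Finset (Set X)), IsNested (𝒬 : Set (Set X)) →
      (∀ Q ∈ 𝒬, u Q ≠ 0) → (∀ Q ∈ 𝒬, u Q ≠ ∞) → (∀ Q ∈ 𝒬, σ Q ≠ 0) → (∀ Q ∈ 𝒬, σ Q ≠ ∞) →
      ∀ (c : Set X → ℝ≥0∞) (L L' : ℝ≥0∞),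
      (∀ F ∈ 𝒬, ∀ 𝒬' ⊆ 𝒬, (∀ Q ∈ 𝒬', Q ⊆ F) → recipNorm u (1 - t)
        (fun x => ∑ Q ∈ 𝒬', Q.indicator (fun _ => c Q * σ Q) x) ≤ L * σ F ^ s) →
      (∀ F ∈ 𝒬, ∀ 𝒬' ⊆ 𝒬, (∀ Q ∈ 𝒬', Q ⊆ F) → recipNorm σ (1 - s)
        (fun x => ∑ Q ∈ 𝒬', Q.indicator (fun _ => c Q * u Q) x) ≤ L' * u F ^ t) →
      ∀ h g : X → ℝ≥0∞, Measurable h → Measurable g → ∫⁻ x, h x ^ s⁻¹ ∂σ ≤ 1 →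
      ∫⁻ x, g x ^ t⁻¹ ∂u ≤ 1 →
      ∑ Q ∈ 𝒬, c Q * (∫⁻ y in Q, h y ∂σ) * ∫⁻ y in Q, g y ∂u ≤ C * (L + L') := by
  classical
  obtain ⟨C₁, hC₁⟩ := exists_bound_of_testing_of_le hs hs1 ht ht1 hst
  obtain ⟨C₂, hC₂⟩ := exists_bound_of_testing_of_le ht ht1 hs hs1 (by linarith)
  refine ⟨C₁ + C₂, ?_⟩
  intro X _ u σ 𝒬 hD hu0 hu1 hσ0 hσ1 c L L' hL hL' h g hh hg hhn hgn
  -- Split according to which function dominates. Each half is handled by the one-sided result, with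
  -- the roles exchanged in the second; the testing hypotheses pass to subfamilies.
  set p : Set X → Prop := fun Q => u Q * ((∫⁻ y in Q, g y ∂u) / u Q) ^ t⁻¹ ≤
        σ Q * ((∫⁻ y in Q, h y ∂σ) / σ Q) ^ s⁻¹ with hp
  have hs1 : 𝒬.filter p ⊆ 𝒬 := Finset.filter_subset _ _
  have hs2 : 𝒬.filter (fun Q => ¬ p Q) ⊆ 𝒬 := Finset.filter_subset _ _
  rw [← Finset.sum_filter_add_sum_filter_not 𝒬 p]
  have h1 := hC₁ u σ (𝒬.filter p) (hD.mono (by exact_mod_cast hs1)) (fun Q hQ => hu0 Q (hs1 hQ))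
    (fun Q hQ => hu1 Q (hs1 hQ)) (fun Q hQ => hσ0 Q (hs1 hQ)) (fun Q hQ => hσ1 Q (hs1 hQ)) c L
    (fun F hF 𝒬' h𝒬' => hL F (hs1 hF) 𝒬' (h𝒬'.trans hs1)) h g hh hg hhn hgn
    (fun Q hQ => (Finset.mem_filter.1 hQ).2)
  have h2 := hC₂ σ u (𝒬.filter (fun Q => ¬ p Q)) (hD.mono (by exact_mod_cast hs2))
    (fun Q hQ => hσ0 Q (hs2 hQ))
    (fun Q hQ => hσ1 Q (hs2 hQ)) (fun Q hQ => hu0 Q (hs2 hQ)) (fun Q hQ => hu1 Q (hs2 hQ)) c L'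
    (fun F hF 𝒬' h𝒬' => hL' F (hs2 hF) 𝒬' (h𝒬'.trans hs2)) g h hg hh hgn hhn
    (fun Q hQ => (not_le.1 (Finset.mem_filter.1 hQ).2).le)
  rw [Finset.sum_congr rfl fun Q _ => mul_right_comm (c Q) _ _] at h2
  refine (add_le_add h1 h2).trans ?_
  push_cast
  rw [add_mul]
  gcongr
  · exact le_self_add
  · exact le_add_self

variable {X : Type*} [MeasurableSpace X]

/-- A bilinear bound gives a norm bound by duality. -/
lemma recipNorm_sum_le_of_bilinear {A s : ℝ} (hA : 0 < A) (hA1 : A < 1) (hs : 0 < s) (hs1 : s ≤ 1)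
    {u σ : Measure X} {𝒬 : Finset (Set X)} (hm : ∀ Q ∈ 𝒬, MeasurableSet Q)
    (hu1 : ∀ Q ∈ 𝒬, u Q ≠ ∞) (hσ1 : ∀ Q ∈ 𝒬, σ Q ≠ ∞) {c : Set X → ℝ≥0∞}
    (hc : ∀ Q ∈ 𝒬, c Q ≠ ∞) {N : ℝ≥0∞}
    (H : ∀ h g : X → ℝ≥0∞, Measurable h → Measurable g → ∫⁻ x, h x ^ s⁻¹ ∂σ ≤ 1 →
      ∫⁻ x, g x ^ (1 - A)⁻¹ ∂u ≤ 1 →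
      ∑ Q ∈ 𝒬, c Q * (∫⁻ y in Q, h y ∂σ) * ∫⁻ y in Q, g y ∂u ≤ N)
    {h : X → ℝ≥0∞} (hh : Measurable h) (hfin : recipNorm σ s h ≠ ∞) :
    recipNorm u A (fun x => ∑ Q ∈ 𝒬, Q.indicator (fun _ => c Q * ∫⁻ y in Q, h y ∂σ) x) ≤
      N * recipNorm σ s h := by
  classical
  have hA1' : 0 < 1 - A := by linarith
  have hnorm : ∀ h : X → ℝ≥0∞, Measurable h → ∫⁻ x, h x ^ s⁻¹ ∂σ ≤ 1 →
      recipNorm u A (fun x => ∑ Q ∈ 𝒬, Q.indicator (fun _ => c Q * ∫⁻ y in Q, h y ∂σ) x) ≤ N := by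
    intro h hh hhn
    set T : X → ℝ≥0∞ := fun x => ∑ Q ∈ 𝒬, Q.indicator (fun _ => c Q * ∫⁻ y in Q, h y ∂σ) x with hT
    have hTm : Measurable T := Finset.measurable_fun_sum _ fun Q hQ =>
      measurable_const.indicator (hm Q hQ)
    set M : ℝ≥0∞ := ∑ Q ∈ 𝒬, c Q * ∫⁻ y in Q, h y ∂σ with hM
    have hMfin : M ≠ ∞ := ENNReal.sum_ne_top.2 fun Q hQ => ENNReal.mul_ne_top (hc Q hQ)
      (setLIntegral_ne_top_of_rpow ((one_le_inv₀ hs).2 hs1) (hσ1 Q hQ)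
        (ne_top_of_le_ne_top ENNReal.one_ne_top hhn))
    have hTle : ∀ x, T x ≤ (⋃ Q ∈ 𝒬, Q).indicator (fun _ => M) x := by
      intro x
      by_cases hx : x ∈ ⋃ Q ∈ 𝒬, Q
      · rw [indicator_of_mem hx]
        exact Finset.sum_le_sum fun Q _ => indicator_le_self' (fun _ _ => zero_le) x
      · rw [indicator_of_notMem hx, hT]
        refine le_of_eq (Finset.sum_eq_zero fun Q hQ => ?_)
        exact indicator_of_notMem (fun hxQ => hx (mem_iUnion₂.2 ⟨Q, hQ, hxQ⟩)) _
    have hTfin : ∀ x, T x ≠ ∞ := fun x => ne_top_of_le_ne_top hMfin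
      ((hTle x).trans (indicator_le_self' (fun _ _ => zero_le) x))
    set I := ∫⁻ x, T x ^ A⁻¹ ∂u with hI
    have hIfin : I ≠ ∞ := by
      have : ∀ x, T x ^ A⁻¹ ≤ (⋃ Q ∈ 𝒬, Q).indicator (fun _ => M ^ A⁻¹) x := by
        intro x
        refine (ENNReal.rpow_le_rpow (hTle x) (by positivity)).trans ?_
        by_cases hx : x ∈ ⋃ Q ∈ 𝒬, Q
        · rw [indicator_of_mem hx, indicator_of_mem hx]
        · rw [indicator_of_notMem hx, indicator_of_notMem hx,
            ENNReal.zero_rpow_of_pos (by positivity)]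
      refine ne_top_of_le_ne_top ?_ (lintegral_mono this)
      rw [lintegral_indicator (Finset.measurableSet_biUnion _ hm), setLIntegral_const]
      refine ENNReal.mul_ne_top (ENNReal.rpow_ne_top_of_nonneg (by positivity) hMfin) ?_
      exact ((measure_biUnion_finset_le _ _).trans_lt
        (ENNReal.sum_lt_top.2 fun Q hQ => (hu1 Q hQ).lt_top)).ne
    rcases eq_or_ne I 0 with hI0 | hI0
    · rw [recipNorm, ← hI, hI0, ENNReal.zero_rpow_of_pos hA]
      exact zero_le
    -- The extremal function in Hölder's inequality for `T`, normalised in the dual space.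
    set g : X → ℝ≥0∞ := fun x => T x ^ (A⁻¹ - 1) * I ^ (-(1 - A)) with hg
    have hA2 : 0 ≤ A⁻¹ - 1 := by
      have := (one_le_inv₀ hA).2 hA1.le
      linarith
    have hgm : Measurable g := (hTm.pow_const _).mul_const _
    have hgn : ∫⁻ x, g x ^ (1 - A)⁻¹ ∂u ≤ 1 := by
      have : ∀ x, g x ^ (1 - A)⁻¹ = T x ^ A⁻¹ * I⁻¹ := by
        intro x
        rw [hg]
        simp only
        rw [ENNReal.mul_rpow_of_nonneg _ _ (by positivity), ← ENNReal.rpow_mul, ← ENNReal.rpow_mul,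
          ← ENNReal.rpow_neg_one I]
        congr 2 <;> field_simp
      simp_rw [this]
      rw [lintegral_mul_const _ (hTm.pow_const _), ← hI, ENNReal.mul_inv_cancel hI0 hIfin]
    have h1 := H h g hh hgm hhn hgn
    have h2 : ∑ Q ∈ 𝒬, c Q * (∫⁻ y in Q, h y ∂σ) * ∫⁻ y in Q, g y ∂u = ∫⁻ x, T x * g x ∂u :=
      sum_mul_setLIntegral_eq hm _ hgm
    have h3 : ∀ x, T x * g x = T x ^ A⁻¹ * I ^ (-(1 - A)) := by
      intro x
      rw [hg]
      simp only
      rw [← mul_assoc]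
      congr 1
      conv_lhs => rw [← ENNReal.rpow_one (T x), ← ENNReal.rpow_mul,
        ← ENNReal.rpow_add_of_nonneg _ _ zero_le_one (by linarith)]
      congr 1
      ring
    rw [h2] at h1
    simp_rw [h3] at h1
    rw [lintegral_mul_const _ (hTm.pow_const _), ← hI] at h1
    refine le_trans (le_of_eq ?_) h1
    rw [recipNorm, ← hI]
    conv_rhs => rw [← ENNReal.rpow_one I, ← ENNReal.rpow_mul, ← ENNReal.rpow_add _ _ hI0 hIfin]
    congr 1
    ring
  -- The general case follows by homogeneity; when the norm vanishes, `h` is null for `σ` and both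
  -- sides are zero.
  set n := recipNorm σ s h with hn
  rcases eq_or_ne n 0 with h0 | h0
  · have hz : ∀ Q ∈ 𝒬, ∫⁻ y in Q, h y ∂σ = 0 := by
      rw [hn, recipNorm, ENNReal.rpow_eq_zero_iff_of_pos hs,
        lintegral_eq_zero_iff (hh.pow_const _)] at h0
      intro Q hQ
      rw [lintegral_eq_zero_iff hh]
      refine ae_restrict_of_ae (h0.mono fun x hx => ?_)
      simpa [ENNReal.rpow_eq_zero_iff_of_pos (inv_pos.2 hs)] using hx
    have : ∀ x, ∑ Q ∈ 𝒬, Q.indicator (fun _ => c Q * ∫⁻ y in Q, h y ∂σ) x = 0 := fun x =>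
      Finset.sum_eq_zero fun Q hQ => by simp [hz Q hQ]
    simp_rw [this]
    simp [recipNorm, hA]
  · have hh' : Measurable fun x => n⁻¹ * h x := hh.const_mul _
    have h1 : ∫⁻ x, (n⁻¹ * h x) ^ s⁻¹ ∂σ ≤ 1 := by
      have := recipNorm_const_mul (μ := σ) hs n⁻¹ hh
      rw [← hn, ENNReal.inv_mul_cancel h0 hfin, recipNorm] at this
      have h2 := congrArg (· ^ s⁻¹) this
      simp only [ENNReal.one_rpow] at h2
      rw [← ENNReal.rpow_mul, mul_inv_cancel₀ hs.ne', ENNReal.rpow_one] at h2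
      exact h2.le
    have h2 := hnorm _ hh' h1
    have h3 : ∀ x, ∑ Q ∈ 𝒬, Q.indicator (fun _ => c Q * ∫⁻ y in Q, h y ∂σ) x =
        n * ∑ Q ∈ 𝒬, Q.indicator (fun _ => c Q * ∫⁻ y in Q, n⁻¹ * h y ∂σ) x := by
      intro x
      rw [Finset.mul_sum]
      refine Finset.sum_congr rfl fun Q hQ => ?_
      by_cases hx : x ∈ Q
      · rw [indicator_of_mem hx, indicator_of_mem hx, lintegral_const_mul _ hh,
          mul_left_comm (c Q), ← mul_assoc, ENNReal.mul_inv_cancel h0 hfin, one_mul]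
      · simp [hx]
    simp_rw [h3]
    rw [recipNorm_const_mul hA _ (Finset.measurable_fun_sum _ fun Q hQ =>
      measurable_const.indicator (hm Q hQ)), mul_comm]
    exact mul_le_mul_left h2 _

end Treil

/-! ### The sharp weighted bound for the dyadic fractional integral -/

section DyadicSum

variable {X : Type*} [MeasurableSpace X]

/-- The sum of the numbers `a Q` over the sets `Q` of the family `D` that contain `x`. -/
def dyadicSum (D : Set (Set X)) (a : Set X → ℝ≥0∞) (x : X) : ℝ≥0∞ :=
  ⨆ (𝒬 : Finset (Set X)) (_ : ↑𝒬 ⊆ D), ∑ Q ∈ 𝒬, Q.indicator (fun _ => a Q) x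

lemma measurable_dyadicSum {D : Set (Set X)} (hD : IsNested D) {a : Set X → ℝ≥0∞} :
    Measurable (dyadicSum D a) := by
  have : Countable D := hD.countable
  have h : dyadicSum D a = fun x => ⨆ 𝒬 : Finset D, ∑ Q ∈ 𝒬.map (Function.Embedding.subtype _),
      Q.indicator (fun _ => a Q) x := funext fun x => iSup_finset_subset_eq _
  rw [h]
  exact Measurable.iSup fun 𝒬 => Finset.measurable_fun_sum _ fun Q hQ =>
    measurable_const.indicator (hD.measurableSet Q (coe_map_subtype_subset 𝒬 hQ))

/-- The sharp weighted bound for the dyadic fractional integral operator. -/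
theorem exists_recipNorm_dyadicSum_le (X : Type*) [MeasurableSpace X] {A B ρ : ℝ} (hA : 0 < A)
    (hB : 0 < B) (hAB : A + B < 1) (hρ : 1 < ρ) : ∃ C : ℝ≥0, ∀ (μ : Measure X) (D : Set (Set X))
      (U S : X → ℝ≥0∞) (K : ℝ≥0∞) (κ : Set X → ℤ), WeightPair μ D A B U S K → IsGraded μ D ρ κ →
      ∀ h : X → ℝ≥0∞, Measurable h → recipNorm (μ.withDensity S) (1 - B) h ≠ ∞ →
      recipNorm (μ.withDensity U) A
        (dyadicSum D fun Q => μ Q ^ (-(A + B)) * ∫⁻ y in Q, h y ∂μ.withDensity S) ≤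
      C * (K ^ ((A + B) / B) + K ^ ((A + B) / A)) * recipNorm (μ.withDensity S) (1 - B) h := by
  classical
  obtain ⟨C₁, hC₁⟩ := exists_testing_bound X hA hB hAB hρ
  obtain ⟨C₂, hC₂⟩ := exists_testing_bound X hB hA (by linarith) hρ
  -- The indices are reciprocals of `p` and of the conjugate of `q`; their sum is `2 - (A + B) ≥ 1`.
  obtain ⟨C₃, hC₃⟩ := exists_bound_of_testing (s := 1 - B) (t := 1 - A) (by linarith) (by linarith)
    (by linarith) (by linarith) (by linarith)
  refine ⟨C₃ * (C₁ + C₂), ?_⟩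
  intro μ D U S K κ hw hκ h hh hfin
  set u := μ.withDensity U with hu
  set σ := μ.withDensity S with hσ
  set N : ℝ≥0∞ := C₃ * (C₁ * K ^ ((A + B) / B) + C₂ * K ^ ((A + B) / A)) with hN
  have hfinite : ∀ 𝒬 : Finset (Set X), ↑𝒬 ⊆ D → recipNorm u A (fun x => ∑ Q ∈ 𝒬,
      Q.indicator (fun _ => μ Q ^ (-(A + B)) * ∫⁻ y in Q, h y ∂σ) x) ≤
      N * recipNorm σ (1 - B) h := by
    intro 𝒬 h𝒬
    have hm : ∀ Q ∈ 𝒬, MeasurableSet Q := fun Q hQ => hw.nested.measurableSet Q (h𝒬 hQ)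
    refine recipNorm_sum_le_of_bilinear hA (by linarith) (by linarith) (by linarith) hm
      (fun Q hQ => hw.left_ne_top (h𝒬 hQ)) (fun Q hQ => hw.swap.left_ne_top (h𝒬 hQ))
      (fun Q hQ => ENNReal.rpow_ne_top_of_ne_zero (hw.measure_ne_zero Q (h𝒬 hQ))
        (hw.measure_ne_top Q (h𝒬 hQ))) ?_ hh hfin
    refine fun h g => hC₃ u σ 𝒬 (hw.nested.mono h𝒬) (fun Q hQ => hw.left_ne_zero (h𝒬 hQ))
      (fun Q hQ => hw.left_ne_top (h𝒬 hQ)) (fun Q hQ => hw.swap.left_ne_zero (h𝒬 hQ))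
      (fun Q hQ => hw.swap.left_ne_top (h𝒬 hQ)) _ _ _ ?_ ?_ h g
    · intro F hF 𝒬' h𝒬' hQF
      rw [sub_sub_cancel]
      exact hC₁ μ D U S K κ hw hκ 𝒬' (fun Q hQ => h𝒬 (h𝒬' hQ)) F (hm F hF) hQF
    -- The dual testing condition is the same estimate for the swapped pair, whence the second power
    -- `K^((A+B)/A)`.
    · intro F hF 𝒬' h𝒬' hQF
      rw [sub_sub_cancel, add_comm A B]
      exact hC₂ μ D S U K κ hw.swap hκ 𝒬' (fun Q hQ => h𝒬 (h𝒬' hQ)) F (hm F hF) hQF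
  have hlim := lintegral_le_of_finset (μ := u) hw.nested.countable
    (T := fun 𝒬 x => (∑ Q ∈ 𝒬, Q.indicator
      (fun _ => μ Q ^ (-(A + B)) * ∫⁻ y in Q, h y ∂σ) x) ^ A⁻¹)
    (c := (N * recipNorm σ (1 - B) h) ^ A⁻¹) ?_ ?_ ?_
  · have hpt : ∀ x, dyadicSum D (fun Q => μ Q ^ (-(A + B)) * ∫⁻ y in Q, h y ∂σ) x ^ A⁻¹ ≤
        ⨆ (𝒬 : Finset (Set X)) (_ : ↑𝒬 ⊆ D), (∑ Q ∈ 𝒬, Q.indicator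
          (fun _ => μ Q ^ (-(A + B)) * ∫⁻ y in Q, h y ∂σ) x) ^ A⁻¹ := by
      intro x
      rw [ENNReal.rpow_inv_le_iff hA]
      refine iSup₂_le fun 𝒬 h𝒬 => ?_
      rw [← ENNReal.rpow_inv_le_iff hA]
      exact le_iSup₂ (f := fun (𝒬 : Finset (Set X)) (_ : ↑𝒬 ⊆ D) => (∑ Q ∈ 𝒬, Q.indicator
          (fun _ => μ Q ^ (-(A + B)) * ∫⁻ y in Q, h y ∂σ) x) ^ A⁻¹) 𝒬 h𝒬
    have h1 := ENNReal.rpow_le_rpow ((lintegral_mono hpt).trans hlim) hA.le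
    rw [← ENNReal.rpow_mul, inv_mul_cancel₀ hA.ne', ENNReal.rpow_one] at h1
    refine h1.trans (mul_le_mul_left ?_ _)
    rw [hN]
    push_cast
    rw [mul_assoc, add_mul]
    gcongr <;> first | exact le_self_add | exact le_add_self
  · intro 𝒬 h𝒬
    exact (Finset.measurable_fun_sum _ fun Q hQ =>
      measurable_const.indicator (hw.nested.measurableSet Q (h𝒬 hQ))).pow_const _
  · intro 𝒬 𝒬' h𝒬 x
    exact ENNReal.rpow_le_rpow (Finset.sum_le_sum_of_subset h𝒬) (by positivity)
  · intro 𝒬 h𝒬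
    have := ENNReal.rpow_le_rpow (hfinite 𝒬 h𝒬) (inv_nonneg.2 hA.le)
    rwa [recipNorm, ← ENNReal.rpow_mul, mul_inv_cancel₀ hA.ne', ENNReal.rpow_one] at this

end DyadicSum

/-! ### Translated grids and the one-third trick -/

section Grid

variable {n : ℕ}

lemma measurable_euclidean_apply (i : Fin n) :
    Measurable fun x : EuclideanSpace ℝ (Fin n) => x i :=
  (EuclideanSpace.proj (𝕜 := ℝ) i).continuous.measurable

lemma volume_cube (a : EuclideanSpace ℝ (Fin n)) (l : ℝ) :
    volume (cube a l) = ENNReal.ofReal l ^ n := by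
  have h : cube a l = (WithLp.ofLp : EuclideanSpace ℝ (Fin n) → Fin n → ℝ) ⁻¹'
      (Icc (fun i => a i) (fun i => a i + l)) := by
    ext x
    simp [cube, Set.mem_Icc, Pi.le_def, forall_and]
  rw [h, (PiLp.volume_preserving_ofLp (Fin n)).measure_preimage
    measurableSet_Icc.nullMeasurableSet, Real.volume_Icc_pi]
  simp

lemma measurableSet_cube (a : EuclideanSpace ℝ (Fin n)) (l : ℝ) : MeasurableSet (cube a l) := by
  have : cube a l = ⋂ i, {x | a i ≤ x i ∧ x i ≤ a i + l} := by ext; simp [cube]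
  rw [this]
  exact MeasurableSet.iInter fun i => measurableSet_Icc.preimage (measurable_euclidean_apply i)

/-- The cubes of side `4^{-k}` of the grid obtained by translating the standard one by `b/3`
relative to the side. -/
def gridCube (b : Fin n → Fin 2) (k : ℤ) (m : Fin n → ℤ) : Set (EuclideanSpace ℝ (Fin n)) :=
  {x | ∀ i, ⌊(4 : ℝ) ^ k * x i - (b i : ℝ) / 3⌋ = m i}

/-- The family of all cubes of a translated dyadic grid. -/
def grid (b : Fin n → Fin 2) : Set (Set (EuclideanSpace ℝ (Fin n))) :=
  range fun km : ℤ × (Fin n → ℤ) => gridCube b km.1 km.2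

lemma gridCube_mem_grid (b : Fin n → Fin 2) (k : ℤ) (m : Fin n → ℤ) :
    gridCube b k m ∈ grid b := ⟨(k, m), rfl⟩

lemma gridCube_eq (b : Fin n → Fin 2) (k : ℤ) (m : Fin n → ℤ) :
    gridCube b k m = (WithLp.ofLp : EuclideanSpace ℝ (Fin n) → Fin n → ℝ) ⁻¹'
      (pi univ fun i => Ico ((m i + (b i : ℝ) / 3) * 4 ^ (-k)) ((m i + (b i : ℝ) / 3) * 4 ^ (-k) + 4 ^ (-k))) := by
  have h4 : (0 : ℝ) < 4 ^ k := by positivity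
  ext x
  simp only [gridCube, mem_ofPred_eq, mem_preimage, mem_pi, mem_univ, true_implies, mem_Ico]
  refine forall_congr' fun i => ?_
  rw [Int.floor_eq_iff, zpow_neg, ← div_eq_mul_inv, inv_eq_one_div, ← add_div, div_le_iff₀ h4,
    lt_div_iff₀ h4]
  constructor <;> rintro ⟨h1, h2⟩ <;> constructor <;> linarith

lemma volume_gridCube (b : Fin n → Fin 2) (k : ℤ) (m : Fin n → ℤ) :
    volume (gridCube b k m) = ENNReal.ofReal (4 ^ (-k)) ^ n := by
  rw [gridCube_eq, (PiLp.volume_preserving_ofLp (Fin n)).measure_preimage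
    (MeasurableSet.univ_pi fun _ => measurableSet_Ico).nullMeasurableSet, Real.volume_pi_Ico]
  simp

lemma gridCube_subset_cube (b : Fin n → Fin 2) (k : ℤ) (m : Fin n → ℤ) :
    gridCube b k m ⊆ cube (WithLp.toLp 2 fun i => (m i + (b i : ℝ) / 3) * 4 ^ (-k)) (4 ^ (-k)) := by
  rw [gridCube_eq]
  intro x hx i
  have := hx i (mem_univ i)
  exact ⟨this.1, this.2.le⟩

/-- Since `4 (z - c/3) + c = 4 z - c/3`, the cell index at one scale determines the index at the
next coarser one by an integer division. Ratio 4 rather than 2 is what lets the same relative shift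
`1/3` work at every scale. -/
lemma floor_eq_of_floor_eq {c : Fin 2} {k k' : ℤ} (hk : k ≤ k') {x y : ℝ}
    (h : ⌊(4 : ℝ) ^ k' * x - (c : ℝ) / 3⌋ = ⌊(4 : ℝ) ^ k' * y - (c : ℝ) / 3⌋) :
    ⌊(4 : ℝ) ^ k * x - (c : ℝ) / 3⌋ = ⌊(4 : ℝ) ^ k * y - (c : ℝ) / 3⌋ := by
  have hstep : ∀ (j : ℤ) (z : ℝ), ⌊(4 : ℝ) ^ j * z - (c : ℝ) / 3⌋ =
      (⌊(4 : ℝ) ^ (j + 1) * z - (c : ℝ) / 3⌋ - (c : ℕ)) / 4 := by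
    intro j z
    have h1 : (4 : ℝ) ^ (j + 1) * z - (c : ℝ) / 3 = 4 * (4 ^ j * z - (c : ℝ) / 3) + ((c : ℕ) : ℤ) := by
      rw [zpow_add_one₀ (by norm_num)]
      push_cast
      ring
    rw [h1, Int.floor_add_intCast, add_sub_cancel_right]
    have h2 := Int.floor_div_natCast (4 * ((4 : ℝ) ^ j * z - (c : ℝ) / 3)) 4
    refine Eq.trans ?_ h2
    congr 1
    push_cast
    ring
  induction k', hk using Int.leInduction with
  | base => exact h
  | succ j hj ih =>
    refine ih ?_
    rw [hstep j x, hstep j y, h]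

lemma isNested_grid (b : Fin n → Fin 2) : IsNested (grid b) where
  countable := countable_range _
  measurableSet := by
    rintro _ ⟨⟨k, m⟩, rfl⟩
    simp only
    rw [gridCube_eq]
    exact (PiLp.volume_preserving_ofLp (Fin n)).measurable
      (MeasurableSet.univ_pi fun _ => measurableSet_Ico)
  nested := by
    have key : ∀ k k' : ℤ, k ≤ k' → ∀ m m', gridCube b k' m' ⊆ gridCube b k m ∨
        Disjoint (gridCube b k' m') (gridCube b k m) := by
      intro k k' hk m m'
      by_cases h : Disjoint (gridCube b k' m') (gridCube b k m)
      · exact Or.inr h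
      · left
        obtain ⟨x, hx', hx⟩ := Set.not_disjoint_iff.1 h
        intro y hy i
        rw [← hx i]
        exact floor_eq_of_floor_eq hk ((hy i).trans (hx' i).symm)
    rintro _ ⟨⟨k, m⟩, rfl⟩ _ ⟨⟨k', m'⟩, rfl⟩
    rcases le_total k k' with h | h
    · rcases key k k' h m m' with h | h
      · exact Or.inr (Or.inl h)
      · exact Or.inr (Or.inr h.symm)
    · rcases key k' k h m' m with h | h
      · exact Or.inl h
      · exact Or.inr (Or.inr h)

lemma ofReal_four_zpow_pow (k : ℤ) :
    ENNReal.ofReal (4 ^ k) ^ n = ENNReal.ofReal (((4 : ℝ) ^ n) ^ k) := by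
  rw [← ENNReal.ofReal_pow (by positivity), ← zpow_natCast, ← zpow_mul, mul_comm, zpow_mul,
    zpow_natCast]

lemma exists_isGraded_grid (b : Fin n → Fin 2) :
    ∃ κ, IsGraded volume (grid b) ((4 : ℝ) ^ n) κ := by
  have h : ∀ Q ∈ grid b, ∃ (k : ℤ) (m : Fin n → ℤ), Q = gridCube b k m := by
    rintro _ ⟨⟨k, m⟩, rfl⟩
    exact ⟨k, m, rfl⟩
  choose! k m hkm using h
  refine ⟨fun Q => -k Q, fun Q hQ => ?_, fun P hP Q hQ x hxP hxQ hPQ => ?_⟩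
  · conv_lhs => rw [hkm Q hQ, volume_gridCube, ofReal_four_zpow_pow]
  · have hk : k P = k Q := by simpa using hPQ
    rw [hkm P hP] at hxP ⊢
    rw [hkm Q hQ] at hxQ ⊢
    rw [hk] at hxP ⊢
    have : m P = m Q := funext fun i => (hxP i).symm.trans (hxQ i)
    rw [this]

/-- An interval of length below `1/3` cannot meet both `ℤ` and `ℤ + 1/3`, so one of the two
partitions has a cell containing it. -/
lemma exists_floor_eq {z l : ℝ} (hl : l < 1 / 3) : ∃ c : Fin 2, ∀ t, 0 ≤ t → t ≤ l →
    ⌊z + t - (c : ℝ) / 3⌋ = ⌊z - (c : ℝ) / 3⌋ := by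
  by_cases h : ⌊z + l⌋ = ⌊z⌋
  · refine ⟨0, fun t ht htl => ?_⟩
    simp only [Fin.val_zero, Nat.cast_zero, zero_div, sub_zero]
    refine le_antisymm ?_ (Int.floor_le_floor (by linarith))
    rw [← h]
    exact Int.floor_le_floor (by linarith)
  · refine ⟨1, fun t ht htl => ?_⟩
    have hl0 : 0 ≤ l := ht.trans htl
    have h1 : ⌊z⌋ + 1 ≤ ⌊z + l⌋ :=
      lt_of_le_of_ne (Int.floor_le_floor (by linarith)) (Ne.symm h)
    have h2 : z < ⌊z + l⌋ := by
      have := Int.lt_floor_add_one z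
      have h1' : ((⌊z⌋ + 1 : ℤ) : ℝ) ≤ ⌊z + l⌋ := by exact_mod_cast h1
      push_cast at h1'
      linarith
    have h3 := Int.floor_le (z + l)
    have key : ∀ t, 0 ≤ t → t ≤ l → ⌊z + t - ((1 : Fin 2) : ℝ) / 3⌋ = ⌊z + l⌋ - 1 := by
      intro t ht htl
      rw [Int.floor_eq_iff]
      push_cast
      simp only [Fin.val_one, Nat.cast_one]
      constructor <;> linarith
    rw [key t ht htl]
    have := key 0 le_rfl hl0
    rw [add_zero] at this
    exact this.symm

/-- Every cube is contained in a comparable cube of one of the translated grids. -/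
lemma exists_cube_subset_grid (a : EuclideanSpace ℝ (Fin n)) {l : ℝ} (hl : 0 < l) :
    ∃ b, ∃ Q ∈ grid b, cube a l ⊆ Q ∧
      volume Q ≤ ENNReal.ofReal (12 ^ n) * ENNReal.ofReal l ^ n := by
  -- The side `4^j` is the largest power of 4 not exceeding `12 l`. It exceeds `3 l`, as the
  -- one-third trick requires, and costs a factor `12` per dimension.
  obtain ⟨j, hj1, hj2⟩ := exists_mem_Ico_zpow (show 0 < 12 * l by positivity)
    (show (1 : ℝ) < 4 by norm_num)
  rw [zpow_add_one₀ (by norm_num)] at hj2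
  have h4 : (0 : ℝ) < 4 ^ j := by positivity
  have hl3 : 4 ^ (-j) * l < 1 / 3 := by
    rw [zpow_neg, inv_mul_lt_iff₀ h4]
    linarith
  choose c hc using fun i => exists_floor_eq (z := 4 ^ (-j) * a i) hl3
  refine ⟨c, gridCube c (-j) fun i => ⌊(4 : ℝ) ^ (-j) * a i - (c i : ℝ) / 3⌋,
    gridCube_mem_grid _ _ _, fun x hx i => ?_, ?_⟩
  · have h0 : (0 : ℝ) ≤ 4 ^ (-j) := by positivity
    have := hc i (4 ^ (-j) * (x i - a i)) (mul_nonneg h0 (by linarith [(hx i).1]))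
      (mul_le_mul_of_nonneg_left (by linarith [(hx i).2]) h0)
    refine Eq.trans ?_ this
    congr 1
    ring
  · rw [volume_gridCube, neg_neg, ← ENNReal.ofReal_pow hl.le, ← ENNReal.ofReal_mul (by positivity),
      ← mul_pow, ← ENNReal.ofReal_pow h4.le]
    gcongr

/-- A pair of points at distance `l` lies in a common cube of side `l`. -/
lemma exists_mem_cube (x y : EuclideanSpace ℝ (Fin n)) :
    ∃ a, x ∈ cube a ‖x - y‖ ∧ y ∈ cube a ‖x - y‖ := by
  refine ⟨WithLp.toLp 2 fun i => min (x i) (y i), fun i => ?_, fun i => ?_⟩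
  all_goals
    have h := PiLp.norm_apply_le (x - y) i
    rw [PiLp.sub_apply, Real.norm_eq_abs, abs_le] at h
    refine ⟨by simp, ?_⟩
    simp only [← min_add_add_right, le_min_iff]
    constructor <;> linarith [norm_nonneg (x - y)]

/-! ### Pointwise domination by dyadic operators -/

section Domination

variable {r : ℝ}

lemma volume_rpow_neg_le (hr : 0 ≤ r) {V l : ℝ≥0∞} (hl1 : l ≠ ∞) {c : ℝ}
    (hc : 0 < c) (hV : V ≤ ENNReal.ofReal c * l) :
    l ^ (-r) ≤ ENNReal.ofReal c ^ r * V ^ (-r) := by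
  have hc0 : ENNReal.ofReal c ≠ 0 := by simpa using hc
  calc l ^ (-r) = ENNReal.ofReal c ^ r * (ENNReal.ofReal c * l) ^ (-r) := by
        rw [ENNReal.mul_rpow_of_ne_top ENNReal.ofReal_ne_top hl1, ← mul_assoc,
          ← ENNReal.rpow_add _ _ hc0 ENNReal.ofReal_ne_top, add_neg_cancel, ENNReal.rpow_zero,
          one_mul]
    _ ≤ _ := by
        refine mul_le_mul_right ?_ _
        rw [ENNReal.rpow_neg, ENNReal.rpow_neg]
        exact ENNReal.inv_le_inv.2 (ENNReal.rpow_le_rpow hV hr)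

/-- The fractional maximal function is dominated by its dyadic versions. -/
lemma fracMaximal_le_sum_dyadicSup {𝕜 : Type*} [RCLike 𝕜] {α : ℝ} (hr : 0 ≤ 1 - α / n)
    (f : EuclideanSpace ℝ (Fin n) → 𝕜) (x : EuclideanSpace ℝ (Fin n)) :
    fracMaximal α f x ≤ ENNReal.ofReal (12 ^ n) ^ (1 - α / n) * ∑ b : Fin n → Fin 2,
      dyadicSup (grid b) (fun Q => volume Q ^ (-(1 - α / n)) * ∫⁻ y in Q, ‖f y‖ₑ) x := by
  refine iSup₂_le fun a l => iSup₂_le fun hl hx => ?_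
  obtain ⟨b, Q, hQ, hsub, hvol⟩ := exists_cube_subset_grid a hl
  have hl' : ENNReal.ofReal l ≠ 0 := by simpa using hl
  have h1 := volume_rpow_neg_le hr (ENNReal.pow_ne_top ENNReal.ofReal_ne_top)
    (by positivity) hvol
  have h2 : volume Q ^ (-(1 - α / n)) * ∫⁻ y in Q, ‖f y‖ₑ ≤ dyadicSup (grid b)
      (fun Q => volume Q ^ (-(1 - α / n)) * ∫⁻ y in Q, ‖f y‖ₑ) x :=
    le_dyadicSup (a := fun Q => volume Q ^ (-(1 - α / n)) * ∫⁻ y in Q, ‖f y‖ₑ) hQ (hsub hx)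
  rw [volume_cube, div_eq_mul_inv, ← ENNReal.rpow_neg, mul_comm]
  calc (ENNReal.ofReal l ^ n) ^ (-(1 - α / n)) * ∫⁻ y in cube a l, ‖f y‖ₑ
      ≤ (ENNReal.ofReal (12 ^ n) ^ (1 - α / n) * volume Q ^ (-(1 - α / n))) *
          ∫⁻ y in Q, ‖f y‖ₑ := mul_le_mul' h1 (lintegral_mono_set hsub)
    _ = ENNReal.ofReal (12 ^ n) ^ (1 - α / n) *
          (volume Q ^ (-(1 - α / n)) * ∫⁻ y in Q, ‖f y‖ₑ) := mul_assoc _ _ _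
    _ ≤ _ := by
        refine mul_le_mul_right (h2.trans ?_) _
        exact Finset.single_le_sum (f := fun b => dyadicSup (grid b)
          (fun Q => volume Q ^ (-(1 - α / n)) * ∫⁻ y in Q, ‖f y‖ₑ) x) (fun _ _ => zero_le)
          (Finset.mem_univ b)

/-- The Riesz potential is dominated by its dyadic versions. -/
lemma lintegral_kernel_le_sum_dyadicSum {α : ℝ} (hn : 0 < n) (hr : 0 ≤ 1 - α / n)
    {f : EuclideanSpace ℝ (Fin n) → ℝ≥0∞} (hf : Measurable f) (x : EuclideanSpace ℝ (Fin n)) :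
    ∫⁻ y, f y * ENNReal.ofReal (‖x - y‖ ^ ((n : ℝ) - α))⁻¹ ≤
      ENNReal.ofReal (12 ^ n) ^ (1 - α / n) * ∑ b : Fin n → Fin 2,
        dyadicSum (grid b) (fun Q => volume Q ^ (-(1 - α / n)) * ∫⁻ y in Q, f y) x := by
  classical
  have hn' : (n : ℝ) ≠ 0 := by positivity
  set r := 1 - α / n with hrdef
  set D : Set (Set (EuclideanSpace ℝ (Fin n))) := ⋃ b : Fin n → Fin 2, grid b with hD
  have hDc : D.Countable := countable_iUnion fun b => (isNested_grid b).countable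
  have hDm : ∀ Q ∈ D, MeasurableSet Q := fun Q hQ => by
    obtain ⟨b, hb⟩ := mem_iUnion.1 hQ
    exact (isNested_grid b).measurableSet Q hb
  set T : Finset (Set (EuclideanSpace ℝ (Fin n))) → EuclideanSpace ℝ (Fin n) → ℝ≥0∞ :=
    fun 𝒬 y => ∑ Q ∈ 𝒬, Q.indicator (fun _ => volume Q ^ (-r)) x * Q.indicator f y with hT
  have hTm : ∀ 𝒬 : Finset (Set (EuclideanSpace ℝ (Fin n))), ↑𝒬 ⊆ D → Measurable (T 𝒬) :=
    fun 𝒬 h𝒬 => Finset.measurable_fun_sum _ fun Q hQ => (hf.indicator (hDm Q (h𝒬 hQ))).const_mul _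
  have hpt : ∀ y, f y * ENNReal.ofReal (‖x - y‖ ^ ((n : ℝ) - α))⁻¹ ≤
      ENNReal.ofReal (12 ^ n) ^ r * ⨆ (𝒬 : Finset (Set (EuclideanSpace ℝ (Fin n))))
        (_ : ↑𝒬 ⊆ D), T 𝒬 y := by
    intro y
    rcases eq_or_ne x y with rfl | hxy
    -- On the diagonal the kernel has a conventional value: `0⁻¹ = 0` when `n - α ≠ 0`, but `0 ^ 0 =
    -- 1` when `n = α`. In the latter case any grid cube containing `x` contributes exactly `f x`.
    · rcases hr.eq_or_lt with h0 | h0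
      · have e : (n : ℝ) - α = 0 := by
          rw [hrdef] at h0
          field_simp at h0
          linarith
        obtain ⟨b, Q, hQ, hsub, -⟩ := exists_cube_subset_grid x one_pos
        have hxQ : x ∈ Q := hsub fun i => ⟨le_rfl, by linarith⟩
        have h1 : T {Q} x ≤ ⨆ (𝒬 : Finset (Set (EuclideanSpace ℝ (Fin n))))
          (_ : ↑𝒬 ⊆ D), T 𝒬 x := le_iSup₂ (f := fun (𝒬 : Finset (Set (EuclideanSpace ℝ (Fin n))))
            (_ : ↑𝒬 ⊆ D) => T 𝒬 x) {Q} (by simpa [hD] using ⟨b, hQ⟩)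
        rw [e, ← h0]
        simpa [hT, hxQ, ← h0] using h1
      · have e : (n : ℝ) - α = n * r := by rw [hrdef]; field_simp
        have : (n : ℝ) - α ≠ 0 := by rw [e]; positivity
        simp [Real.zero_rpow this]
    · have hl : 0 < ‖x - y‖ := norm_pos_iff.2 (sub_ne_zero.2 hxy)
      obtain ⟨a, hxa, hya⟩ := exists_mem_cube x y
      obtain ⟨b, Q, hQ, hsub, hvol⟩ := exists_cube_subset_grid a hl
      have hl' : ENNReal.ofReal ‖x - y‖ ≠ 0 := by simpa using hl
      have h1 := volume_rpow_neg_le hr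
        (ENNReal.pow_ne_top ENNReal.ofReal_ne_top) (by positivity) hvol
      have h2 : ENNReal.ofReal (‖x - y‖ ^ ((n : ℝ) - α))⁻¹ =
          (ENNReal.ofReal ‖x - y‖ ^ n) ^ (-r) := by
        rw [← ENNReal.rpow_natCast, ← ENNReal.rpow_mul, ENNReal.ofReal_rpow_of_pos hl,
          ← Real.rpow_neg hl.le]
        congr 2
        rw [hrdef]
        field_simp
      have h3 : T {Q} y ≤ ⨆ (𝒬 : Finset (Set (EuclideanSpace ℝ (Fin n))))
        (_ : ↑𝒬 ⊆ D), T 𝒬 y := le_iSup₂ (f := fun (𝒬 : Finset (Set (EuclideanSpace ℝ (Fin n))))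
          (_ : ↑𝒬 ⊆ D) => T 𝒬 y) {Q} (by simpa [hD] using ⟨b, hQ⟩)
      have h4 : T {Q} y = volume Q ^ (-r) * f y := by
        simp [hT, hsub hxa, hsub hya]
      rw [h2, mul_comm]
      refine (mul_le_mul_left h1 _).trans ?_
      rw [mul_assoc, ← h4]
      exact mul_le_mul_right h3 _
  have hsup : Measurable fun y => ⨆ (𝒬 : Finset (Set (EuclideanSpace ℝ (Fin n))))
      (_ : ↑𝒬 ⊆ D), T 𝒬 y := by
    have : Countable D := hDc
    simp_rw [iSup_finset_subset_eq fun 𝒬 => T 𝒬 _]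
    exact Measurable.iSup fun 𝒬 => hTm _ (coe_map_subtype_subset 𝒬)
  refine (lintegral_mono hpt).trans ?_
  rw [lintegral_const_mul _ hsup]
  refine mul_le_mul_right (lintegral_le_of_finset hDc hTm ?_ ?_) _
  · intro 𝒬 𝒬' h y
    exact Finset.sum_le_sum_of_subset h
  · intro 𝒬 h𝒬
    rw [hT, lintegral_finsetSum 𝒬 fun Q hQ => (hf.indicator (hDm Q (h𝒬 hQ))).const_mul _]
    have h1 : ∀ Q ∈ 𝒬, ∫⁻ y, Q.indicator (fun _ => volume Q ^ (-r)) x * Q.indicator f y =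
        Q.indicator (fun _ => volume Q ^ (-r) * ∫⁻ y in Q, f y) x := fun Q hQ => by
      rw [lintegral_const_mul _ (hf.indicator (hDm Q (h𝒬 hQ))), lintegral_indicator (hDm Q (h𝒬 hQ))]
      by_cases hx : x ∈ Q <;> simp [hx]
    rw [Finset.sum_congr rfl h1]
    -- A finite family from the union of the grids is sorted by grid. A set belonging to several
    -- grids is counted repeatedly, which only increases the right side.
    calc ∑ Q ∈ 𝒬, Q.indicator (fun _ => volume Q ^ (-r) * ∫⁻ y in Q, f y) x
        ≤ ∑ Q ∈ 𝒬, ∑ b : Fin n → Fin 2, if Q ∈ grid b then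
            Q.indicator (fun _ => volume Q ^ (-r) * ∫⁻ y in Q, f y) x else 0 := by
          refine Finset.sum_le_sum fun Q hQ => ?_
          obtain ⟨b, hb⟩ := mem_iUnion.1 (h𝒬 hQ)
          refine le_trans (by rw [if_pos hb]) (Finset.single_le_sum (f := fun b => if Q ∈ grid b then
            Q.indicator (fun _ => volume Q ^ (-r) * ∫⁻ y in Q, f y) x else 0)
            (fun _ _ => zero_le) (Finset.mem_univ b))
      _ = ∑ b : Fin n → Fin 2, ∑ Q ∈ 𝒬.filter (· ∈ grid b),
            Q.indicator (fun _ => volume Q ^ (-r) * ∫⁻ y in Q, f y) x := by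
          rw [Finset.sum_comm]
          exact Finset.sum_congr rfl fun b _ => (Finset.sum_filter _ _).symm
      _ ≤ _ := by
          refine Finset.sum_le_sum fun b _ => ?_
          exact le_iSup₂ (f := fun (𝒬 : Finset (Set (EuclideanSpace ℝ (Fin n))))
            (_ : ↑𝒬 ⊆ grid b) => ∑ Q ∈ 𝒬,
            Q.indicator (fun _ => volume Q ^ (-r) * ∫⁻ y in Q, f y) x) (𝒬.filter (· ∈ grid b))
            (fun Q hQ => (Finset.mem_filter.1 hQ).2)

end Domination

end Grid

/-! ### From `A_{p,q}` weights to weight pairs -/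

section Weights

variable {n : ℕ} {α p q : ℝ} {w : EuclideanSpace ℝ (Fin n) → ℝ}

lemma weightMeasure_congr {w' : EuclideanSpace ℝ (Fin n) → ℝ} (h : w =ᵐ[volume] w') (e : ℝ) :
    weightMeasure w e = weightMeasure w' e :=
  withDensity_congr_ae (h.mono fun x hx => by simp [hx])

lemma apqConst_congr {w' : EuclideanSpace ℝ (Fin n) → ℝ} (h : w =ᵐ[volume] w') :
    apqConst p q w = apqConst p q w' := by
  unfold apqConst
  have h1 : ∀ (e : ℝ) (Q : Set (EuclideanSpace ℝ (Fin n))),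
      ⨍⁻ x in Q, ENNReal.ofReal (w x) ^ e ∂volume = ⨍⁻ x in Q, ENNReal.ofReal (w' x) ^ e ∂volume :=
    fun e Q => laverage_congr (ae_restrict_of_ae (h.mono fun x hx => by simp [hx]))
  simp_rw [h1]

lemma IsApqWeight.congr {w' : EuclideanSpace ℝ (Fin n) → ℝ} (hw : IsApqWeight p q w)
    (h : w =ᵐ[volume] w') : IsApqWeight p q w' where
  locallyIntegrable := hw.locallyIntegrable.congr h
  ae_pos := by
    filter_upwards [hw.ae_pos, h] with x h1 h2
    rwa [← h2]
  apqConst_lt_top := by rw [← apqConst_congr h]; exact hw.apqConst_lt_top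

lemma IsApqWeight.exists_measurable (hw : IsApqWeight p q w) : ∃ w', Measurable w' ∧
    w =ᵐ[volume] w' :=
  ⟨_, hw.locallyIntegrable.aestronglyMeasurable.stronglyMeasurable_mk.measurable,
    hw.locallyIntegrable.aestronglyMeasurable.ae_eq_mk⟩

lemma volume_absolutelyContinuous_weightMeasure (hw : IsApqWeight p q w) (e : ℝ) :
    volume ≪ weightMeasure w e := by
  refine withDensity_absolutelyContinuous' ?_ ?_
  · exact (hw.locallyIntegrable.aestronglyMeasurable.aemeasurable.ennreal_ofReal).pow_const e
  · filter_upwards [hw.ae_pos] with x hx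
    simp [ENNReal.rpow_eq_zero_iff, hx]

lemma eLpNorm_eq_recipNorm {X E : Type*} [MeasurableSpace X] {μ : Measure X} [TopologicalSpace E]
    [ESeminormedAddMonoid E] {e : ℝ} (he : 0 < e) (f : X → E) :
    eLpNorm f (ENNReal.ofReal e) μ = recipNorm μ (1 / e) (fun x => ‖f x‖ₑ) := by
  rw [eLpNorm_eq_lintegral_rpow_enorm_toReal (by simpa using he) ENNReal.ofReal_ne_top,
    ENNReal.toReal_ofReal he.le, recipNorm]
  simp

lemma conjExponent_eq (hp : 1 < p) : p.conjExponent = (1 - 1 / p)⁻¹ := by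
  have : p ≠ 0 := by positivity
  rw [Real.conjExponent]
  field_simp

/-- The `q`-th root of the weight condition with averages written as integrals; the second exponent
becomes `1/p' = 1 - 1/p`. -/
lemma apqConst_bound (hp : 1 < p) (hq0 : 0 < q) (a : EuclideanSpace ℝ (Fin n)) {l : ℝ}
    (hl : 0 < l) :
    (volume.withDensity (fun x => ENNReal.ofReal (w x) ^ q)) (cube a l) ^ (1 / q) *
      (volume.withDensity (fun x => ENNReal.ofReal (w x) ^ (-p.conjExponent))) (cube a l) ^ (1 - 1 / p) ≤
      apqConst p q w ^ (1 / q) * volume (cube a l) ^ (1 / q + (1 - 1 / p)) := by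
  have h1p : 1 / p < 1 := (div_lt_one (by positivity)).2 hp
  have hB : 0 < 1 - 1 / p := by linarith
  have hA : 0 < 1 / q := by positivity
  have hV0 : volume (cube a l) ≠ 0 := by
    rw [volume_cube]; exact pow_ne_zero _ (by simpa using hl)
  have hV1 : volume (cube a l) ≠ ∞ := by
    rw [volume_cube]; exact ENNReal.pow_ne_top ENNReal.ofReal_ne_top
  have h := le_iSup₂_of_le (f := fun (a : EuclideanSpace ℝ (Fin n)) (l : ℝ) => ⨆ _ : 0 < l,
    (⨍⁻ x in cube a l, ENNReal.ofReal (w x) ^ q ∂volume) *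
      (⨍⁻ x in cube a l, ENNReal.ofReal (w x) ^ (-p.conjExponent) ∂volume) ^ (q / p.conjExponent))
    a l (le_iSup_of_le hl le_rfl)
  change _ ≤ apqConst p q w at h
  rw [setLAverage_eq, setLAverage_eq] at h
  have h2 := ENNReal.rpow_le_rpow h hA.le
  have e1 : q / p.conjExponent * (1 / q) = 1 - 1 / p := by
    rw [conjExponent_eq hp]; field_simp
  rw [ENNReal.mul_rpow_of_nonneg _ _ hA.le, ← ENNReal.rpow_mul, e1,
    ENNReal.div_rpow_of_nonneg _ _ hA.le, ENNReal.div_rpow_of_nonneg _ _ hB.le] at h2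
  rw [withDensity_apply _ (measurableSet_cube a l), withDensity_apply _ (measurableSet_cube a l)]
  set V := volume (cube a l)
  set I := ∫⁻ x in cube a l, ENNReal.ofReal (w x) ^ q
  set J := ∫⁻ x in cube a l, ENNReal.ofReal (w x) ^ (-p.conjExponent)
  calc I ^ (1 / q) * J ^ (1 - 1 / p)
      = I ^ (1 / q) / V ^ (1 / q) * (J ^ (1 - 1 / p) / V ^ (1 - 1 / p)) * V ^ (1 / q + (1 - 1 / p)) := by
        rw [ENNReal.rpow_add _ _ hV0 hV1, mul_mul_mul_comm, ENNReal.div_mul_cancel,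
          ENNReal.div_mul_cancel] <;>
        simp [ENNReal.rpow_eq_zero_iff, ENNReal.rpow_eq_top_iff, hV0, hV1]
    _ ≤ _ := mul_le_mul_left h2 _

lemma measurable_ofReal_rpow (hm : Measurable w) (e : ℝ) :
    Measurable fun x => ENNReal.ofReal (w x) ^ e := hm.ennreal_ofReal.pow_const e

lemma IsApqWeight.weightPair (hw : IsApqWeight p q w) (hm : Measurable w) (hp : 1 < p)
    (hq0 : 0 < q) (hpq : 1 / q ≤ 1 / p) (b : Fin n → Fin 2) :
    WeightPair volume (grid b) (1 / q) (1 - 1 / p) (fun x => ENNReal.ofReal (w x) ^ q)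
      (fun x => ENNReal.ofReal (w x) ^ (-p.conjExponent)) (apqConst p q w ^ (1 / q)) := by
  have h1p : 1 / p < 1 := (div_lt_one (by positivity)).2 hp
  have hB : 0 < 1 - 1 / p := by linarith
  have hA : 0 < 1 / q := by positivity
  refine ⟨hA, hB, by linarith, measurable_ofReal_rpow hm _, measurable_ofReal_rpow hm _, ?_,
    isNested_grid b, ?_, ?_, ENNReal.rpow_ne_top_of_nonneg hA.le hw.apqConst_lt_top.ne, ?_⟩
  · filter_upwards [hw.ae_pos] with x hx
    have h0 : ENNReal.ofReal (w x) ≠ 0 := by simpa using hx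
    rw [← ENNReal.rpow_mul, ← ENNReal.rpow_mul, ← ENNReal.rpow_add _ _ h0 ENNReal.ofReal_ne_top,
      conjExponent_eq hp]
    have : q * (1 / q) + -(1 - 1 / p)⁻¹ * (1 - 1 / p) = 0 := by
      rw [neg_mul, inv_mul_cancel₀ hB.ne', mul_one_div_cancel hq0.ne', add_neg_cancel]
    rw [this, ENNReal.rpow_zero]
  · rintro _ ⟨⟨k, m⟩, rfl⟩
    simp only
    rw [volume_gridCube]
    have : (0 : ℝ) < 4 ^ (-k) := by positivity
    exact pow_ne_zero _ (by simpa using this)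
  · rintro _ ⟨⟨k, m⟩, rfl⟩
    simp only
    rw [volume_gridCube]
    exact ENNReal.pow_ne_top ENNReal.ofReal_ne_top
  · rintro _ ⟨⟨k, m⟩, rfl⟩
    simp only
    have h := apqConst_bound hp hq0 (WithLp.toLp 2 fun i => (m i + (b i : ℝ) / 3) * 4 ^ (-k))
      (w := w) (l := 4 ^ (-k)) (by positivity)
    rw [volume_cube] at h
    rw [volume_gridCube]
    refine le_trans ?_ h
    have hsub := gridCube_subset_cube b k m
    gcongr

/-- Hölder's inequality on `Q` for `U^A S^B = 1`. Consequently powers of the weight constant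
increase with the exponent. -/
lemma WeightPair.one_le {X : Type*} [MeasurableSpace X] {μ : Measure X} {D : Set (Set X)} {A B : ℝ}
    {U S : X → ℝ≥0∞} {K : ℝ≥0∞} (h : WeightPair μ D A B U S K) {Q : Set X} (hQ : Q ∈ D) :
    1 ≤ K := by
  have hm := h.nested.measurableSet Q hQ
  have h1 := recipNorm_mul_le (μ := μ.restrict Q) h.A_pos h.B_pos
    (h.measurable_left.pow_const A).aemeasurable (h.measurable_right.pow_const B).aemeasurable
  have h2 : recipNorm (μ.restrict Q) (A + B) (fun x => U x ^ A * S x ^ B) = μ Q ^ (A + B) := by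
    unfold recipNorm
    congr 1
    rw [← setLIntegral_one]
    refine lintegral_congr_ae ?_
    filter_upwards [ae_restrict_of_ae h.ae_eq_one] with x hx
    rw [hx, ENNReal.one_rpow]
  have h3 : ∀ (V : X → ℝ≥0∞) (e : ℝ), 0 < e →
      recipNorm (μ.restrict Q) e (fun x => V x ^ e) = μ.withDensity V Q ^ e := fun V e he => by
    unfold recipNorm
    rw [withDensity_apply _ hm]
    simp_rw [← ENNReal.rpow_mul, mul_inv_cancel₀ he.ne', ENNReal.rpow_one]
  rw [h2, h3 U A h.A_pos, h3 S B h.B_pos] at h1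
  have h4 := h1.trans (h.bound Q hQ)
  have hAB : 0 < A + B := add_pos h.A_pos h.B_pos
  have h5 : μ Q ^ (A + B) ≠ 0 := by
    simp [ENNReal.rpow_eq_zero_iff, h.measure_ne_zero Q hQ, hAB.le]
  have h6 : μ Q ^ (A + B) ≠ ∞ := ENNReal.rpow_ne_top_of_nonneg hAB.le (h.measure_ne_top Q hQ)
  refine (ENNReal.mul_le_mul_iff_left h5 h6).1 ?_
  rwa [one_mul]

lemma IsApqWeight.one_le (hw : IsApqWeight p q w) (hp : 1 < p) (hq0 : 0 < q)
    (hpq : 1 / q ≤ 1 / p) : 1 ≤ apqConst p q w := by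
  obtain ⟨w', hm, hww'⟩ := hw.exists_measurable
  have h := ((hw.congr hww').weightPair hm hp hq0 hpq 0).one_le (gridCube_mem_grid 0 0 0)
  rw [← apqConst_congr hww'] at h
  have h2 := ENNReal.rpow_le_rpow h hq0.le
  rwa [ENNReal.one_rpow, ← ENNReal.rpow_mul, one_div_mul_cancel hq0.ne', ENNReal.rpow_one] at h2

/-- The function `F / S` has the same norm in `L^p(σ)` as `F` has in `L^p(w^p)`. -/
lemma IsApqWeight.recipNorm_div (hw : IsApqWeight p q w) (hm : Measurable w) (hp : 1 < p)
    {F : EuclideanSpace ℝ (Fin n) → ℝ≥0∞} (hF : Measurable F) :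
    recipNorm (volume.withDensity fun x => ENNReal.ofReal (w x) ^ (-p.conjExponent)) (1 / p)
      (fun x => F x * (ENNReal.ofReal (w x) ^ (-p.conjExponent))⁻¹) =
      recipNorm (weightMeasure w p) (1 / p) F := by
  have hp0 : 0 < p := by linarith
  have hS := measurable_ofReal_rpow hm (-p.conjExponent)
  have hm' : Measurable fun x => F x * (ENNReal.ofReal (w x) ^ (-p.conjExponent))⁻¹ :=
    hF.mul hS.inv
  rw [recipNorm_withDensity hS hm', weightMeasure,
    recipNorm_withDensity (measurable_ofReal_rpow hm p) hF]
  congr 1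
  refine lintegral_congr_ae ?_
  filter_upwards [hw.ae_pos] with x hx
  have h0 : ENNReal.ofReal (w x) ≠ 0 := by simpa using hx
  rw [ENNReal.mul_rpow_of_nonneg _ _ (by positivity), ← ENNReal.rpow_neg, ← ENNReal.rpow_mul,
    mul_left_comm, ← ENNReal.rpow_add _ _ h0 ENNReal.ofReal_ne_top, mul_comm]
  congr 2
  have : p - 1 ≠ 0 := by linarith
  rw [Real.conjExponent]
  field_simp
  ring

/-- With `IsApqWeight.recipNorm_div` this justifies the substitution `|f| = h S`, which replaces
Lebesgue averages of `f` by integrals of `h` against `S dx`. -/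
lemma IsApqWeight.setLIntegral_div (hw : IsApqWeight p q w) (hm : Measurable w)
    {F : EuclideanSpace ℝ (Fin n) → ℝ≥0∞} (hF : Measurable F) (e : ℝ)
    {Q : Set (EuclideanSpace ℝ (Fin n))} (hQ : MeasurableSet Q) :
    ∫⁻ x in Q, F x * (ENNReal.ofReal (w x) ^ e)⁻¹
      ∂(volume.withDensity fun x => ENNReal.ofReal (w x) ^ e) = ∫⁻ x in Q, F x := by
  have hS := measurable_ofReal_rpow hm e
  have hm' : Measurable fun x => F x * (ENNReal.ofReal (w x) ^ e)⁻¹ := hF.mul hS.inv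
  rw [setLIntegral_withDensity_eq_setLIntegral_mul _ hS hm' hQ]
  refine lintegral_congr_ae (ae_restrict_of_ae ?_)
  filter_upwards [hw.ae_pos] with x hx
  have h0 : ENNReal.ofReal (w x) ^ e ≠ 0 := by simp [ENNReal.rpow_eq_zero_iff, hx]
  have h1 : ENNReal.ofReal (w x) ^ e ≠ ∞ :=
    ENNReal.rpow_ne_top_of_ne_zero (by simpa using hx) ENNReal.ofReal_ne_top
  simp only [Pi.mul_apply]
  rw [mul_left_comm, ENNReal.mul_inv_cancel h0 h1, mul_one]

lemma dyadicSup_congr {X : Type*} [MeasurableSpace X] {D : Set (Set X)} {a a' : Set X → ℝ≥0∞}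
    (h : ∀ Q ∈ D, a Q = a' Q) : dyadicSup D a = dyadicSup D a' :=
  funext fun _ => iSup_congr fun Q => iSup_congr fun hQ => by rw [h Q hQ]

lemma dyadicSum_congr {X : Type*} [MeasurableSpace X] {D : Set (Set X)} {a a' : Set X → ℝ≥0∞}
    (h : ∀ Q ∈ D, a Q = a' Q) : dyadicSum D a = dyadicSum D a' :=
  funext fun _ => iSup_congr fun _ => iSup_congr fun h𝒬 => Finset.sum_congr rfl fun Q hQ => by rw [h Q (h𝒬 hQ)]

end Weights

/-! ### Upper bounds for measurable data -/

section UpperBounds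

variable {𝕜 : Type*} [RCLike 𝕜] {n : ℕ} {α p q : ℝ}

lemma exponent_pos (hp : 1 < p) (hpα : p * α < n) (hn : 0 < n) (hq : 1 / q = 1 / p - α / n) :
    0 < q := by
  have hn' : (0 : ℝ) < n := by exact_mod_cast hn
  have : 0 < 1 / q := by
    rw [hq, sub_pos, div_lt_div_iff₀ hn' (by linarith)]
    linarith
  simpa using this

lemma exists_fracMaximal_bound (hn : 0 < n) (hα0 : 0 ≤ α) (hp : 1 < p) (hpα : p * α < n)
    (hq : 1 / q = 1 / p - α / n) : ∃ C : ℝ≥0, ∀ w : EuclideanSpace ℝ (Fin n) → ℝ,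
      IsApqWeight p q w → Measurable w → ∀ f : EuclideanSpace ℝ (Fin n) → 𝕜, Measurable f →
      eLpNorm (fracMaximal α f) (ENNReal.ofReal q) (weightMeasure w q) ≤
        C * apqConst p q w ^ (p.conjExponent / q * (1 - α / n)) *
          eLpNorm f (ENNReal.ofReal p) (weightMeasure w p) := by
  have hn' : (0 : ℝ) < n := by exact_mod_cast hn
  have hq0 : 0 < q := exponent_pos hp hpα hn hq
  have hp0 : 0 < p := by linarith
  have hpq : 1 / q ≤ 1 / p := by rw [hq]; linarith [div_nonneg hα0 hn'.le]
  have hq1 : 1 / q ≤ 1 := hpq.trans ((div_lt_one hp0).2 hp).le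
  have hB : 0 < 1 - 1 / p := by have := (div_lt_one hp0).2 hp; linarith
  have hr : 1 / q + (1 - 1 / p) = 1 - α / n := by rw [hq]; ring
  have hr0 : 0 < 1 - α / n := by rw [← hr]; positivity
  set c₁ : ℝ≥0∞ := ENNReal.ofReal (12 ^ n) ^ (1 - α / n) with hc₁
  set c₂ : ℝ≥0∞ := ENNReal.ofReal ((1 / q + (1 - 1 / p)) / (1 / q)) ^ ((1 / q + (1 - 1 / p)) * (1 / q) / (1 - 1 / p)) *
    ENNReal.ofReal (1 / (1 - 1 / p)) ^ ((1 / q) / (1 - (1 - 1 / p))) with hc₂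
  have hc₁f : c₁ ≠ ∞ := ENNReal.rpow_ne_top_of_nonneg hr0.le ENNReal.ofReal_ne_top
  have hc₂f : c₂ ≠ ∞ := by
    refine ENNReal.mul_ne_top (ENNReal.rpow_ne_top_of_nonneg (by positivity) ENNReal.ofReal_ne_top)
      (ENNReal.rpow_ne_top_of_nonneg ?_ ENNReal.ofReal_ne_top)
    rw [sub_sub_cancel]
    positivity
  refine ⟨(c₁ * ((Finset.univ : Finset (Fin n → Fin 2)).card * c₂)).toNNReal, ?_⟩
  intro w hw hm f hf
  have hFm : Measurable fun y => ‖f y‖ₑ := hf.enorm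
  rw [eLpNorm_eq_recipNorm hq0, eLpNorm_eq_recipNorm hp0, ENNReal.coe_toNNReal
    (ENNReal.mul_ne_top hc₁f (ENNReal.mul_ne_top (ENNReal.natCast_ne_top _) hc₂f))]
  simp only [enorm_eq_self]
  set N := recipNorm (weightMeasure w p) (1 / p) fun x => ‖f x‖ₑ with hN
  set K := apqConst p q w with hK
  have hone : ∀ b : Fin n → Fin 2, recipNorm (weightMeasure w q) (1 / q)
      (dyadicSup (grid b) (fun Q => volume Q ^ (-(1 - α / n)) * ∫⁻ y in Q, ‖f y‖ₑ)) ≤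
      c₂ * (K ^ (p.conjExponent / q * (1 - α / n)) * N) := by
    intro b
    have hwp := hw.weightPair hm hp hq0 hpq b
    have hS := measurable_ofReal_rpow hm (-p.conjExponent)
    have h := hwp.recipNorm_dyadicSup_le (hFm.mul hS.inv)
    rw [sub_sub_cancel] at h
    have h1 := hw.recipNorm_div hm hp hFm
    rw [dyadicSup_congr (a' := fun Q => volume Q ^ (-(1 - α / n)) * ∫⁻ y in Q, ‖f y‖ₑ)] at h
    · refine h.trans_eq ?_
      rw [← ENNReal.rpow_mul, hc₂, sub_sub_cancel]
      -- The pair has constant `[w]^(1/q)`, so its power `(A+B)/B` is the stated power of `[w]`.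
      have e : 1 / q * ((1 / q + (1 - 1 / p)) / (1 - 1 / p)) = p.conjExponent / q * (1 - α / n) := by
        rw [hr, conjExponent_eq hp]
        field_simp
      rw [e, mul_assoc]
      congr 1
      exact congrArg _ h1
    · intro Q hQ
      rw [hr]
      congr 1
      exact hw.setLIntegral_div hm hFm _ ((isNested_grid b).measurableSet Q hQ)
  have hmeas : ∀ b ∈ (Finset.univ : Finset (Fin n → Fin 2)), Measurable
      (dyadicSup (grid b) (fun Q => volume Q ^ (-(1 - α / n)) * ∫⁻ y in Q, ‖f y‖ₑ)) :=
    fun b _ => (isNested_grid b).measurable_dyadicSup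
  refine (recipNorm_mono (by positivity) (fracMaximal_le_sum_dyadicSup hr0.le f)).trans ?_
  rw [recipNorm_const_mul (by positivity) _ (Finset.measurable_fun_sum _ hmeas), ← hc₁]
  refine (mul_le_mul_right ((recipNorm_sum_le _ (by positivity) hq1 hmeas).trans
    (Finset.sum_le_card_nsmul _ _ _ fun b _ => hone b)) _).trans_eq ?_
  rw [nsmul_eq_mul]
  ring

lemma exists_kernel_bound (hn : 0 < n) (hα0 : 0 < α) (hp : 1 < p) (hpα : p * α < n)
    (hq : 1 / q = 1 / p - α / n) : ∃ C : ℝ≥0, ∀ w : EuclideanSpace ℝ (Fin n) → ℝ,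
      IsApqWeight p q w → Measurable w → ∀ f : EuclideanSpace ℝ (Fin n) → 𝕜, Measurable f →
      eLpNorm f (ENNReal.ofReal p) (weightMeasure w p) ≠ ∞ →
      recipNorm (weightMeasure w q) (1 / q)
        (fun x => ∫⁻ y, ‖f y‖ₑ * ENNReal.ofReal (‖x - y‖ ^ ((n : ℝ) - α))⁻¹) ≤
        C * apqConst p q w ^ ((1 - α / n) * max 1 (p.conjExponent / q)) *
          eLpNorm f (ENNReal.ofReal p) (weightMeasure w p) := by
  have hn' : (0 : ℝ) < n := by exact_mod_cast hn
  have hq0 : 0 < q := exponent_pos hp hpα hn hq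
  have hp0 : 0 < p := by linarith
  have hαn : 0 < α / n := by positivity
  have hpq : 1 / q ≤ 1 / p := by rw [hq]; linarith
  have hq1 : 1 / q ≤ 1 := hpq.trans ((div_lt_one hp0).2 hp).le
  have hB : 0 < 1 - 1 / p := by have := (div_lt_one hp0).2 hp; linarith
  have hr : 1 / q + (1 - 1 / p) = 1 - α / n := by rw [hq]; ring
  have hr0 : 0 < 1 - α / n := by rw [← hr]; positivity
  set c₁ : ℝ≥0∞ := ENNReal.ofReal (12 ^ n) ^ (1 - α / n) with hc₁
  have hc₁f : c₁ ≠ ∞ := ENNReal.rpow_ne_top_of_nonneg hr0.le ENNReal.ofReal_ne_top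
  obtain ⟨c₂, hc₂⟩ := exists_recipNorm_dyadicSum_le (EuclideanSpace ℝ (Fin n))
    (A := 1 / q) (B := 1 - 1 / p) (ρ := (4 : ℝ) ^ n) (by positivity) hB (by linarith)
    (one_lt_pow₀ (by norm_num) hn.ne')
  refine ⟨(c₁ * ((Finset.univ : Finset (Fin n → Fin 2)).card * (c₂ * 2))).toNNReal, ?_⟩
  intro w hw hm f hf hfin
  have hFm : Measurable fun y => ‖f y‖ₑ := hf.enorm
  rw [eLpNorm_eq_recipNorm hp0] at hfin ⊢
  rw [ENNReal.coe_toNNReal (ENNReal.mul_ne_top hc₁f (ENNReal.mul_ne_top (ENNReal.natCast_ne_top _)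
    (ENNReal.mul_ne_top ENNReal.coe_ne_top (by norm_num))))]
  set N := recipNorm (weightMeasure w p) (1 / p) fun x => ‖f x‖ₑ with hN
  set K := apqConst p q w with hK
  have hK1 : 1 ≤ K := hw.one_le hp hq0 hpq
  have hone : ∀ b : Fin n → Fin 2, recipNorm (weightMeasure w q) (1 / q)
      (dyadicSum (grid b) (fun Q => volume Q ^ (-(1 - α / n)) * ∫⁻ y in Q, ‖f y‖ₑ)) ≤
      c₂ * 2 * (K ^ ((1 - α / n) * max 1 (p.conjExponent / q)) * N) := by
    intro b
    have hwp := hw.weightPair hm hp hq0 hpq b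
    have hS := measurable_ofReal_rpow hm (-p.conjExponent)
    have h1 := hw.recipNorm_div hm hp hFm
    obtain ⟨κ, hκ⟩ := exists_isGraded_grid b
    have h := hc₂ volume (grid b) _ _ _ κ hwp hκ _ (hFm.mul hS.inv) (by
      rw [sub_sub_cancel]
      exact ne_of_eq_of_ne h1 hfin)
    rw [dyadicSum_congr (a' := fun Q => volume Q ^ (-(1 - α / n)) * ∫⁻ y in Q, ‖f y‖ₑ)] at h
    · refine h.trans ?_
      rw [← ENNReal.rpow_mul, ← ENNReal.rpow_mul, sub_sub_cancel]
      -- The two powers of `[w]` correspond to the two entries of the maximum, and `[w] ≥ 1` lets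
      -- each be raised to the larger one.
      have e1 : 1 / q * ((1 / q + (1 - 1 / p)) / (1 - 1 / p)) ≤
          (1 - α / n) * max 1 (p.conjExponent / q) := by
        rw [hr, conjExponent_eq hp]
        refine le_trans (le_of_eq ?_) (mul_le_mul_of_nonneg_left (le_max_right _ _) hr0.le)
        field_simp
      have e2 : 1 / q * ((1 / q + (1 - 1 / p)) / (1 / q)) ≤
          (1 - α / n) * max 1 (p.conjExponent / q) := by
        rw [hr]
        refine le_trans (le_of_eq ?_) (mul_le_mul_of_nonneg_left (le_max_left _ _) hr0.le)
        field_simp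
      calc _ ≤ (c₂ : ℝ≥0∞) * (K ^ ((1 - α / n) * max 1 (p.conjExponent / q)) +
            K ^ ((1 - α / n) * max 1 (p.conjExponent / q))) * N := by
            refine mul_le_mul' (mul_le_mul_right (add_le_add
              (ENNReal.rpow_le_rpow_of_exponent_le hK1 e1)
              (ENNReal.rpow_le_rpow_of_exponent_le hK1 e2)) _) (le_of_eq h1)
        _ = _ := by rw [← two_mul]; ring
    · intro Q hQ
      rw [hr]
      congr 1
      exact hw.setLIntegral_div hm hFm _ ((isNested_grid b).measurableSet Q hQ)
  have hmeas : ∀ b ∈ (Finset.univ : Finset (Fin n → Fin 2)), Measurable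
      (dyadicSum (grid b) (fun Q => volume Q ^ (-(1 - α / n)) * ∫⁻ y in Q, ‖f y‖ₑ)) :=
    fun b _ => measurable_dyadicSum (isNested_grid b)
  refine (recipNorm_mono (by positivity)
    (lintegral_kernel_le_sum_dyadicSum hn hr0.le hFm)).trans ?_
  rw [recipNorm_const_mul (by positivity) _ (Finset.measurable_fun_sum _ hmeas), ← hc₁]
  refine (mul_le_mul_right ((recipNorm_sum_le _ (by positivity) hq1 hmeas).trans
    (Finset.sum_le_card_nsmul _ _ _ fun b _ => hone b)) _).trans_eq ?_
  rw [nsmul_eq_mul]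
  ring

end UpperBounds

/-! ### Measurability, general data and operator norms -/

section Operators

open Filter Topology

variable {𝕜 : Type*} [RCLike 𝕜] {n : ℕ} {α p q : ℝ} {w : EuclideanSpace ℝ (Fin n) → ℝ}
  {f : EuclideanSpace ℝ (Fin n) → 𝕜}

lemma ball_subset_cube {a x : EuclideanSpace ℝ (Fin n)} {l ε : ℝ} (hx : x ∈ cube a l) :
    Metric.ball x ε ⊆ cube (WithLp.toLp 2 fun i => a i - ε) (l + 2 * ε) := by
  intro y hy i
  have h := (PiLp.norm_apply_le (y - x) i).trans_lt (mem_ball_iff_norm.1 hy)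
  rw [PiLp.sub_apply, Real.norm_eq_abs, abs_lt] at h
  have hxi := hx i
  constructor <;> simp only <;> linarith

/-- A closed cube containing `x`, enlarged by `ε` on every side, contains a neighbourhood of `x`. As
`ε → 0` the enlarged volume tends to the original one, so a strict lower bound at `x` persists
nearby. -/
lemma lowerSemicontinuous_fracMaximal (hα : 0 ≤ 1 - α / n) :
    LowerSemicontinuous (fracMaximal α f) := by
  intro x c hc
  obtain ⟨a, l, hl, hx, h⟩ : ∃ a l, 0 < l ∧ x ∈ cube a l ∧
      c < (∫⁻ y in cube a l, ‖f y‖ₑ) / volume (cube a l) ^ (1 - α / n) := by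
    simpa only [fracMaximal, lt_iSup_iff, exists_prop] using hc
  have hcont : Tendsto (fun ε : ℝ => (∫⁻ y in cube a l, ‖f y‖ₑ) /
      (ENNReal.ofReal (l + 2 * ε) ^ n) ^ (1 - α / n)) (𝓝[>] 0)
      (𝓝 ((∫⁻ y in cube a l, ‖f y‖ₑ) / volume (cube a l) ^ (1 - α / n))) := by
    rw [volume_cube]
    refine ENNReal.Tendsto.const_div ?_ (Or.inl (ENNReal.rpow_ne_top_of_nonneg hα
      (ENNReal.pow_ne_top ENNReal.ofReal_ne_top)))
    refine (ENNReal.continuous_rpow_const.tendsto _).comp ?_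
    refine ((ENNReal.continuous_pow n).tendsto _).comp ?_
    refine (ENNReal.continuous_ofReal.tendsto _).comp ?_
    have : Continuous fun ε : ℝ => l + 2 * ε := by fun_prop
    simpa using (this.tendsto 0).mono_left nhdsWithin_le_nhds
  obtain ⟨ε, hε, hε0⟩ := ((hcont.eventually (lt_mem_nhds h)).and self_mem_nhdsWithin).exists
  have hε0 : 0 < ε := hε0
  filter_upwards [Metric.ball_mem_nhds x hε0] with y hy
  refine hε.trans_le ?_
  have hsub : cube a l ⊆ cube (WithLp.toLp 2 fun i => a i - ε) (l + 2 * ε) := fun z hz =>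
    ball_subset_cube hz (Metric.mem_ball_self hε0)
  refine le_trans ?_ (le_iSup₂_of_le (WithLp.toLp 2 fun i => a i - ε) (l + 2 * ε)
    (le_iSup₂_of_le (by positivity) (ball_subset_cube hx hy) le_rfl))
  rw [volume_cube]
  exact ENNReal.div_le_div_right (lintegral_mono_set hsub) _

lemma fracMaximal_congr {f' : EuclideanSpace ℝ (Fin n) → 𝕜} (h : f =ᵐ[volume] f') :
    fracMaximal α f = fracMaximal α f' := by
  have h1 : ∀ Q : Set (EuclideanSpace ℝ (Fin n)), ∫⁻ y in Q, ‖f y‖ₑ = ∫⁻ y in Q, ‖f' y‖ₑ := fun Q =>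
    lintegral_congr_ae (ae_restrict_of_ae (h.mono fun x hx => by simp [hx]))
  funext x
  simp_rw [fracMaximal, h1]

lemma weightMeasure_absolutelyContinuous (w : EuclideanSpace ℝ (Fin n) → ℝ) (e : ℝ) :
    weightMeasure w e ≪ volume := withDensity_absolutelyContinuous _ _

/-- A weight is positive almost everywhere, so null sets of `w^p dx` are Lebesgue null and the
measurable representative agrees with `f` for Lebesgue measure. -/
lemma exists_measurable_of_memLp (hw : IsApqWeight p q w)
    (hf : MemLp f (ENNReal.ofReal p) (weightMeasure w p)) :
    ∃ f' : EuclideanSpace ℝ (Fin n) → 𝕜, Measurable f' ∧ f =ᵐ[volume] f' := by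
  have h := hf.1.mono_ac (volume_absolutelyContinuous_weightMeasure hw p)
  exact ⟨_, h.stronglyMeasurable_mk.measurable, h.ae_eq_mk⟩

lemma exists_fracMaximal_eLpNorm_le (hn : 0 < n) (hα0 : 0 ≤ α) (hp : 1 < p) (hpα : p * α < n)
    (hq : 1 / q = 1 / p - α / n) : ∃ C : ℝ≥0, ∀ w : EuclideanSpace ℝ (Fin n) → ℝ,
      IsApqWeight p q w → ∀ f : EuclideanSpace ℝ (Fin n) → 𝕜,
      MemLp f (ENNReal.ofReal p) (weightMeasure w p) →
      eLpNorm (fracMaximal α f) (ENNReal.ofReal q) (weightMeasure w q) ≤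
        C * apqConst p q w ^ (p.conjExponent / q * (1 - α / n)) *
          eLpNorm f (ENNReal.ofReal p) (weightMeasure w p) := by
  obtain ⟨C, hC⟩ := exists_fracMaximal_bound (𝕜 := 𝕜) hn hα0 hp hpα hq
  refine ⟨C, fun w hw f hf => ?_⟩
  obtain ⟨w', hm, hww'⟩ := hw.exists_measurable
  obtain ⟨f', hfm, hff'⟩ := exists_measurable_of_memLp hw hf
  rw [fracMaximal_congr hff', apqConst_congr hww', eLpNorm_congr_ae
    ((weightMeasure_absolutelyContinuous w p).ae_eq hff'), weightMeasure_congr hww',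
    weightMeasure_congr hww']
  exact hC w' (hw.congr hww') hm f' hfm

/-- The Riesz potential of the absolute value. -/
def rieszPotential (α : ℝ) (f : EuclideanSpace ℝ (Fin n) → 𝕜) (x : EuclideanSpace ℝ (Fin n)) :
    ℝ≥0∞ := ∫⁻ y, ‖f y‖ₑ * ENNReal.ofReal (‖x - y‖ ^ ((n : ℝ) - α))⁻¹

lemma enorm_rieszIntegrand (x y : EuclideanSpace ℝ (Fin n)) :
    ‖rieszIntegrand α f x y‖ₑ = ‖f y‖ₑ * ENNReal.ofReal (‖x - y‖ ^ ((n : ℝ) - α))⁻¹ := by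
  have h0 : 0 ≤ (‖x - y‖ ^ ((n : ℝ) - α))⁻¹ := by positivity
  rw [rieszIntegrand, div_eq_mul_inv, enorm_mul, ← RCLike.ofReal_inv, ← ofReal_norm
    ((_ : ℝ) : 𝕜), RCLike.norm_ofReal, abs_of_nonneg h0]

lemma enorm_fracIntegral_le (x : EuclideanSpace ℝ (Fin n)) :
    ‖fracIntegral α f x‖ₑ ≤ rieszPotential α f x := by
  refine (enorm_integral_le_lintegral_enorm _).trans_eq ?_
  exact lintegral_congr fun y => enorm_rieszIntegrand x y

lemma measurable_rieszKernel : Measurable fun z : EuclideanSpace ℝ (Fin n) ×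
    EuclideanSpace ℝ (Fin n) => ‖z.1 - z.2‖ ^ ((n : ℝ) - α) :=
  ((measurable_fst.sub measurable_snd).norm).pow_const _

lemma measurable_rieszPotential (hf : Measurable f) : Measurable (rieszPotential α f) :=
  Measurable.lintegral_prod_right' (f := fun z : EuclideanSpace ℝ (Fin n) ×
    EuclideanSpace ℝ (Fin n) => ‖f z.2‖ₑ * ENNReal.ofReal (‖z.1 - z.2‖ ^ ((n : ℝ) - α))⁻¹)
    ((hf.comp measurable_snd).enorm.mul measurable_rieszKernel.inv.ennreal_ofReal)

lemma measurable_rieszIntegrand (hf : Measurable f) : Measurable fun z : EuclideanSpace ℝ (Fin n) ×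
    EuclideanSpace ℝ (Fin n) => rieszIntegrand α f z.1 z.2 :=
  (hf.comp measurable_snd).div (RCLike.measurable_ofReal.comp measurable_rieszKernel)

lemma measurable_fracIntegral (hf : Measurable f) : StronglyMeasurable (fracIntegral α f) :=
  StronglyMeasurable.integral_prod_right (f := fun x y => rieszIntegrand α f x y)
    (measurable_rieszIntegrand hf).stronglyMeasurable

lemma rieszIntegrand_congr {f' : EuclideanSpace ℝ (Fin n) → 𝕜} (h : f =ᵐ[volume] f')
    (x : EuclideanSpace ℝ (Fin n)) : rieszIntegrand α f x =ᵐ[volume] rieszIntegrand α f' x :=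
  h.mono fun y hy => by simp [rieszIntegrand, hy]

lemma fracIntegral_congr {f' : EuclideanSpace ℝ (Fin n) → 𝕜} (h : f =ᵐ[volume] f') :
    fracIntegral α f = fracIntegral α f' :=
  funext fun x => integral_congr_ae (rieszIntegrand_congr h x)

/-- All three claims come from the bound on the potential of `|f|`: a function with finite norm is
finite almost everywhere, first for `w^q dx` and then for Lebesgue measure. -/
lemma exists_fracIntegral_bound (hn : 0 < n) (hα0 : 0 < α) (hp : 1 < p) (hpα : p * α < n)
    (hq : 1 / q = 1 / p - α / n) : ∃ C : ℝ≥0, ∀ w : EuclideanSpace ℝ (Fin n) → ℝ,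
      IsApqWeight p q w → ∀ f : EuclideanSpace ℝ (Fin n) → 𝕜,
      MemLp f (ENNReal.ofReal p) (weightMeasure w p) →
      (∀ᵐ x, Integrable (rieszIntegrand α f x)) ∧
      MemLp (fracIntegral α f) (ENNReal.ofReal q) (weightMeasure w q) ∧
      eLpNorm (fracIntegral α f) (ENNReal.ofReal q) (weightMeasure w q) ≤
        C * apqConst p q w ^ ((1 - α / n) * max 1 (p.conjExponent / q)) *
          eLpNorm f (ENNReal.ofReal p) (weightMeasure w p) := by
  have hq0 : 0 < q := exponent_pos hp hpα hn hq
  have hp0 : 0 < p := by linarith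
  obtain ⟨C, hC⟩ := exists_kernel_bound (𝕜 := 𝕜) hn hα0 hp hpα hq
  refine ⟨C, fun w hw f hf => ?_⟩
  obtain ⟨w', hm, hww'⟩ := hw.exists_measurable
  obtain ⟨f', hfm, hff'⟩ := exists_measurable_of_memLp hw hf
  have heq : eLpNorm f (ENNReal.ofReal p) (weightMeasure w p) =
      eLpNorm f' (ENNReal.ofReal p) (weightMeasure w' p) := by
    rw [eLpNorm_congr_ae ((weightMeasure_absolutelyContinuous w p).ae_eq hff'),
      weightMeasure_congr hww']
  have hfin := hf.2.ne
  rw [heq] at hfin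
  have hw' := hw.congr hww'
  have hb := hC w' hw' hm f' hfm hfin
  change recipNorm _ _ (rieszPotential α f') ≤ _ at hb
  have he : 0 ≤ (1 - α / n) * max 1 (p.conjExponent / q) := by
    refine mul_nonneg ?_ (le_trans zero_le_one (le_max_left _ _))
    have h1 : 1 / q ≤ 1 - α / n := by
      rw [hq]
      have := (div_lt_one hp0).2 hp
      linarith
    exact le_trans (by positivity) h1
  have hRHS : C * apqConst p q w' ^ ((1 - α / n) * max 1 (p.conjExponent / q)) *
          eLpNorm f' (ENNReal.ofReal p) (weightMeasure w' p) ≠ ∞ :=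
    ENNReal.mul_ne_top (ENNReal.mul_ne_top ENNReal.coe_ne_top
      (ENNReal.rpow_ne_top_of_nonneg he hw'.apqConst_lt_top.ne)) hfin
  have hle : eLpNorm (fracIntegral α f') (ENNReal.ofReal q) (weightMeasure w' q) ≤
      C * apqConst p q w' ^ ((1 - α / n) * max 1 (p.conjExponent / q)) *
          eLpNorm f' (ENNReal.ofReal p) (weightMeasure w' p) := by
    rw [eLpNorm_eq_recipNorm hq0]
    exact (recipNorm_mono (by positivity) fun x => enorm_fracIntegral_le x).trans hb
  rw [fracIntegral_congr hff', apqConst_congr hww', heq, weightMeasure_congr hww']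
  refine ⟨?_, ⟨(measurable_fracIntegral hfm).aestronglyMeasurable, hle.trans_lt hRHS.lt_top⟩, hle⟩
  have hJ : ∀ᵐ x ∂weightMeasure w' q, rieszPotential α f' x ^ (1 / q)⁻¹ < ∞ := by
    refine ae_lt_top ((measurable_rieszPotential hfm).pow_const _) fun htop => hRHS ?_
    rw [recipNorm, htop, ENNReal.top_rpow_of_pos (by positivity), top_le_iff] at hb
    exact hb
  filter_upwards [(volume_absolutelyContinuous_weightMeasure hw' q).ae_le hJ] with x hx
  refine Integrable.congr ?_ (rieszIntegrand_congr hff' x).symm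
  refine ⟨((measurable_rieszIntegrand hfm).comp measurable_prodMk_left).aestronglyMeasurable, ?_⟩
  rw [hasFiniteIntegral_def]
  simp_rw [enorm_rieszIntegrand]
  refine lt_top_iff_ne_top.2 fun htop => ?_
  rw [show rieszPotential α f' x = ∞ from htop, ENNReal.top_rpow_of_pos (by positivity)] at hx
  exact lt_irrefl _ hx

lemma weightedBound_of_eLpNorm_le {F : Type*} [ENorm F] {β : ℝ}
    {T : (EuclideanSpace ℝ (Fin n) → 𝕜) → EuclideanSpace ℝ (Fin n) → F} {C : ℝ≥0}
    (h : ∀ w : EuclideanSpace ℝ (Fin n) → ℝ, IsApqWeight p q w →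
      ∀ f : EuclideanSpace ℝ (Fin n) → 𝕜, MemLp f (ENNReal.ofReal p) (weightMeasure w p) →
      eLpNorm (T f) (ENNReal.ofReal q) (weightMeasure w q) ≤
        C * apqConst p q w ^ β * eLpNorm f (ENNReal.ofReal p) (weightMeasure w p)) :
    WeightedBound p q β T := by
  refine ⟨C, fun w hw => sInf_le fun f hf => ?_⟩
  rw [ENNReal.ofReal_coe_nnreal]
  exact h w hw f hf

/-- Finiteness of the operator norm provides an admissible `N`, which settles the case of zero norm
of `f`; otherwise one divides by that norm. -/
lemma eLpNorm_le_weightedOpNorm_mul {F : Type*} [ENorm F]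
    {T : (EuclideanSpace ℝ (Fin n) → 𝕜) → EuclideanSpace ℝ (Fin n) → F}
    (hT : weightedOpNorm p q w T ≠ ∞) (hf : MemLp f (ENNReal.ofReal p) (weightMeasure w p)) :
    eLpNorm (T f) (ENNReal.ofReal q) (weightMeasure w q) ≤
      weightedOpNorm p q w T * eLpNorm f (ENNReal.ofReal p) (weightMeasure w p) := by
  set y := eLpNorm (T f) (ENNReal.ofReal q) (weightMeasure w q)
  set a := eLpNorm f (ENNReal.ofReal p) (weightMeasure w p)
  have ha : a ≠ ∞ := hf.2.ne
  rcases eq_or_ne a 0 with h0 | h0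
  · obtain ⟨N, hN, -⟩ := sInf_lt_iff.1 (lt_top_iff_ne_top.2 hT)
    have := hN f hf
    change y ≤ N * a at this
    rw [h0, mul_zero] at this
    exact this.trans zero_le
  · rw [← ENNReal.div_le_iff h0 ha]
    refine le_sInf fun N hN => ?_
    rw [ENNReal.div_le_iff h0 ha]
    exact hN f hf

end Operators

/-! ### Integrals of radial powers -/

section Radial

variable {n : ℕ}

/-- The surface measure of the unit sphere of `ℝⁿ`. -/
def sphereArea (n : ℕ) : ℝ := n * volume.real (Metric.ball (0 : EuclideanSpace ℝ (Fin n)) 1)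

/-- The rotation invariant set of all vectors with norm in `S`. -/
def radialSet (n : ℕ) (S : Set ℝ) : Set (EuclideanSpace ℝ (Fin n)) := {x | ‖x‖ ∈ S}

lemma measurableSet_radialSet {S : Set ℝ} (hS : MeasurableSet S) : MeasurableSet (radialSet n S) :=
  measurable_norm hS

lemma sphereArea_pos (hn : 0 < n) : 0 < sphereArea n := by
  have : NeZero n := ⟨hn.ne'⟩
  refine mul_pos (by exact_mod_cast hn) ?_
  exact ENNReal.toReal_pos (Metric.measure_ball_pos _ _ one_pos).ne' measure_ball_lt_top.ne

lemma pow_pred_mul_rpow (hn : 0 < n) {y : ℝ} (hy : 0 < y) (s : ℝ) :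
    y ^ (n - 1) * y ^ s = y ^ (s + n - 1) := by
  rw [← Real.rpow_natCast, ← Real.rpow_add hy, Nat.cast_pred hn]
  congr 1; ring

/-- Integration in polar coordinates. -/
lemma setLIntegral_radialSet (hn : 0 < n) {S : Set ℝ} (hS : MeasurableSet S) (hS0 : S ⊆ Ioi 0)
    {s : ℝ} (hi : IntegrableOn (fun y : ℝ => y ^ (s + n - 1)) S) :
    ∫⁻ x in radialSet n S, ‖x‖ₑ ^ s = ENNReal.ofReal (sphereArea n * ∫ y in S, y ^ (s + n - 1)) := by
  have : NeZero n := ⟨hn.ne'⟩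
  have key : ∀ y ∈ Ioi (0 : ℝ), y ^ (Module.finrank ℝ (EuclideanSpace ℝ (Fin n)) - 1) •
      S.indicator (fun y => y ^ s) y = S.indicator (fun y => y ^ (s + n - 1)) y := by
    intro y hy
    rw [finrank_euclideanSpace_fin]
    by_cases h : y ∈ S
    · simp [h, pow_pred_mul_rpow hn hy]
    · simp [h]
  have hint : Integrable (fun x : EuclideanSpace ℝ (Fin n) => S.indicator (fun y => y ^ s) ‖x‖) := by
    rw [integrable_fun_norm_addHaar volume (f := S.indicator fun y => y ^ s),
      integrableOn_congr_fun key measurableSet_Ioi]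
    exact ((integrable_indicator_iff hS).2 hi).integrableOn
  have hval := integral_fun_norm_addHaar (volume : Measure (EuclideanSpace ℝ (Fin n)))
    (S.indicator fun y : ℝ => y ^ s)
  rw [setIntegral_congr_fun measurableSet_Ioi key, setIntegral_indicator hS,
    inter_eq_self_of_subset_right hS0, finrank_euclideanSpace_fin] at hval
  have h1 : sphereArea n * ∫ y in S, y ^ (s + n - 1) =
      ∫ x : EuclideanSpace ℝ (Fin n), S.indicator (fun y => y ^ s) ‖x‖ := by
    rw [hval, sphereArea, nsmul_eq_mul, smul_eq_mul, mul_assoc]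
  rw [h1, ofReal_integral_eq_lintegral_ofReal hint (ae_of_all _ fun x =>
    indicator_nonneg (fun y hy => Real.rpow_nonneg (hS0 hy).le _) _),
    ← lintegral_indicator (measurableSet_radialSet hS)]
  refine lintegral_congr fun x => ?_
  by_cases h : ‖x‖ ∈ S
  · rw [indicator_of_mem (show x ∈ radialSet n S from h), indicator_of_mem h,
      ← ENNReal.ofReal_rpow_of_pos (hS0 h), ofReal_norm]
  · rw [indicator_of_notMem (show x ∉ radialSet n S from h), indicator_of_notMem h,
      ENNReal.ofReal_zero]

lemma setLIntegral_radialSet_Ioo (hn : 0 < n) {δ R : ℝ} (hδ : 0 < δ) (hR : 0 < R) :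
    ∫⁻ x in radialSet n (Ioo 0 R), ‖x‖ₑ ^ (δ - n) =
      ENNReal.ofReal (sphereArea n * (R ^ δ / δ)) := by
  have he : δ - n + n - 1 = δ - 1 := by ring
  have hi : IntervalIntegrable (fun y : ℝ => y ^ (δ - 1)) volume 0 R :=
    intervalIntegral.intervalIntegrable_rpow' (by linarith)
  rw [setLIntegral_radialSet hn measurableSet_Ioo (fun y hy => hy.1), he,
    ← integral_Ioc_eq_integral_Ioo, ← intervalIntegral.integral_of_le hR.le,
    integral_rpow (Or.inl (by linarith)), sub_add_cancel, Real.zero_rpow hδ.ne', sub_zero]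
  rw [he]
  exact ((intervalIntegrable_iff_integrableOn_Ioc_of_le hR.le).1 hi).mono_set Ioo_subset_Ioc_self

lemma setLIntegral_radialSet_Ioi (hn : 0 < n) {ε : ℝ} (hε : 0 < ε) :
    ∫⁻ x in radialSet n (Ioi 1), ‖x‖ₑ ^ (-ε - n) = ENNReal.ofReal (sphereArea n * ε⁻¹) := by
  have he : -ε - n + n - 1 = -ε - 1 := by ring
  rw [setLIntegral_radialSet hn measurableSet_Ioi (Ioi_subset_Ioi zero_le_one), he,
    integral_Ioi_rpow_of_lt (by linarith) one_pos]
  · simp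
  · rw [he]
    exact integrableOn_Ioi_rpow_of_lt (by linarith) one_pos

lemma locallyIntegrable_norm_rpow (hn : 0 < n) {γ : ℝ} (hγ : 0 < γ + n) :
    LocallyIntegrable fun x : EuclideanSpace ℝ (Fin n) => ‖x‖ ^ γ := by
  have : NeZero n := ⟨hn.ne'⟩
  intro x
  refine ⟨Metric.ball 0 (‖x‖ + 1), Metric.isOpen_ball.mem_nhds (by simp), ?_⟩
  rw [integrableOn_fun_norm_addHaar volume (f := fun y => y ^ γ), finrank_euclideanSpace_fin,
    integrableOn_congr_fun (g := fun y => y ^ (γ + n - 1))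
      (fun y hy => by simpa using pow_pred_mul_rpow hn hy.1 γ) measurableSet_Ioo]
  have hi : IntervalIntegrable (fun y : ℝ => y ^ (γ + n - 1)) volume 0 (‖x‖ + 1) :=
    intervalIntegral.intervalIntegrable_rpow' (by linarith)
  exact ((intervalIntegrable_iff_integrableOn_Ioc_of_le (by positivity)).1 hi).mono_set
    Ioo_subset_Ioc_self

lemma ae_ne_zero (hn : 0 < n) : ∀ᵐ x : EuclideanSpace ℝ (Fin n), x ≠ 0 := by
  have : NeZero n := ⟨hn.ne'⟩
  exact Measure.ae_ne volume 0

lemma enorm_rpow_eq {x : EuclideanSpace ℝ (Fin n)} (hx : x ≠ 0) (s : ℝ) :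
    ENNReal.ofReal (‖x‖ ^ s) = ‖x‖ₑ ^ s := by
  rw [← ENNReal.ofReal_rpow_of_pos (norm_pos_iff.2 hx), ofReal_norm]

lemma ofReal_norm_rpow_rpow (hn : 0 < n) (γ e : ℝ) :
    (fun x : EuclideanSpace ℝ (Fin n) => ENNReal.ofReal (‖x‖ ^ γ) ^ e) =ᵐ[volume]
      fun x => ‖x‖ₑ ^ (γ * e) := by
  filter_upwards [ae_ne_zero hn] with x hx
  rw [enorm_rpow_eq hx, ENNReal.rpow_mul]

end Radial

/-! ### Weight constants of power weights -/

section PowerWeights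

variable {n : ℕ} {p q : ℝ}

lemma norm_sub_le_of_mem_cube (hn : 0 < n) {a x y : EuclideanSpace ℝ (Fin n)} {l : ℝ} (hl : 0 ≤ l)
    (hx : x ∈ cube a l) (hy : y ∈ cube a l) : ‖x - y‖ ≤ n * l := by
  have hn1 : (1 : ℝ) ≤ n := by exact_mod_cast hn
  refine abs_le_of_sq_le_sq' ?_ (by positivity) |>.2
  rw [EuclideanSpace.norm_sq_eq]
  calc ∑ i, ‖(x - y) i‖ ^ 2 ≤ ∑ _i : Fin n, l ^ 2 := by
        refine Finset.sum_le_sum fun i _ => ?_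
        rw [Real.norm_eq_abs, sq_abs, PiLp.sub_apply]
        exact sq_le_sq' (by linarith [(hx i).1, (hy i).2]) (by linarith [(hx i).2, (hy i).1])
    _ = n * l ^ 2 := by simp
    _ ≤ (n * l) ^ 2 := by rw [mul_pow]; gcongr; nlinarith

lemma setLAverage_le_of_forall_mem {X : Type*} [MeasurableSpace X] {μ : Measure X} {s : Set X}
    {f : X → ℝ≥0∞} {c : ℝ≥0∞} (h : ∀ x ∈ s, f x ≤ c) (hs : MeasurableSet s) :
    ⨍⁻ x in s, f x ∂μ ≤ c := by
  rw [setLAverage_eq]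
  refine ENNReal.div_le_of_le_mul ?_
  rw [← setLIntegral_const]
  exact setLIntegral_mono' hs h

/-- The length scale `M` cancels, because `κ b = a` balances its powers; only the constants survive.
-/
lemma mul_rpow_rpow_le {X Y : ℝ≥0∞} {a b κ K₁ K₂ M t : ℝ} (ha : 0 < a) (hb : 0 < b)
    (hκ : κ * b = a) (hM : 0 < M) (hK₁ : 0 ≤ K₁) (hK₂ : 0 ≤ K₂)
    (hX : X ≤ ENNReal.ofReal (K₁ * M ^ (-t))) (hY : Y ≤ ENNReal.ofReal (K₂ * M ^ (κ * t))) :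
    X ^ a * Y ^ b ≤ ENNReal.ofReal (K₁ ^ a * K₂ ^ b) := by
  have h1 := Real.rpow_nonneg hM.le (-t)
  have h2 := Real.rpow_nonneg hM.le (κ * t)
  refine (mul_le_mul' (ENNReal.rpow_le_rpow hX ha.le) (ENNReal.rpow_le_rpow hY hb.le)).trans
    (le_of_eq ?_)
  rw [ENNReal.ofReal_rpow_of_nonneg (mul_nonneg hK₁ h1) ha.le,
    ENNReal.ofReal_rpow_of_nonneg (mul_nonneg hK₂ h2) hb.le,
    ← ENNReal.ofReal_mul (Real.rpow_nonneg (mul_nonneg hK₁ h1) _), Real.mul_rpow hK₁ h1,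
    Real.mul_rpow hK₂ h2, ← Real.rpow_mul hM.le, ← Real.rpow_mul hM.le, mul_mul_mul_comm,
    ← Real.rpow_add hM, ← hκ]
  ring_nf
  simp

lemma enorm_rpow_le_ofReal {x : EuclideanSpace ℝ (Fin n)} {N s : ℝ} (hs : 0 ≤ s) (h : ‖x‖ ≤ N) :
    ‖x‖ₑ ^ s ≤ ENNReal.ofReal (N ^ s) := by
  rw [← ENNReal.ofReal_rpow_of_nonneg ((norm_nonneg x).trans h) hs, ← ofReal_norm]
  exact ENNReal.rpow_le_rpow (ENNReal.ofReal_le_ofReal h) hs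

lemma enorm_rpow_neg_le_ofReal {x : EuclideanSpace ℝ (Fin n)} {N s : ℝ} (hs : 0 ≤ s) (hN : 0 < N)
    (h : N ≤ ‖x‖) : ‖x‖ₑ ^ (-s) ≤ ENNReal.ofReal (N ^ (-s)) := by
  rw [← ENNReal.ofReal_rpow_of_pos hN, ← ofReal_norm, ENNReal.rpow_neg, ENNReal.rpow_neg]
  exact ENNReal.inv_le_inv.2 (ENNReal.rpow_le_rpow (ENNReal.ofReal_le_ofReal h) hs)

/-- Only cubes near the origin see the singularity of `|x|^(δ-n)`, whose integral over a ball costs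
a factor `1/δ`. On the other cubes both powers are essentially constant. -/
lemma exists_power_setLAverage_le (hn : 0 < n) {a b κ : ℝ} (ha : 0 < a) (hb : 0 < b) (hκ0 : 0 < κ)
    (hκ : κ * b = a) : ∃ C : ℝ, 0 < C ∧ ∀ δ : ℝ, 0 < δ → δ ≤ 1 →
      ∀ (c : EuclideanSpace ℝ (Fin n)) (l : ℝ), 0 < l →
        (⨍⁻ x in cube c l, ‖x‖ₑ ^ (δ - n) ∂volume) ^ a * (⨍⁻ x in cube c l, ‖x‖ₑ ^ (κ * (n - δ)) ∂volume) ^ b ≤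
          ENNReal.ofReal (C * δ ^ (-a)) := by
  have hS := sphereArea_pos hn
  have hn1 : (1 : ℝ) ≤ n := by exact_mod_cast hn
  refine ⟨(sphereArea n * (4 * n) ^ n) ^ a + ((4 : ℝ) ^ (κ * n)) ^ b, by positivity, ?_⟩
  intro δ hδ hδ1 c l hl
  have ht : 0 ≤ n - δ := by linarith
  have hδn : δ - n = -(n - δ) := by ring
  have hδa : 1 ≤ δ ^ (-a) := Real.one_le_rpow_of_pos_of_le_one_of_nonpos hδ hδ1 (by linarith)
  -- The cube has diameter at most `n l`. Near the origin it lies in the ball of radius `4 n l`; far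
  -- away, all its points have norm comparable to that of the corner `c`.
  by_cases hx : ∃ x₀ ∈ cube c l, ‖x₀‖ ≤ 2 * (n * l)
  · obtain ⟨x₀, hx₀, hx₀n⟩ := hx
    have hM : 0 < 4 * n * l := by positivity
    have hnorm : ∀ x ∈ cube c l, ‖x‖ < 4 * n * l := fun x hx => by
      have h1 := norm_sub_le_of_mem_cube hn hl.le hx hx₀
      have h2 := norm_le_norm_add_norm_sub' x x₀
      nlinarith
    refine (mul_rpow_rpow_le (K₁ := sphereArea n * (4 * n) ^ n / δ) (K₂ := 1) ha hb hκ hM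
      (by positivity) zero_le_one (t := n - δ) ?_ ?_).trans ?_
    · rw [setLAverage_eq, volume_cube]
      refine ENNReal.div_le_of_le_mul ?_
      rw [← ENNReal.ofReal_pow hl.le, ← ENNReal.ofReal_mul (by positivity)]
      calc ∫⁻ x in cube c l, ‖x‖ₑ ^ (δ - n)
          ≤ ∫⁻ x in radialSet n (Ioo 0 (4 * n * l)), ‖x‖ₑ ^ (δ - n) := by
            refine lintegral_mono_set' ?_
            filter_upwards [ae_ne_zero hn] with x hx hxc
            exact ⟨norm_pos_iff.2 hx, hnorm x hxc⟩
        _ = ENNReal.ofReal (sphereArea n * ((4 * n * l) ^ δ / δ)) :=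
            setLIntegral_radialSet_Ioo hn hδ hM
        _ = _ := by
            congr 1
            have h1 : (4 * n * l) ^ δ = (4 * n * l) ^ (-(n - δ)) * ((4 * n) ^ n * l ^ n) := by
              rw [← mul_pow, ← Real.rpow_natCast, ← Real.rpow_add hM]
              congr 1; ring
            rw [h1]; ring
    · rw [one_mul]
      exact setLAverage_le_of_forall_mem (fun x hx => enorm_rpow_le_ofReal (by positivity)
        (hnorm x hx).le) (measurableSet_cube c l)
    · refine ENNReal.ofReal_le_ofReal ?_
      rw [Real.one_rpow, mul_one, Real.div_rpow (by positivity) hδ.le, Real.rpow_neg hδ.le,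
        div_eq_mul_inv]
      gcongr
      exact le_add_of_nonneg_right (by positivity)
  · push Not at hx
    have hc : c ∈ cube c l := fun i => ⟨le_rfl, by linarith⟩
    have hcN := hx c hc
    have hN : 0 < ‖c‖ / 2 := by have : 0 < (n : ℝ) * l := by positivity
                                linarith
    have hnorm : ∀ x ∈ cube c l, ‖c‖ / 2 ≤ ‖x‖ ∧ ‖x‖ ≤ 4 * (‖c‖ / 2) := fun x hx => by
      have h1 := norm_sub_le_of_mem_cube hn hl.le hx hc
      have h2 := norm_le_norm_add_norm_sub' x c
      have h3 := norm_le_norm_add_norm_sub x c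
      constructor <;> linarith
    refine (mul_rpow_rpow_le (K₁ := 1) (K₂ := 4 ^ (κ * n)) ha hb hκ hN
      zero_le_one (by positivity) (t := n - δ) ?_ ?_).trans ?_
    · rw [one_mul, hδn]
      exact setLAverage_le_of_forall_mem (fun x hx => enorm_rpow_neg_le_ofReal ht hN
        (hnorm x hx).1) (measurableSet_cube c l)
    · refine setLAverage_le_of_forall_mem (fun x hx => (enorm_rpow_le_ofReal (by positivity)
        (hnorm x hx).2).trans (ENNReal.ofReal_le_ofReal ?_)) (measurableSet_cube c l)
      rw [Real.mul_rpow (by norm_num) hN.le]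
      gcongr
      · norm_num
      · linarith
    · refine ENNReal.ofReal_le_ofReal ?_
      rw [Real.one_rpow, one_mul]
      refine le_trans ?_ (le_mul_of_one_le_right (by positivity) hδa)
      exact le_add_of_nonneg_left (by positivity)

lemma isApqWeight_norm_rpow (hn : 0 < n) {γ : ℝ} (hγ : 0 < γ + n) {K : ℝ}
    (h : ∀ (c : EuclideanSpace ℝ (Fin n)) (l : ℝ), 0 < l →
      (⨍⁻ x in cube c l, ‖x‖ₑ ^ (γ * q) ∂volume) *
        (⨍⁻ x in cube c l, ‖x‖ₑ ^ (γ * -p.conjExponent) ∂volume) ^ (q / p.conjExponent) ≤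
          ENNReal.ofReal K) :
    IsApqWeight p q (fun x : EuclideanSpace ℝ (Fin n) => ‖x‖ ^ γ) ∧
      apqConst p q (fun x : EuclideanSpace ℝ (Fin n) => ‖x‖ ^ γ) ≤ ENNReal.ofReal K := by
  have hK : apqConst p q (fun x : EuclideanSpace ℝ (Fin n) => ‖x‖ ^ γ) ≤ ENNReal.ofReal K := by
    refine iSup_le fun c => iSup_le fun l => iSup_le fun hl => ?_
    simp only [setLAverage_eq] at h ⊢
    rw [lintegral_congr_ae (ae_restrict_of_ae (ofReal_norm_rpow_rpow hn γ q)),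
      lintegral_congr_ae (ae_restrict_of_ae (ofReal_norm_rpow_rpow hn γ (-p.conjExponent)))]
    exact h c l hl
  refine ⟨⟨locallyIntegrable_norm_rpow hn hγ, ?_, hK.trans_lt ENNReal.ofReal_lt_top⟩, hK⟩
  filter_upwards [ae_ne_zero hn] with x hx
  exact Real.rpow_pos_of_pos (norm_pos_iff.2 hx) _

/-- Here `w^(-p') = |x|^(δ-n)` is the singular factor, and it enters with the power `q/p'`. -/
lemma exists_positive_power_weight (hn : 0 < n) (hp : 0 < p.conjExponent) (hq : 0 < q) :
    ∃ C : ℝ, 0 < C ∧ ∀ δ : ℝ, 0 < δ → δ ≤ 1 →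
      IsApqWeight p q (fun x : EuclideanSpace ℝ (Fin n) => ‖x‖ ^ ((n - δ) / p.conjExponent)) ∧
      apqConst p q (fun x : EuclideanSpace ℝ (Fin n) => ‖x‖ ^ ((n - δ) / p.conjExponent)) ≤
        ENNReal.ofReal (C * δ ^ (-(q / p.conjExponent))) := by
  have hn1 : (1 : ℝ) ≤ n := by exact_mod_cast hn
  obtain ⟨C, hC0, hC⟩ := exists_power_setLAverage_le hn (div_pos hq hp) one_pos (div_pos hq hp)
    (mul_one _)
  refine ⟨C, hC0, fun δ hδ hδ1 => isApqWeight_norm_rpow hn ?_ fun c l hl => ?_⟩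
  · have : 0 ≤ (n - δ) / p.conjExponent := div_nonneg (by linarith) hp.le
    linarith
  · have h := hC δ hδ hδ1 c l hl
    rw [ENNReal.rpow_one, mul_comm] at h
    convert h using 5 <;> field_simp
    ring_nf

/-- Here `w^q = |x|^(δ-n)` is the singular factor and enters with the power `1`; `q ≥ 1` makes `w`
locally integrable. -/
lemma exists_negative_power_weight (hn : 0 < n) (hp : 0 < p.conjExponent) (hq : 1 ≤ q) :
    ∃ C : ℝ, 0 < C ∧ ∀ δ : ℝ, 0 < δ → δ ≤ 1 →
      IsApqWeight p q (fun x : EuclideanSpace ℝ (Fin n) => ‖x‖ ^ (-(n - δ) / q)) ∧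
      apqConst p q (fun x : EuclideanSpace ℝ (Fin n) => ‖x‖ ^ (-(n - δ) / q)) ≤
        ENNReal.ofReal (C * δ ^ (-1 : ℝ)) := by
  have hn1 : (1 : ℝ) ≤ n := by exact_mod_cast hn
  have hq0 : 0 < q := one_pos.trans_le hq
  obtain ⟨C, hC0, hC⟩ := exists_power_setLAverage_le hn one_pos (div_pos hq0 hp) (div_pos hp hq0)
    (by field_simp)
  refine ⟨C, hC0, fun δ hδ hδ1 => isApqWeight_norm_rpow hn ?_ fun c l hl => ?_⟩
  · have : (n - δ) / q ≤ n - δ := div_le_self (by linarith) hq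
    rw [neg_div]
    linarith
  · have h := hC δ hδ hδ1 c l hl
    rw [ENNReal.rpow_one] at h
    convert h using 5 <;> field_simp
    ring

end PowerWeights

/-! ### Comparison of blow-up rates and lower bounds for the operators -/

section Sharpness

variable {𝕜 : Type*} [RCLike 𝕜] {n : ℕ} {α p q : ℝ}

/-- If `s > t`, the value of `δ` with `δ^(-(s-t)) = max C 0 + 1` contradicts the hypothesis. -/
lemma le_of_forall_rpow_neg_le {s t C : ℝ}
    (h : ∀ δ : ℝ, 0 < δ → δ ≤ 1 → δ ^ (-s) ≤ C * δ ^ (-t)) : s ≤ t := by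
  by_contra! hst
  have hs : 0 < s - t := sub_pos.2 hst
  set D := max C 0 + 1
  have hD : 1 ≤ D := by simp [D]
  have hD0 : 0 < D := one_pos.trans_le hD
  have hδ : 0 < D ^ (-(s - t)⁻¹) := Real.rpow_pos_of_pos hD0 _
  have h1 := h (D ^ (-(s - t)⁻¹)) hδ
    (Real.rpow_le_one_of_one_le_of_nonpos hD (by simpa using hs.le))
  rw [show -s = -(s - t) + -t by ring, Real.rpow_add hδ, ← Real.rpow_mul hD0.le, neg_mul_neg,
    inv_mul_cancel₀ hs.ne', Real.rpow_one, mul_le_mul_iff_left₀ (Real.rpow_pos_of_pos hδ _)] at h1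
  linarith [le_max_left C 0, show D = max C 0 + 1 from rfl]

/-- Along a family of test functions the operator norm grows at least like `δ^(-r)`, while the
weighted bound allows growth of order `δ^(-aβ)`. -/
lemma WeightedBound.le_mul {F : Type*} [ENorm F] {a β e r C₀ c₁ c₂ : ℝ}
    {T : (EuclideanSpace ℝ (Fin n) → 𝕜) → EuclideanSpace ℝ (Fin n) → F}
    (hT : WeightedBound p q β T) (hr : 0 < r) (hC₀ : 0 < C₀) (hc₁ : 0 < c₁) (hc₂ : 0 < c₂)
    {w : ℝ → EuclideanSpace ℝ (Fin n) → ℝ} {f : ℝ → EuclideanSpace ℝ (Fin n) → 𝕜}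
    (hw : ∀ δ, 0 < δ → δ ≤ 1 → IsApqWeight p q (w δ) ∧
      apqConst p q (w δ) ≤ ENNReal.ofReal (C₀ * δ ^ (-a)))
    (h1 : ∀ v : EuclideanSpace ℝ (Fin n) → ℝ, IsApqWeight p q v → 1 ≤ apqConst p q v)
    (hf : ∀ δ, 0 < δ → δ ≤ 1 → MemLp (f δ) (ENNReal.ofReal p) (weightMeasure (w δ) p) ∧
      eLpNorm (f δ) (ENNReal.ofReal p) (weightMeasure (w δ) p) ≤ ENNReal.ofReal (c₁ * δ ^ (-e)))
    (hTf : ∀ δ, 0 < δ → δ ≤ 1 → ENNReal.ofReal (c₂ * δ ^ (-(e + r))) ≤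
      eLpNorm (T (f δ)) (ENNReal.ofReal q) (weightMeasure (w δ) q)) :
    r ≤ a * β := by
  obtain ⟨C, hC⟩ := hT
  -- The constant `[w]` is only bounded from above, which is useful for nonnegative exponents. Since
  -- `[w] ≥ 1`, `β` may be replaced by `max β 0`, and a nonpositive `β` is excluded afterwards by `r
  -- > 0`.
  have key : r ≤ a * max β 0 := by
    refine le_of_forall_rpow_neg_le (C := max C 0 * C₀ ^ max β 0 * c₁ / c₂) fun δ hδ hδ1 => ?_
    obtain ⟨hA, hK⟩ := hw δ hδ hδ1
    obtain ⟨hm, hn⟩ := hf δ hδ hδ1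
    have hK1 := h1 _ hA
    have hbd : weightedOpNorm p q (w δ) T ≤
        ENNReal.ofReal (max C 0 * (C₀ * δ ^ (-a)) ^ max β 0) := by
      refine (hC _ hA).trans ?_
      rw [ENNReal.ofReal_mul (le_max_right _ _),
        ← ENNReal.ofReal_rpow_of_nonneg (by positivity) (le_max_right _ _)]
      gcongr
      · exact le_max_left _ _
      · exact (ENNReal.rpow_le_rpow_of_exponent_le hK1 (le_max_left β 0)).trans
          (ENNReal.rpow_le_rpow hK (le_max_right _ _))
    have h2 := (hTf δ hδ hδ1).trans
      ((eLpNorm_le_weightedOpNorm_mul (ne_top_of_le_ne_top ENNReal.ofReal_ne_top hbd) hm).trans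
        (mul_le_mul' hbd hn))
    rw [← ENNReal.ofReal_mul (by positivity), ENNReal.ofReal_le_ofReal_iff (by positivity),
      Real.mul_rpow hC₀.le (by positivity), ← Real.rpow_mul hδ.le, neg_add, Real.rpow_add hδ] at h2
    have hδe : 0 < δ ^ (-e) := by positivity
    rw [div_mul_eq_mul_div, le_div_iff₀ hc₂, ← neg_mul, ← mul_le_mul_iff_left₀ hδe]
    linarith
  rcases le_total 0 β with h | h
  · rwa [max_eq_left h] at key
  · rw [max_eq_right h, mul_zero] at key
    exact absurd hr key.not_gt

variable (𝕜) in
/-- The function `‖x‖ ^ s` restricted to the vectors with norm in `S`. -/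
def radialPower (S : Set ℝ) (s : ℝ) : EuclideanSpace ℝ (Fin n) → 𝕜 :=
  (radialSet n S).indicator fun x => ((‖x‖ ^ s : ℝ) : 𝕜)

variable {S : Set ℝ} {s γ : ℝ}

lemma measurable_radialPower (hS : MeasurableSet S) :
    Measurable (radialPower 𝕜 S s : EuclideanSpace ℝ (Fin n) → 𝕜) :=
  (RCLike.measurable_ofReal.comp (measurable_norm.pow_const _)).indicator
    (measurableSet_radialSet hS)

lemma enorm_radialPower (hS0 : S ⊆ Ioi 0) (x : EuclideanSpace ℝ (Fin n)) :
    ‖radialPower 𝕜 S s x‖ₑ = (radialSet n S).indicator (fun x => ‖x‖ₑ ^ s) x := by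
  rw [radialPower, enorm_indicator_eq_indicator_enorm]
  refine congrFun (indicator_congr fun y hy => ?_) x
  rw [← ofReal_norm, RCLike.norm_ofReal, abs_of_nonneg (by positivity),
    enorm_rpow_eq (norm_pos_iff.1 (hS0 hy))]

lemma lintegral_weightMeasure_norm_rpow (hn : 0 < n) (e : ℝ)
    {g : EuclideanSpace ℝ (Fin n) → ℝ≥0∞} (hg : Measurable g) :
    ∫⁻ x, g x ∂(weightMeasure (fun x => ‖x‖ ^ γ) e) = ∫⁻ x, ‖x‖ₑ ^ (γ * e) * g x := by
  rw [weightMeasure, lintegral_withDensity_eq_lintegral_mul _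
    (measurable_ofReal_rpow (measurable_norm.pow_const _) e) hg]
  refine lintegral_congr_ae ?_
  filter_upwards [ofReal_norm_rpow_rpow hn γ e] with x hx
  rw [Pi.mul_apply, hx]

lemma recipNorm_weightMeasure_norm_rpow (hn : 0 < n) (hS : MeasurableSet S) (hS0 : S ⊆ Ioi 0)
    {e : ℝ} (he : 0 < e) :
    recipNorm (weightMeasure (fun x => ‖x‖ ^ γ) e) (1 / e)
      ((radialSet n S).indicator fun x => ‖x‖ₑ ^ s) =
        (∫⁻ x in radialSet n S, ‖x‖ₑ ^ ((s + γ) * e)) ^ (1 / e) := by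
  have hm := measurableSet_radialSet (n := n) hS
  rw [recipNorm, one_div, inv_inv, lintegral_weightMeasure_norm_rpow hn e
    (((measurable_enorm.pow_const _).indicator hm).pow_const _), ← lintegral_indicator hm]
  congr 1
  refine lintegral_congr fun x => ?_
  by_cases hx : x ∈ radialSet n S
  · have hx0 : ‖x‖ₑ ≠ 0 := enorm_ne_zero.2 (norm_pos_iff.1 (hS0 hx))
    rw [indicator_of_mem hx, indicator_of_mem hx, ← ENNReal.rpow_mul,
      ← ENNReal.rpow_add _ _ hx0 enorm_ne_top]
    congr 1; ring
  · rw [indicator_of_notMem hx, indicator_of_notMem hx, ENNReal.zero_rpow_of_pos he, mul_zero]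

lemma eLpNorm_radialPower (hn : 0 < n) (hS : MeasurableSet S) (hS0 : S ⊆ Ioi 0) {e : ℝ}
    (he : 0 < e) :
    eLpNorm (radialPower 𝕜 S s : EuclideanSpace ℝ (Fin n) → 𝕜) (ENNReal.ofReal e)
      (weightMeasure (fun x => ‖x‖ ^ γ) e) =
      (∫⁻ x in radialSet n S, ‖x‖ₑ ^ ((s + γ) * e)) ^ (1 / e) := by
  rw [eLpNorm_eq_recipNorm he, ← recipNorm_weightMeasure_norm_rpow hn hS hS0 he]
  simp_rw [enorm_radialPower hS0]

lemma mul_lintegral_le_eLpNorm {F : Type*} [TopologicalSpace F] [ESeminormedAddMonoid F]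
    (hn : 0 < n) (hS : MeasurableSet S) (hS0 : S ⊆ Ioi 0) {e : ℝ} (he : 0 < e) {c : ℝ≥0∞}
    {g : EuclideanSpace ℝ (Fin n) → F}
    (h : ∀ᵐ x, x ∈ radialSet n S → c * ‖x‖ₑ ^ s ≤ ‖g x‖ₑ) :
    c * (∫⁻ x in radialSet n S, ‖x‖ₑ ^ ((s + γ) * e)) ^ (1 / e) ≤
      eLpNorm g (ENNReal.ofReal e) (weightMeasure (fun x => ‖x‖ ^ γ) e) := by
  rw [eLpNorm_eq_recipNorm he, ← recipNorm_weightMeasure_norm_rpow hn hS hS0 he,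
    ← recipNorm_const_mul (by positivity) c
      ((measurable_enorm.pow_const _).indicator (measurableSet_radialSet hS))]
  refine recipNorm_mono_ae (by positivity)
    ((weightMeasure_absolutelyContinuous _ _).ae_le (h.mono fun x hx => ?_))
  by_cases hxS : x ∈ radialSet n S
  · rw [indicator_of_mem hxS]
    exact hx hxS
  · rw [indicator_of_notMem hxS, mul_zero]
    exact zero_le

lemma le_rieszKernel (hα : α ≤ n) {x y z : EuclideanSpace ℝ (Fin n)} (hxy : x ≠ y)
    (h : ‖x - y‖ ≤ 2 * ‖z‖) : ENNReal.ofReal (2 ^ (α - n)) * ‖z‖ₑ ^ (α - n) ≤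
      ENNReal.ofReal (‖x - y‖ ^ ((n : ℝ) - α))⁻¹ := by
  have hxy0 : 0 < ‖x - y‖ := norm_pos_iff.2 (sub_ne_zero.2 hxy)
  have hz : 0 < ‖z‖ := by linarith
  rw [← enorm_rpow_eq (norm_pos_iff.1 hz), ← ENNReal.ofReal_mul (by positivity),
    ← Real.mul_rpow zero_le_two hz.le, ← Real.rpow_neg hxy0.le, neg_sub]
  exact ENNReal.ofReal_le_ofReal (Real.rpow_le_rpow_of_nonpos hxy0 h (by linarith))

/-- The integrand is nonnegative, so no cancellation occurs. Integrability is needed because the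
Bochner integral of a non-integrable function is `0`. -/
lemma enorm_fracIntegral_radialPower (x : EuclideanSpace ℝ (Fin n))
    (hi : Integrable (rieszIntegrand α (radialPower 𝕜 S s : EuclideanSpace ℝ (Fin n) → 𝕜) x)) :
    ‖fracIntegral α (radialPower 𝕜 S s) x‖ₑ =
      rieszPotential α (radialPower 𝕜 S s : EuclideanSpace ℝ (Fin n) → 𝕜) x := by
  set g : EuclideanSpace ℝ (Fin n) → ℝ := fun y =>
    (radialSet n S).indicator (fun x => ‖x‖ ^ s) y / ‖x - y‖ ^ ((n : ℝ) - α)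
  have hg0 : ∀ y, 0 ≤ g y := fun y => div_nonneg
    (indicator_nonneg (fun y _ => by positivity) _) (by positivity)
  have hg : rieszIntegrand α (radialPower 𝕜 S s : EuclideanSpace ℝ (Fin n) → 𝕜) x =
      fun y => ((g y : ℝ) : 𝕜) := by
    funext y
    by_cases hy : y ∈ radialSet n S <;> simp [rieszIntegrand, radialPower, g, hy]
  have hnorm : ∀ y, ‖((g y : ℝ) : 𝕜)‖ = g y := fun y => by
    rw [RCLike.norm_ofReal, abs_of_nonneg (hg0 y)]
  rw [hg] at hi
  have hgi : Integrable g := by simpa only [hnorm] using hi.norm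
  rw [fracIntegral, hg, integral_ofReal, ← ofReal_norm, RCLike.norm_ofReal,
    abs_of_nonneg (integral_nonneg hg0), ofReal_integral_eq_lintegral_ofReal hgi (ae_of_all _ hg0)]
  refine lintegral_congr fun y => ?_
  rw [← enorm_rieszIntegrand, hg, ← ofReal_norm, hnorm]

lemma le_rieszPotential_radialPower (hS : MeasurableSet S) (hS0 : S ⊆ Ioi 0)
    {x : EuclideanSpace ℝ (Fin n)} {k : EuclideanSpace ℝ (Fin n) → ℝ≥0∞}
    (h : ∀ y ∈ radialSet n S, k y ≤ ENNReal.ofReal (‖x - y‖ ^ ((n : ℝ) - α))⁻¹) :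
    ∫⁻ y in radialSet n S, ‖y‖ₑ ^ s * k y ≤
      rieszPotential α (radialPower 𝕜 S s : EuclideanSpace ℝ (Fin n) → 𝕜) x := by
  rw [← lintegral_indicator (measurableSet_radialSet hS)]
  refine lintegral_mono fun y => ?_
  rw [enorm_radialPower hS0]
  by_cases hy : y ∈ radialSet n S
  · rw [indicator_of_mem hy, indicator_of_mem hy]
    exact mul_le_mul_right (h y hy) _
  · rw [indicator_of_notMem hy]
    exact zero_le

lemma Ioo_zero_subset_Ioi {R : ℝ} : Ioo 0 R ⊆ Ioi (0 : ℝ) := fun _ hy => hy.1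

lemma Ioi_one_subset_Ioi : Ioi 1 ⊆ Ioi (0 : ℝ) := Ioi_subset_Ioi zero_le_one

/-- Test with the cube of side `2‖x‖` centred at the origin: it contains the unit ball, where the
function has integral of order `1/δ`. -/
lemma le_fracMaximal_radialPower (hn : 0 < n) {δ : ℝ} (hδ : 0 < δ)
    {x : EuclideanSpace ℝ (Fin n)} (hx : x ∈ radialSet n (Ioi 1)) :
    ENNReal.ofReal (2 ^ (α - n) * (sphereArea n * δ⁻¹)) * ‖x‖ₑ ^ (α - n) ≤
      ‖fracMaximal α (radialPower 𝕜 (Ioo 0 1) (δ - n) : EuclideanSpace ℝ (Fin n) → 𝕜) x‖ₑ := by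
  have hn0 : (n : ℝ) ≠ 0 := by exact_mod_cast hn.ne'
  have hx1 : 1 < ‖x‖ := hx
  have hx0 : 0 < ‖x‖ := one_pos.trans hx1
  have hmem : ∀ y : EuclideanSpace ℝ (Fin n), ‖y‖ ≤ ‖x‖ →
      y ∈ cube (WithLp.toLp 2 fun _ : Fin n => -‖x‖) (2 * ‖x‖) := fun y hy i => by
    have h := abs_le.1 ((PiLp.norm_apply_le y i).trans hy)
    constructor <;> simp only <;> linarith
  rw [enorm_eq_self]
  refine le_trans ?_ (le_iSup₂_of_le (WithLp.toLp 2 fun _ : Fin n => -‖x‖) (2 * ‖x‖)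
    (le_iSup₂_of_le (by positivity) (hmem x le_rfl) le_rfl))
  have hint : ENNReal.ofReal (sphereArea n * δ⁻¹) ≤
      ∫⁻ y in cube (WithLp.toLp 2 fun _ : Fin n => -‖x‖) (2 * ‖x‖),
        ‖radialPower 𝕜 (Ioo 0 1) (δ - n) y‖ₑ := by
    have h := setLIntegral_radialSet_Ioo hn hδ one_pos
    rw [Real.one_rpow, one_div] at h
    rw [← h]
    simp_rw [enorm_radialPower Ioo_zero_subset_Ioi]
    rw [setLIntegral_indicator (measurableSet_radialSet measurableSet_Ioo)]
    refine lintegral_mono_set fun y hy => ⟨hy, hmem y ?_⟩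
    exact (hy.2.trans hx1).le
  rw [volume_cube, ← ENNReal.rpow_natCast, ← ENNReal.rpow_mul,
    show (n : ℝ) * (1 - α / n) = -(α - n) by field_simp; ring, ENNReal.rpow_neg, div_eq_mul_inv,
    inv_inv, ENNReal.ofReal_mul (by positivity), ENNReal.ofReal_mul zero_le_two,
    ENNReal.mul_rpow_of_ne_top ENNReal.ofReal_ne_top ENNReal.ofReal_ne_top, ofReal_norm,
    ENNReal.ofReal_rpow_of_pos zero_lt_two, mul_comm (ENNReal.ofReal _) (ENNReal.ofReal (_ * _)),
    mul_assoc]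
  exact mul_le_mul_left hint _

lemma le_fracIntegral_radialPower_of_one_lt (hn : 0 < n) (hα : α ≤ n) {δ : ℝ} (hδ : 0 < δ)
    {x : EuclideanSpace ℝ (Fin n)} (hx : x ∈ radialSet n (Ioi 1))
    (hi : Integrable (rieszIntegrand α
      (radialPower 𝕜 (Ioo 0 1) (δ - n) : EuclideanSpace ℝ (Fin n) → 𝕜) x)) :
    ENNReal.ofReal (2 ^ (α - n) * (sphereArea n * δ⁻¹)) * ‖x‖ₑ ^ (α - n) ≤
      ‖fracIntegral α (radialPower 𝕜 (Ioo 0 1) (δ - n) : EuclideanSpace ℝ (Fin n) → 𝕜) x‖ₑ := by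
  have hx1 : 1 < ‖x‖ := hx
  rw [enorm_fracIntegral_radialPower x hi]
  refine le_trans ?_ (le_rieszPotential_radialPower measurableSet_Ioo Ioo_zero_subset_Ioi
    (k := fun _ => ENNReal.ofReal (2 ^ (α - n)) * ‖x‖ₑ ^ (α - n)) fun y hy => ?_)
  · have h := setLIntegral_radialSet_Ioo hn hδ one_pos
    rw [Real.one_rpow, one_div] at h
    rw [lintegral_mul_const _ (measurable_enorm.pow_const _), h,
      ENNReal.ofReal_mul (by positivity)]
    exact le_of_eq (by ring)
  · have hy1 : ‖y‖ < 1 := hy.2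
    refine le_rieszKernel hα (fun h => ?_) ((norm_sub_le x y).trans (by linarith))
    rw [h] at hx1
    exact hx1.not_gt hy1

/-- For `‖x‖ < 1 < ‖y‖` one has `‖x - y‖ ≤ 2‖y‖`, so the kernel turns the integrand into
`|y|^(-ε-n)`, whose integral at infinity is of order `1/ε`. -/
lemma le_fracIntegral_radialPower_of_lt_one (hn : 0 < n) (hα : α ≤ n) {ε : ℝ} (hε : 0 < ε)
    {x : EuclideanSpace ℝ (Fin n)} (hx : x ∈ radialSet n (Ioo 0 1))
    (hi : Integrable (rieszIntegrand α
      (radialPower 𝕜 (Ioi 1) (-ε - α) : EuclideanSpace ℝ (Fin n) → 𝕜) x)) :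
    ENNReal.ofReal (2 ^ (α - n) * (sphereArea n * ε⁻¹)) ≤
      ‖fracIntegral α (radialPower 𝕜 (Ioi 1) (-ε - α) : EuclideanSpace ℝ (Fin n) → 𝕜) x‖ₑ := by
  have hx1 : ‖x‖ < 1 := hx.2
  rw [enorm_fracIntegral_radialPower x hi]
  refine le_trans ?_ (le_rieszPotential_radialPower measurableSet_Ioi Ioi_one_subset_Ioi
    (k := fun y => ENNReal.ofReal (2 ^ (α - n)) * ‖y‖ₑ ^ (α - n)) fun y hy => ?_)
  · rw [ENNReal.ofReal_mul (by positivity), ← setLIntegral_radialSet_Ioi hn hε,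
      ← lintegral_const_mul _ (measurable_enorm.pow_const _)]
    refine le_of_eq (setLIntegral_congr_fun (measurableSet_radialSet measurableSet_Ioi) ?_)
    intro y hy
    have hy0 : ‖y‖ₑ ≠ 0 := enorm_ne_zero.2 (norm_pos_iff.1 (Ioi_one_subset_Ioi hy))
    simp only
    rw [mul_left_comm, ← ENNReal.rpow_add _ _ hy0 enorm_ne_top]
    congr 2; ring
  · have hy1 : 1 < ‖y‖ := hy
    refine le_rieszKernel hα (fun h => ?_) ((norm_sub_le x y).trans (by linarith))
    rw [h] at hx1
    exact hx1.not_gt hy1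

end Sharpness

/-! ### Sharpness of the exponents -/

section SharpExponents

variable {𝕜 : Type*} [RCLike 𝕜] {n : ℕ} {α p q β : ℝ}

lemma conjExponent_pos (hp : 1 < p) : 0 < p.conjExponent := by
  rw [conjExponent_eq hp, inv_pos, sub_pos, one_div]
  exact inv_lt_one_of_one_lt₀ hp

lemma one_div_conjExponent (hp : 1 < p) : 1 / p.conjExponent = 1 - 1 / p := by
  rw [conjExponent_eq hp, one_div, inv_inv]

lemma one_sub_div_pos (hαn : α < n) (hn : 0 < n) : 0 < 1 - α / n := by
  rw [sub_pos, div_lt_one (by exact_mod_cast hn)]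
  exact hαn

lemma one_div_le_one_div_of_eq (hα0 : 0 ≤ α) (hq : 1 / q = 1 / p - α / n) : 1 / q ≤ 1 / p := by
  rw [hq]
  exact sub_le_self _ (by positivity)

/-- Serves both operators. For `w = |x|^((n-δ)/p')` the test function has norm of order `δ^(-1/p)`
and its image at least of order `δ^(-1-1/q)`, so the operator norm grows like `δ^(-(1-α/n))`, while
`[w]` is at most of order `δ^(-q/p')`. -/
lemma exponent_le_of_lower_bound {F : Type*} [TopologicalSpace F] [ESeminormedAddMonoid F]
    (hn : 0 < n) (hα0 : 0 ≤ α) (hαn : α < n) (hp : 1 < p) (hpα : p * α < n)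
    (hq : 1 / q = 1 / p - α / n)
    {T : (EuclideanSpace ℝ (Fin n) → 𝕜) → EuclideanSpace ℝ (Fin n) → F}
    (hT : WeightedBound p q β T)
    (h : ∀ δ, 0 < δ → ∀ w : EuclideanSpace ℝ (Fin n) → ℝ, IsApqWeight p q w →
      MemLp (radialPower 𝕜 (Ioo 0 1) (δ - n)) (ENNReal.ofReal p) (weightMeasure w p) →
      ∀ᵐ x : EuclideanSpace ℝ (Fin n), x ∈ radialSet n (Ioi 1) →
        ENNReal.ofReal (2 ^ (α - n) * (sphereArea n * δ⁻¹)) * ‖x‖ₑ ^ (α - n) ≤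
          ‖T (radialPower 𝕜 (Ioo 0 1) (δ - n)) x‖ₑ) :
    p.conjExponent / q * (1 - α / n) ≤ β := by
  have hn0 : (0 : ℝ) < n := by exact_mod_cast hn
  have hq0 := exponent_pos hp hpα hn hq
  have hp0 : 0 < p := one_pos.trans hp
  have hP0 := conjExponent_pos hp
  have hP := one_div_conjExponent hp
  have hr := one_sub_div_pos hαn hn
  have hS := sphereArea_pos hn
  obtain ⟨C, hC0, hC⟩ := exists_positive_power_weight hn hP0 hq0
  have hnorm : ∀ δ, 0 < δ → eLpNorm (radialPower 𝕜 (Ioo 0 1) (δ - n)) (ENNReal.ofReal p)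
      (weightMeasure (fun x : EuclideanSpace ℝ (Fin n) => ‖x‖ ^ ((n - δ) / p.conjExponent)) p) =
        ENNReal.ofReal (sphereArea n ^ (1 / p) * δ ^ (-(1 / p))) := fun δ hδ => by
    have he : (δ - n + (n - δ) / p.conjExponent) * p = δ - n := by
      rw [div_eq_mul_one_div, hP]; field_simp; ring
    rw [eLpNorm_radialPower hn measurableSet_Ioo Ioo_zero_subset_Ioi hp0, he,
      setLIntegral_radialSet_Ioo hn hδ one_pos, Real.one_rpow, one_div,
      ENNReal.ofReal_rpow_of_nonneg (by positivity) (by positivity),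
      Real.mul_rpow hS.le (by positivity), Real.inv_rpow hδ.le, Real.rpow_neg hδ.le]
  have hmem : ∀ δ, 0 < δ → MemLp (radialPower 𝕜 (Ioo 0 1) (δ - n)) (ENNReal.ofReal p)
      (weightMeasure (fun x : EuclideanSpace ℝ (Fin n) => ‖x‖ ^ ((n - δ) / p.conjExponent)) p) :=
    fun δ hδ => ⟨(measurable_radialPower measurableSet_Ioo).aestronglyMeasurable,
      (hnorm δ hδ).trans_lt ENNReal.ofReal_lt_top⟩
  have key : 1 - α / n ≤ q / p.conjExponent * β := by
    refine hT.le_mul (e := 1 / p) (c₁ := sphereArea n ^ (1 / p))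
      (c₂ := 2 ^ (α - n) * sphereArea n * (sphereArea n * (q / p.conjExponent)⁻¹) ^ (1 / q))
      hr hC0 (by positivity) (by positivity) hC
      (fun v hv => hv.one_le hp hq0 (one_div_le_one_div_of_eq hα0 hq))
      (fun δ hδ _ => ⟨hmem δ hδ, (hnorm δ hδ).le⟩) fun δ hδ hδ1 => ?_
    refine le_trans (le_of_eq ?_) (mul_lintegral_le_eLpNorm hn measurableSet_Ioi
      Ioi_one_subset_Ioi hq0 (h δ hδ _ (hC δ hδ hδ1).1 (hmem δ hδ)))
    have hnα : ((n : ℝ) - α) * q = n + n * (q / p.conjExponent) := by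
      have h1 : (n : ℝ) - α = n * (1 / q + 1 / p.conjExponent) := by
        rw [hq, hP]; field_simp; ring
      rw [h1]; field_simp
    have he : (α - n + (n - δ) / p.conjExponent) * q = -(δ * (q / p.conjExponent)) - n := by
      have : (α - n + (n - δ) / p.conjExponent) * q =
        -(((n : ℝ) - α) * q) + (n - δ) * (q / p.conjExponent) := by ring
      rw [this, hnα]; ring
    rw [he, setLIntegral_radialSet_Ioi hn (by positivity),
      ENNReal.ofReal_rpow_of_nonneg (by positivity) (by positivity),
      ← ENNReal.ofReal_mul (by positivity)]
    congr 1
    have h2 : -(1 / p + (1 - α / n)) = -1 + -(1 / q) := by rw [hq]; ring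
    rw [h2, Real.rpow_add hδ, Real.rpow_neg_one, mul_inv, mul_left_comm (sphereArea n) δ⁻¹,
      Real.mul_rpow (x := δ⁻¹) (by positivity) (by positivity), Real.inv_rpow hδ.le,
      Real.rpow_neg hδ.le]
    ring
  rw [div_mul_eq_mul_div, div_le_iff₀ hq0]
  calc p.conjExponent * (1 - α / n) ≤ p.conjExponent * (q / p.conjExponent * β) := by gcongr
    _ = β * q := by field_simp

/-- The counterpart of the previous example with singularity and decay exchanged: the test function
lives outside the unit ball, its image is estimated inside, and the singular factor is `w^q`. The
operator norm again grows like `δ^(-(1-α/n))`, but now `[w]` is at most of order `1/δ`. -/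
lemma exponent_le_of_fracIntegral_bound (hn : 0 < n) (hα0 : 0 < α) (hαn : α < n) (hp : 1 < p)
    (hpα : p * α < n) (hq : 1 / q = 1 / p - α / n)
    (hT : WeightedBound p q β (fun f : EuclideanSpace ℝ (Fin n) → 𝕜 => fracIntegral α f)) :
    1 - α / n ≤ β := by
  have hn0 : (0 : ℝ) < n := by exact_mod_cast hn
  have hq0 := exponent_pos hp hpα hn hq
  have hp0 : 0 < p := one_pos.trans hp
  have hP0 := conjExponent_pos hp
  have hP := one_div_conjExponent hp
  have hr := one_sub_div_pos hαn hn
  have hS := sphereArea_pos hn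
  have hqp := one_div_le_one_div_of_eq hα0.le hq
  have hq1 : 1 ≤ q := hp.le.trans ((one_div_le_one_div hq0 hp0).1 hqp)
  obtain ⟨C, hC0, hC⟩ := exists_negative_power_weight hn hP0 hq1
  obtain ⟨_, hI⟩ := exists_fracIntegral_bound (𝕜 := 𝕜) hn hα0 hp hpα hq
  set b := p.conjExponent / q with hb
  have hb0 : 0 < b := by positivity
  have hnorm : ∀ δ, 0 < δ → eLpNorm (radialPower 𝕜 (Ioi 1) (-(δ * b) - α)) (ENNReal.ofReal p)
      (weightMeasure (fun x : EuclideanSpace ℝ (Fin n) => ‖x‖ ^ (-(n - δ) / q)) p) =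
        ENNReal.ofReal ((sphereArea n * b⁻¹) ^ (1 / p) * δ ^ (-(1 / p))) := fun δ hδ => by
    -- The choice `b = p'/q` makes the exponent of `(f w)^p` equal to `-(δ b) - n`, barely
    -- integrable at infinity.
    have he : (-(δ * b) - α + -(n - δ) / q) * p = -(δ * b) - n := by
      have h1 : α = n * (1 / p - 1 / q) := by rw [hq]; field_simp; ring
      have h2 : b = p / ((p - 1) * q) := by rw [hb, Real.conjExponent, div_div]
      have h3 : p - 1 ≠ 0 := by linarith
      rw [h1, h2]
      field_simp
      ring
    rw [eLpNorm_radialPower hn measurableSet_Ioi Ioi_one_subset_Ioi hp0, he,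
      setLIntegral_radialSet_Ioi hn (by positivity),
      ENNReal.ofReal_rpow_of_nonneg (by positivity) (by positivity), mul_inv,
      mul_left_comm, mul_comm δ⁻¹, Real.mul_rpow (y := δ⁻¹) (by positivity) (by positivity),
      Real.inv_rpow hδ.le, Real.rpow_neg hδ.le]
  have hmem : ∀ δ, 0 < δ → MemLp (radialPower 𝕜 (Ioi 1) (-(δ * b) - α)) (ENNReal.ofReal p)
      (weightMeasure (fun x : EuclideanSpace ℝ (Fin n) => ‖x‖ ^ (-(n - δ) / q)) p) :=
    fun δ hδ => ⟨(measurable_radialPower measurableSet_Ioi).aestronglyMeasurable,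
      (hnorm δ hδ).trans_lt ENNReal.ofReal_lt_top⟩
  have key : 1 - α / n ≤ 1 * β := by
    refine hT.le_mul (e := 1 / p) (c₁ := (sphereArea n * b⁻¹) ^ (1 / p))
      (c₂ := 2 ^ (α - n) * (sphereArea n * b⁻¹) * sphereArea n ^ (1 / q))
      hr hC0 (by positivity) (by positivity) hC
      (fun v hv => hv.one_le hp hq0 hqp)
      (fun δ hδ _ => ⟨hmem δ hδ, (hnorm δ hδ).le⟩) fun δ hδ hδ1 => ?_
    refine le_trans (le_of_eq ?_) (mul_lintegral_le_eLpNorm (s := 0)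
      (c := ENNReal.ofReal (2 ^ (α - n) * (sphereArea n * (δ * b)⁻¹))) hn measurableSet_Ioo
      (Ioo_zero_subset_Ioi (R := 1)) hq0 ?_)
    · rw [zero_add, div_mul_cancel₀ _ hq0.ne', neg_sub,
        setLIntegral_radialSet_Ioo hn hδ one_pos, Real.one_rpow, one_div δ,
        ENNReal.ofReal_rpow_of_nonneg (by positivity) (by positivity),
        ← ENNReal.ofReal_mul (by positivity)]
      congr 1
      have h2 : -(1 / p + (1 - α / n)) = -1 + -(1 / q) := by rw [hq]; ring
      rw [h2, Real.rpow_add hδ, Real.rpow_neg_one, mul_inv,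
        Real.mul_rpow (y := δ⁻¹) (by positivity) (by positivity), Real.inv_rpow hδ.le,
        Real.rpow_neg hδ.le]
      ring
    · filter_upwards [(hI _ (hC δ hδ hδ1).1 _ (hmem δ hδ)).1] with x hx hxS
      rw [ENNReal.rpow_zero, mul_one]
      exact le_fracIntegral_radialPower_of_lt_one hn hαn.le (by positivity) hxS hx
  rwa [one_mul] at key

end SharpExponents

end FracOp

end

end

theorem proposition5p1 (𝕜 : Type*) [RCLike 𝕜] (n : ℕ) (α p q : ℝ)
    (hα0 : 0 ≤ α) (hαn : α < n) (hp : 1 < p) (hpα : p * α < n)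
    (hq : 1 / q = 1 / p - α / n) :
    -- the fractional maximal operator: measurability, bound, sharpness
    ((∀ w : EuclideanSpace ℝ (Fin n) → ℝ, FracOp.IsApqWeight p q w →
        ∀ f : EuclideanSpace ℝ (Fin n) → 𝕜,
          MemLp f (ENNReal.ofReal p) (FracOp.weightMeasure w p) →
            MemLp (FracOp.fracMaximal α f) (ENNReal.ofReal q) (FracOp.weightMeasure w q)) ∧
      FracOp.WeightedBound p q (p.conjExponent / q * (1 - α / n))
        (fun f : EuclideanSpace ℝ (Fin n) → 𝕜 => FracOp.fracMaximal α f) ∧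
      ∀ β : ℝ,
        FracOp.WeightedBound p q β
          (fun f : EuclideanSpace ℝ (Fin n) → 𝕜 => FracOp.fracMaximal α f) →
        p.conjExponent / q * (1 - α / n) ≤ β) ∧
    -- the fractional integral: absolute convergence, bound, sharpness
    (0 < α →
      (∀ w : EuclideanSpace ℝ (Fin n) → ℝ, FracOp.IsApqWeight p q w →
        ∀ f : EuclideanSpace ℝ (Fin n) → 𝕜,
          MemLp f (ENNReal.ofReal p) (FracOp.weightMeasure w p) →
            (∀ᵐ x, Integrable (FracOp.rieszIntegrand α f x)) ∧
            MemLp (FracOp.fracIntegral α f) (ENNReal.ofReal q) (FracOp.weightMeasure w q)) ∧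
      FracOp.WeightedBound p q ((1 - α / n) * max 1 (p.conjExponent / q))
        (fun f : EuclideanSpace ℝ (Fin n) → 𝕜 => FracOp.fracIntegral α f) ∧
      ∀ β : ℝ,
        FracOp.WeightedBound p q β
          (fun f : EuclideanSpace ℝ (Fin n) → 𝕜 => FracOp.fracIntegral α f) →
        (1 - α / n) * max 1 (p.conjExponent / q) ≤ β) := by
  have hn : 0 < n := by exact_mod_cast hα0.trans_lt hαn
  have hr := FracOp.one_sub_div_pos hαn hn
  have hq0 := FracOp.exponent_pos hp hpα hn hq
  have hP0 := FracOp.conjExponent_pos hp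
  refine ⟨?_, fun hα => ?_⟩
  · obtain ⟨C, hC⟩ := FracOp.exists_fracMaximal_eLpNorm_le (𝕜 := 𝕜) hn hα0 hp hpα hq
    refine ⟨fun w hw f hf => ⟨?_, (hC w hw f hf).trans_lt ?_⟩,
      FracOp.weightedBound_of_eLpNorm_le hC, fun β hβ => ?_⟩
    · exact (FracOp.lowerSemicontinuous_fracMaximal hr.le).measurable.aestronglyMeasurable
    · exact ENNReal.mul_lt_top (ENNReal.mul_lt_top ENNReal.coe_lt_top
        (ENNReal.rpow_lt_top_of_nonneg (by positivity) hw.apqConst_lt_top.ne)) hf.2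
    · exact FracOp.exponent_le_of_lower_bound hn hα0 hαn hp hpα hq hβ fun δ hδ w _ _ =>
        ae_of_all _ fun x hx => FracOp.le_fracMaximal_radialPower hn hδ hx
  · obtain ⟨C, hC⟩ := FracOp.exists_fracIntegral_bound (𝕜 := 𝕜) hn hα hp hpα hq
    refine ⟨fun w hw f hf => ⟨(hC w hw f hf).1, (hC w hw f hf).2.1⟩,
      FracOp.weightedBound_of_eLpNorm_le fun w hw f hf => (hC w hw f hf).2.2, fun β hβ => ?_⟩
    rw [mul_max_of_nonneg _ _ hr.le, mul_one, mul_comm _ (p.conjExponent / q)]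
    refine max_le (FracOp.exponent_le_of_fracIntegral_bound hn hα hαn hp hpα hq hβ)
      (FracOp.exponent_le_of_lower_bound hn hα0 hαn hp hpα hq hβ fun δ hδ w hw hf => ?_)
    filter_upwards [(hC w hw _ hf).1] with x hx hxS
    exact FracOp.le_fracIntegral_radialPower_of_one_lt hn hαn.le hδ hxS hx
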